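/- **Connected Dominating Set parameterized by modular-treewidth.** *Problem.* An instance consists of a nonempty finite undirected graph $G=(V,E)$, a cost function $\mathbf c\colon V\to\mathbb N\setminus\{0\}$ and an integer $\overline b$. The question is whether there is a connected dominating set of cost at most $\overline b$, i.e. a set $X\subseteq V$ with $N_G[X]=V$, $G[X]$ connected (in particular nonempty) and $\mathbf c(X)=\sum_{v\in X}\mathbf c(v)\le\overline b$. The costs are assumed to be polynomially bounded in $|V|$ for the running time. *Modular decomposition.* A set $M\subseteq V$ is a module of $G$ if $N(v)\setminus M=N(w)\setminus M$ for all $v,w\in M$; it is strong if every module $M'$ satisfies $M\cap M'=\emptyset$, $M\subseteq M'$ or $M'\subseteq M$. The nodes of the modular decomposition are the nonempty strong modules. If $|V|\ge 2$, then $\Pi_{mod}(G)$ is the partition of $V$ into the inclusion-maximal nonempty proper strong modules, and $G/\Pi_{mod}(G)$ is the quotient graph, in which two distinct parts are adjacent if $G$ has an edge between them. The quotient graph at a node $M$ with $|M|\ge2$ is $G^q_M=G[M]/\Pi_{mod}(G[M])$. The node is a prime node if $G^q_M$ has at least three vertices and its only modules are $\emptyset$, the whole vertex set and the singletons; it is a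 series node if the complement of $G[M]$ is disconnected and $G^q_M$ is a clique. A weight function $\mathbf w\colon V\to\mathbb N$ isolates a family $\mathcal F$ of subsets of $V$ if exactly one member of $\mathcal F$ has minimum weight. Optimum connected dominating sets are those of minimum cost. *Theorem.* 1. There is a Monte-Carlo algorithm (a single program for a random access machine with fair coin tosses and logarithmic costs) that, given $(G,\mathbf c,\overline b)$ and a tree decomposition of $G^q_M$ for every prime node $M$ of the modular decomposition of $G$, solves Connected Dominating Set as follows. It never answers yes on a no-instance, and it answers no on a yes-instance with probability at most $1/2$. For every polynomial $p$ there is a polynomial $q$ such that for every $k$, on every input of bit length $N$ in which all costs are at most $p(|V|)$ and all given tree decompositions have width at most $k$, the algorithm halts within time $4^k\cdot q(N)$, whatever the outcomes of the coin tosses; that is, its running time is $\mathcal O^*(4^k)$. 2. (Recursion at series nodes.) Let $G$ be a finite graph with at least two vertices such that $V$ is a series node, and let $\mathbf c\colon V\to\mathbb N$. For every integer $b$, $G$ has a connected dominating set of cost at most $b$ if and only if there are distinct $M,N\in\Pi_{mod}(G)$, $x\in M$ and $y\in N$ with $\mathbf c(x)+\mathbf c(y)\le b$, or some $G[M]$ with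 $M\in\Pi_{mod}(G)$ has a connected dominating set of cost at most $b$. If $\mathbf w\colon V\to\mathbb N$ isolates the optimum connected dominating sets of $(G,\mathbf c)$ and the one of minimum weight is contained in $M\in\Pi_{mod}(G)$, then $\mathbf w|_M$ isolates the optimum connected dominating sets of $(G[M],\mathbf c|_M)$. 3. (Reduction at prime nodes.) Let $G$ be a finite graph such that $V$ is a prime node, with quotient graph $G^q$, let $\mathbf c\colon V\to\mathbb N\setminus\{0\}$ and $\mathbf w\colon V\to\mathbb N$. For every $M\in\Pi_{mod}(G)$ let $r(M)\in M$ minimize $(\mathbf c(v),\mathbf w(v))$ lexicographically over $v\in M$, and put $\mathbf c^q(M)=\mathbf c(r(M))$ and $\mathbf w^q(M)=\mathbf w(r(M))$. - If $X$ is an optimum connected dominating set of $(G,\mathbf c)$, then $X^q=\{M\in\Pi_{mod}(G): M\cap X\neq\emptyset\}$ is a connected dominating set of $G^q$ with $\mathbf c^q(X^q)=\mathbf c(X)$. - If $X^q$ is an optimum connected dominating set of $(G^q,\mathbf c^q)$, then $X=\{r(M):M\in X^q\}$ is a connected dominating set of $G$ with $\mathbf c(X)=\mathbf c^q(X^q)$.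 - If $\mathbf w$ isolates the optimum connected dominating sets of $(G,\mathbf c)$, then $\mathbf w^q$ isolates the optimum connected dominating sets of $(G^q,\mathbf c^q)$. -/

import Mathlib

namespace CDSModTW

/-! ### Modules and quotient graphs -/

section Modules

variable {V : Type*}

/-- A vertex set `M` is a module if all its vertices have the same neighbours outside `M`. -/
def IsModule (G : SimpleGraph V) (M : Set V) : Prop :=
  ∀ v ∈ M, ∀ w ∈ M, G.neighborSet v \ M = G.neighborSet w \ M

/-- A strong module is comparable to, or disjoint from, every module. -/
def IsStrongModule (G : SimpleGraph V) (M : Set V) : Prop :=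
  IsModule G M ∧ ∀ N, IsModule G N → Disjoint M N ∨ M ⊆ N ∨ N ⊆ M

/-- The nodes of the modular decomposition tree: the nonempty strong modules. -/
def modularTree (G : SimpleGraph V) : Set (Set V) :=
  {M | IsStrongModule G M ∧ M.Nonempty}

/-- The canonical modular partition: the inclusion-maximal nonempty proper strong modules. -/
def canonicalPartition (G : SimpleGraph V) : Set (Set V) :=
  {M | Maximal (fun N : Set V => IsStrongModule G N ∧ N.Nonempty ∧ N ≠ Set.univ) M}

/-- The quotient of `G` by a family `P` of (disjoint) vertex sets. -/
def quotientGraph (G : SimpleGraph V) (P : Set (Set V)) : SimpleGraph P where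
  Adj A B := A ≠ B ∧ ∃ u ∈ A.1, ∃ v ∈ B.1, G.Adj u v
  symm := ⟨fun _ _ h => ⟨h.1.symm, by
    obtain ⟨_, u, hu, v, hv, huv⟩ := h
    exact ⟨v, hv, u, hu, huv.symm⟩⟩⟩
  loopless := ⟨fun _ h => h.1 rfl⟩

/-- The quotient of `G` by its canonical modular partition. The quotient graph at a node `M` of the
modular decomposition tree is `modularQuotient (G.induce M)`. -/
def modularQuotient (G : SimpleGraph V) : SimpleGraph (canonicalPartition G) :=
  quotientGraph G (canonicalPartition G)

/-- A prime graph has only the trivial modules. As usual the graphs with at most two vertices are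
not counted as prime, so that series, parallel and prime nodes exclude each other. -/
def IsPrimeGraph (G : SimpleGraph V) : Prop :=
  3 ≤ Nat.card V ∧
    ∀ M : Set V, IsModule G M → M = ∅ ∨ M = Set.univ ∨ ∃ v, M = {v}

/-- A prime node of the modular decomposition tree of `G`. -/
def IsPrimeNode (G : SimpleGraph V) (M : Set V) : Prop :=
  M ∈ modularTree G ∧ IsPrimeGraph (modularQuotient (G.induce M))

/-- The root of the modular decomposition tree of `G` is a series node. -/
def IsSeries (G : SimpleGraph V) : Prop :=
  2 ≤ Nat.card V ∧ ¬ Gᶜ.Connected ∧ modularQuotient G = ⊤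

/-- The canonical projection of a vertex set to the quotient graph: the parts that it meets. -/
noncomputable def projection [Finite V] (G : SimpleGraph V) (X : Finset V) :
    Finset (canonicalPartition G) :=
  (Set.toFinite {P : canonicalPartition G | ∃ x ∈ X, x ∈ P.1}).toFinset

end Modules

/-- A tree decomposition of `G`, with bags indexed by `Fin size`. -/
structure TreeDecomposition {V : Type*} (G : SimpleGraph V) where
  size : ℕ
  tree : SimpleGraph (Fin size)
  isTree : tree.IsTree
  bag : Fin size → Finset V
  vertex_mem : ∀ v, ∃ t, v ∈ bag t
  edge_mem : ∀ u v, G.Adj u v → ∃ t, u ∈ bag t ∧ v ∈ bag t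
  connected : ∀ v, (tree.induce {t | v ∈ bag t}).Connected

/-- The width, i.e. the largest size of a bag minus one, is at most `k`. -/
def TreeDecomposition.WidthAtMost {V : Type*} {G : SimpleGraph V} (D : TreeDecomposition G)
    (k : ℕ) : Prop :=
  ∀ t, (D.bag t).card ≤ k + 1

/-! ### Connected dominating sets and isolation -/

section CDS

variable {V : Type*}

/-- `X` is a connected dominating set of `G`. -/
def IsCDS (G : SimpleGraph V) (X : Finset V) : Prop :=
  (∀ v, v ∈ X ∨ ∃ u ∈ X, G.Adj u v) ∧ (G.induce (X : Set V)).Connected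

/-- `G` has a connected dominating set of cost at most `b`. -/
def HasCDS (G : SimpleGraph V) (c : V → ℕ) (b : ℤ) : Prop :=
  ∃ X : Finset V, IsCDS G X ∧ ((∑ v ∈ X, c v : ℕ) : ℤ) ≤ b

/-- The family of connected dominating sets of minimum cost. -/
def optimumCDS (G : SimpleGraph V) (c : V → ℕ) : Set (Finset V) :=
  {X | IsCDS G X ∧ ∀ Y, IsCDS G Y → ∑ v ∈ X, c v ≤ ∑ v ∈ Y, c v}

/-- `S` is a member of `F` of minimum weight. -/
def IsMinWeight (w : V → ℕ) (F : Set (Finset V)) (S : Finset V) : Prop :=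
  S ∈ F ∧ ∀ T ∈ F, ∑ v ∈ S, w v ≤ ∑ v ∈ T, w v

/-- The weight function `w` isolates the family `F`. -/
def Isolates (w : V → ℕ) (F : Set (Finset V)) : Prop :=
  ∃! S, IsMinWeight w F S

end CDS

/-! ### A probabilistic random access machine with logarithmic costs -/

/-- The arithmetic operations and tests of the machine. -/
inductive Op
  | add | sub | mul | div | lt | eq

/-- Subtraction is truncated, division is rounded down; a test returns `1` or `0`. -/
def Op.eval : Op → ℕ → ℕ → ℕ
  | .add, a, b => a + b
  | .sub, a, b => a - b
  | .mul, a, b => a * b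
  | .div, a, b => a / b
  | .lt, a, b => if a < b then 1 else 0
  | .eq, a, b => if a = b then 1 else 0

/-- Expressions over constants, registers and array cells. Names of registers and of arrays are
numerals in the program text; array cells are addressed by computed values. -/
inductive Expr
  | const (a : ℕ)
  | reg (r : ℕ)
  | load (arr : ℕ) (e : Expr)
  | op (o : Op) (e₁ e₂ : Expr)

/-- Programs. `flip r` tosses a fair coin and stores the outcome in register `r`. -/
inductive Program
  | skip
  | assign (r : ℕ) (e : Expr)
  | store (arr : ℕ) (address value : Expr)
  | flip (r : ℕ)
  | seq (p q : Program)
  | ite (test : Expr) (p q : Program)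
  | while (test : Expr) (body : Program)

/-- The memory, and the number of coins tossed so far. -/
structure State where
  reg : ℕ → ℕ
  arr : ℕ → ℕ → ℕ
  tossed : ℕ

def Expr.eval (s : State) : Expr → ℕ
  | .const a => a
  | .reg r => s.reg r
  | .load a e => s.arr a (e.eval s)
  | .op o e₁ e₂ => o.eval (e₁.eval s) (e₂.eval s)

/-- The logarithmic cost of evaluating an expression: every operation is charged the bit lengths
of all values and addresses that it handles. -/
def Expr.cost (s : State) : Expr → ℕ
  | .const a => a.size + 1
  | .reg r => (s.reg r).size + 1
  | .load a e => e.cost s + (e.eval s).size + (s.arr a (e.eval s)).size + 1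
  | .op _ e₁ e₂ => e₁.cost s + e₂.cost s + (e₁.eval s).size + (e₂.eval s).size + 1

def State.setReg (s : State) (r a : ℕ) : State :=
  { s with reg := Function.update s.reg r a }

def State.setArr (s : State) (i j a : ℕ) : State :=
  { s with arr := Function.update s.arr i (Function.update (s.arr i) j a) }

/-- `Exec ω p s t s'`: started in the state `s` and with the coin tosses `ω`, the program `p` halts
in the state `s'` after time `t`. -/
inductive Exec (ω : ℕ → Bool) : Program → State → ℕ → State → Prop
  | skip (s) : Exec ω .skip s 1 s
  | assign (r e s) :
      Exec ω (.assign r e) s (e.cost s + (e.eval s).size + 1) (s.setReg r (e.eval s))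
  | store (a e₁ e₂ s) :
      Exec ω (.store a e₁ e₂) s
        (e₁.cost s + e₂.cost s + (e₁.eval s).size + (e₂.eval s).size + 1)
        (s.setArr a (e₁.eval s) (e₂.eval s))
  | flip (r s) :
      Exec ω (.flip r) s 1
        { s.setReg r (ω s.tossed).toNat with tossed := s.tossed + 1 }
  | seq {p q s₁ t₁ s₂ t₂ s₃} :
      Exec ω p s₁ t₁ s₂ → Exec ω q s₂ t₂ s₃ → Exec ω (.seq p q) s₁ (t₁ + t₂) s₃
  | ite_true {e p q s t s'} :
      e.eval s ≠ 0 → Exec ω p s t s' →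
        Exec ω (.ite e p q) s (e.cost s + (e.eval s).size + 1 + t) s'
  | ite_false {e p q s t s'} :
      e.eval s = 0 → Exec ω q s t s' →
        Exec ω (.ite e p q) s (e.cost s + (e.eval s).size + 1 + t) s'
  | while_true {e p s₁ t₁ s₂ t₂ s₃} :
      e.eval s₁ ≠ 0 → Exec ω p s₁ t₁ s₂ → Exec ω (.while e p) s₂ t₂ s₃ →
        Exec ω (.while e p) s₁ (e.cost s₁ + (e.eval s₁).size + 1 + t₁ + t₂) s₃
  | while_false {e p s} :
      e.eval s = 0 → Exec ω (.while e p) s (e.cost s + (e.eval s).size + 1) s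

/-- The machine is deterministic once the coin tosses are fixed. -/
theorem Exec.unique {ω : ℕ → Bool} {p : Program} {s : State} {t t' : ℕ} {s₁ s₂ : State}
    (h₁ : Exec ω p s t s₁) (h₂ : Exec ω p s t' s₂) : t = t' ∧ s₁ = s₂ := by
  induction h₁ generalizing t' s₂ with
  | skip | assign | store | flip => cases h₂; exact ⟨rfl, rfl⟩
  | seq _ _ ih₁ ih₂ =>
    cases h₂ with
    | seq a b =>
      obtain ⟨rfl, rfl⟩ := ih₁ a
      obtain ⟨rfl, rfl⟩ := ih₂ b
      exact ⟨rfl, rfl⟩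
  | ite_true h _ ih =>
    cases h₂ with
    | ite_true _ a => obtain ⟨rfl, rfl⟩ := ih a; exact ⟨rfl, rfl⟩
    | ite_false h' _ => exact absurd h' h
  | ite_false h _ ih =>
    cases h₂ with
    | ite_true h' _ => exact absurd h h'
    | ite_false _ a => obtain ⟨rfl, rfl⟩ := ih a; exact ⟨rfl, rfl⟩
  | while_true h _ _ ih₁ ih₂ =>
    cases h₂ with
    | while_true _ a b =>
      obtain ⟨rfl, rfl⟩ := ih₁ a
      obtain ⟨rfl, rfl⟩ := ih₂ b
      exact ⟨rfl, rfl⟩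
    | while_false h' => exact absurd h' h
  | while_false h =>
    cases h₂ with
    | while_true h' _ _ => exact absurd h h'
    | while_false _ => exact ⟨rfl, rfl⟩

/-- The start state: the input word is in array `0`, everything else is zero. -/
def State.start (x : List ℕ) : State where
  reg := fun _ => 0
  arr := fun a i => if a = 0 then x.getD i 0 else 0
  tossed := 0

/-- On the input `x` and with the coin tosses `ω`, the program halts within time `T`. -/
def HaltsWithin (p : Program) (ω : ℕ → Bool) (x : List ℕ) (T : ℕ) : Prop :=
  ∃ t s, Exec ω p (State.start x) t s ∧ t ≤ T

/-- On the input `x` and with the coin tosses `ω`, the program halts and answers yes, i.e. with a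
nonzero value in register `0`. -/
def Accepts (p : Program) (ω : ℕ → Bool) (x : List ℕ) : Prop :=
  ∃ t s, Exec ω p (State.start x) t s ∧ s.reg 0 ≠ 0

/-- The distribution of an infinite sequence of independent fair coin tosses. -/
noncomputable def coinMeasure : MeasureTheory.Measure (ℕ → Bool) :=
  MeasureTheory.Measure.infinitePi fun _ : ℕ => (PMF.uniformOfFintype Bool).toMeasure

/-- The number of bits of an input word, with a delimiter for every entry. -/
def bitLength (x : List ℕ) : ℕ :=
  (x.map fun a => a.size + 1).sum

/-! ### Inputs -/

/-- A connected dominating set instance with vertex set `Fin n`, together with a list of tree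
decompositions of prime quotient graphs, in any order, in which every prime node occurs. -/
structure Input where
  n : ℕ
  pos : 0 < n
  graph : SimpleGraph (Fin n)
  cost : Fin n → ℕ
  cost_pos : ∀ v, 0 < cost v
  budget : ℤ
  decs : List ((M : {M : Set (Fin n) // IsPrimeNode graph M}) ×
    TreeDecomposition (modularQuotient (graph.induce M.1)))
  complete : ∀ M : {M : Set (Fin n) // IsPrimeNode graph M}, ∃ D ∈ decs, D.1 = M

open Classical in
/-- The 0-1 vector of a predicate. -/
noncomputable def bits {m : ℕ} (p : Fin m → Prop) : List ℕ :=
  List.ofFn fun i => if p i then 1 else 0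

/-- The adjacency matrix, row by row. -/
noncomputable def encodeGraph {m : ℕ} (G : SimpleGraph (Fin m)) : List ℕ :=
  (List.finRange m).flatMap fun i => bits (G.Adj i)

/-- A node `M` with a tree decomposition of its quotient graph: the vertices of `M`, the number of
bags, the tree, and for every bag the union of the child modules that it contains. -/
noncomputable def encodeDec {n : ℕ} {G : SimpleGraph (Fin n)} (M : Set (Fin n))
    (D : TreeDecomposition (modularQuotient (G.induce M))) : List ℕ :=
  bits (fun v => v ∈ M) ++ [D.size] ++ encodeGraph D.tree ++
    (List.finRange D.size).flatMap fun t =>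
      bits fun v => ∃ h : v ∈ M, ∃ P ∈ D.bag t, (⟨v, h⟩ : M) ∈ P.1

/-- The input word: number of vertices, adjacency matrix, costs, positive and negative part of the
budget, number of listed tree decompositions, and these one by one. -/
noncomputable def Input.encode (I : Input) : List ℕ :=
  [I.n] ++ encodeGraph I.graph ++ List.ofFn I.cost ++
    [I.budget.toNat, (-I.budget).toNat] ++ [I.decs.length] ++
    I.decs.flatMap fun D => encodeDec D.1.1 D.2

end CDSModTW

open CDSModTW

namespace CDSModTW

section ModularDecomposition

variable {V : Type*} {G : SimpleGraph V}

/-! ### Connectivity and cuts -/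

/-! The algorithm needs no recursion. Let `X` be a connected dominating set and consider the
components of the complement graph. If `X` meets two of them, one vertex of `X` from each is already
a connected dominating set, because vertices of different co-components are adjacent. Otherwise `X`
lies in one co-component `C`, which is joined to everything outside. Then `G[C]` is connected, since
the connected set `X` dominates it, and co-connected by choice; so, unless it is a single vertex,
`C` is a prime node by Gallai's theorem (`isPrimeGraph_modularQuotient`). By
`HasCDS.exists_pair_or_prime` it suffices to try all pairs of vertices and all prime nodes that are
joined to the rest of the graph.

In a prime graph no vertex is adjacent to all others. Hence a connected dominating set of a prime
quotient gives every vertex, even its own members, a neighbour in the set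
(`IsCDS.exists_adj_of_prime`), and any choice of one vertex per part lifts it to the graph;
conversely, connected dominating sets project to the quotient. Since costs are positive, an optimum
uses one cheapest vertex in every part it meets (`sum_projection`). This gives the reduction at
prime nodes, and it lets the algorithm work in the subgraph induced by one cheapest representative
per part.

Solutions in that subgraph are counted modulo 4. Every vertex gets the value 0 with weight 1, the
value 1 with weight 3, or one of the colours 2, 3 with weight `z ^ E v`; adjacent vertices with
nonzero values must agree. If `X` is the set of coloured vertices, the colourings number 2 to the
number of components of `G[X]`, and the value 1 is possible exactly at the vertices not dominated by
`X`, which contributes a factor 1 + 3 for each of them. So the coefficient of `X` is 2 if `X` is a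
connected dominating set and divisible by 4 otherwise (`cutCoeff_mod_four`). The constraints are
local to edges, so tables of children in a tree decomposition are combined by pointwise products,
and a bag of `k + 1` vertices costs `4 ^ (k + 1)` terms (`BagTree.sum_eq`).

The generating function is evaluated at the single number `z = 16 ^ n`, larger than the sum of all
coefficients, so that the coefficients are digits in base `z`. The exponent `E` combines the cost
with a random weight read off the coins. A digit congruent to 2 always comes from an actual
solution, so there are no false positives. By the isolation lemma (`coinMeasure_not_isolates_le`),
with probability at least one half a single optimum has minimum weight; its digit is then 2.

For the machine, programs are written in a language of counted loops, and `Runs` proves termination,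
time, memory bounds, frame conditions and the result simultaneously. Only the loops over the
assignments of a bag are exponential, and these are never nested, which gives one factor `4 ^ (k +
1)` times a polynomial (`LP.exists_timeBound_le`). -/

theorem exists_adj_of_connected {H : SimpleGraph V} (h : H.Connected) {S : Set V} {u v : V}
    (hu : u ∈ S) (hv : v ∉ S) : ∃ a ∈ S, ∃ b ∉ S, H.Adj a b := by
  obtain ⟨p⟩ := h.preconnected u v
  obtain ⟨d, _, h1, h2⟩ := p.exists_boundary_dart S hu hv
  exact ⟨_, h1, _, h2, d.adj⟩

theorem connected_of_forall_exists_adj {H : SimpleGraph V} [Nonempty V]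
    (h : ∀ S : Set V, S.Nonempty → (∃ v, v ∉ S) → ∃ a ∈ S, ∃ b ∉ S, H.Adj a b) : H.Connected := by
  refine ⟨fun u v => ?_⟩
  by_contra hv
  obtain ⟨a, ha, b, hb, hab⟩ := h {x | H.Reachable u x} ⟨u, .refl u⟩ ⟨v, hv⟩
  exact hb (SimpleGraph.Reachable.trans ha hab.reachable)

/-! ### Modules -/

theorem isModule_iff {M : Set V} :
    IsModule G M ↔ ∀ v ∈ M, ∀ w ∈ M, ∀ x ∉ M, G.Adj v x → G.Adj w x := by
  refine ⟨fun h v hv w hw x hx hvx => ?_, fun h v hv w hw => ?_⟩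
  · have : x ∈ G.neighborSet v \ M := ⟨hvx, hx⟩
    rw [h v hv w hw] at this
    exact this.1
  · ext x
    exact ⟨fun hx => ⟨h v hv w hw x hx.2 hx.1, hx.2⟩, fun hx => ⟨h w hw v hv x hx.2 hx.1, hx.2⟩⟩

theorem IsModule.adj_iff {M : Set V} (h : IsModule G M) {v w x : V} (hv : v ∈ M) (hw : w ∈ M)
    (hx : x ∉ M) : G.Adj v x ↔ G.Adj w x :=
  ⟨isModule_iff.1 h v hv w hw x hx, isModule_iff.1 h w hw v hv x hx⟩

theorem isStrongModule_singleton (v : V) : IsStrongModule G {v} := by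
  refine ⟨isModule_iff.2 ?_, fun N _ => ?_⟩
  · rintro _ rfl _ rfl x _ h
    exact h
  · by_cases hv : v ∈ N
    · exact Or.inr (Or.inl (by simpa using hv))
    · exact Or.inl (by simpa using hv)

theorem IsModule.union {A B : Set V} (hA : IsModule G A) (hB : IsModule G B)
    (h : (A ∩ B).Nonempty) : IsModule G (A ∪ B) := by
  obtain ⟨c, hcA, hcB⟩ := h
  have key : ∀ v ∈ A ∪ B, ∀ x ∉ A ∪ B, G.Adj v x ↔ G.Adj c x := by
    rintro v (hv | hv) x hx
    · exact hA.adj_iff hv hcA fun h => hx (Or.inl h)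
    · exact hB.adj_iff hv hcB fun h => hx (Or.inr h)
  exact isModule_iff.2 fun v hv w hw x hx h => (key w hw x hx).2 ((key v hv x hx).1 h)

/-! ### The canonical partition -/

theorem canonicalPartition_isModule (P : canonicalPartition G) : IsModule G P.1 :=
  P.2.1.1.1

theorem canonicalPartition_nonempty (P : canonicalPartition G) : P.1.Nonempty :=
  P.2.1.2.1

theorem canonicalPartition_ne_univ (P : canonicalPartition G) : P.1 ≠ Set.univ :=
  P.2.1.2.2

/-- Parts that share a vertex are comparable, since one is strong and the other a module; maximality
makes them equal. -/
theorem canonicalPartition_eq_of_mem {P Q : canonicalPartition G} {v : V} (hP : v ∈ P.1)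
    (hQ : v ∈ Q.1) : P = Q := by
  apply Subtype.ext
  rcases P.2.1.1.2 Q.1 Q.2.1.1.1 with h | h | h
  · exact absurd hQ (Set.disjoint_left.1 h hP)
  · exact h.antisymm (P.2.2 Q.2.1 h)
  · exact (Q.2.2 P.2.1 h).antisymm h

/-- Singletons are strong modules, and proper ones as there are two vertices; finiteness yields a
maximal strong module above. -/
theorem exists_mem_canonicalPartition [Finite V] [Nontrivial V] (v : V) :
    ∃ P : canonicalPartition G, v ∈ P.1 := by
  obtain ⟨u, hu⟩ := exists_ne v
  obtain ⟨P, hvP, hP⟩ := (Set.toFinite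
    {N : Set V | IsStrongModule G N ∧ N.Nonempty ∧ N ≠ Set.univ}).exists_le_maximal
    (a := {v}) ⟨isStrongModule_singleton v, Set.singleton_nonempty v, fun h =>
      hu (by have := Set.mem_univ u; rw [← h] at this; exact this)⟩
  exact ⟨⟨P, hP⟩, hvP rfl⟩

/-- The part that contains a vertex. -/
noncomputable def partOf (G : SimpleGraph V) [Finite V] [Nontrivial V] (v : V) :
    canonicalPartition G :=
  (exists_mem_canonicalPartition v).choose

theorem mem_partOf [Finite V] [Nontrivial V] (v : V) : v ∈ (partOf G v).1 :=
  (exists_mem_canonicalPartition v).choose_spec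

theorem partOf_eq [Finite V] [Nontrivial V] {P : canonicalPartition G} {v : V} (h : v ∈ P.1) :
    partOf G v = P :=
  canonicalPartition_eq_of_mem (mem_partOf v) h

/-- Since both parts are modules, an edge between them can be moved to any other pair of endpoints,
one endpoint at a time. Everything about quotients below goes through this equivalence. -/
theorem modularQuotient_adj_iff {P Q : canonicalPartition G} (hPQ : P ≠ Q) {u v : V}
    (hu : u ∈ P.1) (hv : v ∈ Q.1) : (modularQuotient G).Adj P Q ↔ G.Adj u v := by
  refine ⟨fun h => ?_, fun h => ⟨hPQ, u, hu, v, hv, h⟩⟩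
  obtain ⟨-, a, ha, b, hb, hab⟩ := h
  have h1 := (canonicalPartition_isModule P).adj_iff ha hu
    (fun hbP => hPQ (canonicalPartition_eq_of_mem hbP hb))
  have h2 := (canonicalPartition_isModule Q).adj_iff hb hv
    (fun huQ => hPQ (canonicalPartition_eq_of_mem hu huQ))
  exact ((h2.1 (h1.1 hab).symm)).symm

/-! ### Graphs that are connected and co-connected -/

/-- If two proper modules cover the graph, the cut between one of them and its complement consists
entirely of edges or entirely of non-edges, so the graph or its complement is disconnected. -/
theorem not_connected_of_union_eq_univ {A B : Set V} (hA : IsModule G A) (hB : IsModule G B)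
    (hA' : A ≠ Set.univ) (hB' : B ≠ Set.univ) (hAB : A ∪ B = Set.univ)
    (hG : G.Connected) (hG' : Gᶜ.Connected) : False := by
  obtain ⟨u, hu⟩ := (Set.ne_univ_iff_exists_notMem B).1 hB'
  obtain ⟨v, hv⟩ := (Set.ne_univ_iff_exists_notMem A).1 hA'
  have cov : ∀ x, x ∈ A ∨ x ∈ B := fun x => by
    have := Set.mem_univ x
    rwa [← hAB] at this
  have huA : u ∈ A := (cov u).resolve_right hu
  have hvB : v ∈ B := (cov v).resolve_left hv
  -- Move `y` to `v` inside `B`, then `x` to `u` inside `A`; the witnesses `u ∉ B` and `v ∉ A` are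
  -- fixed.
  have key : ∀ x ∉ B, ∀ y ∈ B, G.Adj x y ↔ G.Adj u v := by
    intro x hx y hy
    have hxA : x ∈ A := (cov x).resolve_right hx
    have h1 := hB.adj_iff hy hvB hx
    have h2 := hA.adj_iff hxA huA hv
    rw [G.adj_comm x y, h1, G.adj_comm v x, h2]
  by_cases huv : G.Adj u v
  · obtain ⟨a, ha, b, hb, hab⟩ := exists_adj_of_connected hG' hvB hu
    exact ((SimpleGraph.compl_adj G a b).1 hab).2 ((key b hb a ha).2 huv).symm
  · obtain ⟨a, ha, b, hb, hab⟩ := exists_adj_of_connected hG hvB hu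
    exact huv ((key b hb a ha).1 hab.symm)

/-- A maximal proper module is strong here: the union with an overlapping proper module is a module
and, by `not_connected_of_union_eq_univ`, still proper. Hence parts are maximal among all proper
modules, not only among the strong ones. -/
theorem subset_of_isModule_of_mem_canonicalPartition [Finite V] (hG : G.Connected)
    (hG' : Gᶜ.Connected) (P : canonicalPartition G) {N : Set V} (hN : IsModule G N)
    (hN' : N ≠ Set.univ) (hPN : P.1 ⊆ N) : N = P.1 := by
  obtain ⟨N', hNN', hmax⟩ := (Set.toFinite
    {N : Set V | IsModule G N ∧ N ≠ Set.univ}).exists_le_maximal (a := N) ⟨hN, hN'⟩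
  have hne : N'.Nonempty := (canonicalPartition_nonempty P).mono (hPN.trans hNN')
  have hstrong : IsStrongModule G N' := by
    refine ⟨hmax.1.1, fun B hB => ?_⟩
    by_cases hd : (N' ∩ B).Nonempty
    · right
      by_cases hBu : B = Set.univ
      · left; rw [hBu]; exact Set.subset_univ _
      · right
        have hu := hmax.1.1.union hB hd
        have hu' : N' ∪ B ≠ Set.univ := fun h =>
          not_connected_of_union_eq_univ hmax.1.1 hB hmax.1.2 hBu h hG hG'
        exact Set.subset_union_right.trans (hmax.2 ⟨hu, hu'⟩ Set.subset_union_left)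
    · left
      rw [Set.disjoint_iff_inter_eq_empty]
      exact Set.not_nonempty_iff_eq_empty.1 hd
  exact (hNN'.trans (P.2.2 ⟨hstrong, hne, hmax.1.2⟩ (hPN.trans hNN'))).antisymm hPN

/-- Gallai's theorem. -/
theorem isPrimeGraph_modularQuotient [Finite V] [Nontrivial V] (hG : G.Connected)
    (hG' : Gᶜ.Connected) : IsPrimeGraph (modularQuotient G) := by
  constructor
  · obtain ⟨v⟩ : Nonempty V := inferInstance
    obtain ⟨u, hu⟩ := (Set.ne_univ_iff_exists_notMem _).1 (canonicalPartition_ne_univ (partOf G v))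
    set P := partOf G v with hP
    set Q := partOf G u with hQ
    have hvP : v ∈ P.1 := mem_partOf v
    have huQ : u ∈ Q.1 := mem_partOf u
    have hPQ : P ≠ Q := fun h => hu (h ▸ huQ)
    -- With only two parts the cut around `P` would be uniform, contradicting connectedness or
    -- co-connectedness. So there is a third part.
    have hex : ∃ x, x ∉ P.1 ∧ x ∉ Q.1 := by
      by_contra hcon
      push Not at hcon
      have key : ∀ a ∈ P.1, ∀ b ∉ P.1, G.Adj a b ↔ (modularQuotient G).Adj P Q :=
        fun a ha b hb => (modularQuotient_adj_iff hPQ ha (hcon b hb)).symm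
      by_cases h : (modularQuotient G).Adj P Q
      · obtain ⟨a, ha, b, hb, hab⟩ := exists_adj_of_connected hG' hvP hu
        exact ((SimpleGraph.compl_adj G a b).1 hab).2 ((key a ha b hb).2 h)
      · obtain ⟨a, ha, b, hb, hab⟩ := exists_adj_of_connected hG hvP hu
        exact h ((key a ha b hb).1 hab)
    obtain ⟨x, hxP, hxQ⟩ := hex
    set R := partOf G x with hR
    have hxR : x ∈ R.1 := mem_partOf x
    have hPR : P ≠ R := fun h => hxP (h ▸ hxR)
    have hQR : Q ≠ R := fun h => hxQ (h ▸ hxR)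
    classical
    have := Fintype.ofFinite (canonicalPartition G)
    rw [Nat.card_eq_fintype_card]
    calc 3 = ({P, Q, R} : Finset (canonicalPartition G)).card := by
            rw [Finset.card_insert_of_notMem (by simp [hPQ, hPR]), Finset.card_pair hQR]
      _ ≤ _ := Finset.card_le_univ _
  · intro Q hQ
    rcases Set.eq_empty_or_nonempty Q with h | ⟨P, hP⟩
    · exact Or.inl h
    right
    by_cases hs : ∃ P, Q = {P}
    · exact Or.inr hs
    left
    -- A module of the quotient pulls back to a module of `G`. If it has two parts, its pull-back
    -- strictly contains a part and therefore is everything.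
    have hU : IsModule G {v | partOf G v ∈ Q} := by
      refine isModule_iff.2 fun v hv w hw x hx hvx => ?_
      have h1 : ∀ y, partOf G y ∈ Q → ((modularQuotient G).Adj (partOf G y) (partOf G x) ↔
          G.Adj y x) := fun y hy =>
        modularQuotient_adj_iff (fun h => hx (by simpa [← h] using hy)) (mem_partOf y) (mem_partOf x)
      rw [← h1 w hw]
      exact isModule_iff.1 hQ _ hv _ hw _ hx ((h1 v hv).2 hvx)
    have hPU : P.1 ⊆ {v | partOf G v ∈ Q} := fun v hv => by
      rw [Set.mem_ofPred_eq, partOf_eq hv]; exact hP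
    obtain ⟨P', hP', hne⟩ : ∃ P' ∈ Q, P' ≠ P := by
      by_contra hcon
      push Not at hcon
      exact hs ⟨P, Set.eq_singleton_iff_unique_mem.2 ⟨hP, hcon⟩⟩
    obtain ⟨y, hy⟩ := canonicalPartition_nonempty P'
    have huniv : {v | partOf G v ∈ Q} = Set.univ := by
      by_contra hcon
      have := subset_of_isModule_of_mem_canonicalPartition hG hG' P hU hcon hPU
      have hyU : y ∈ {v | partOf G v ∈ Q} := by
        rw [Set.mem_ofPred_eq, partOf_eq hy]; exact hP'
      rw [this] at hyU
      exact hne (canonicalPartition_eq_of_mem hy hyU)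
    rw [Set.eq_univ_iff_forall]
    intro R
    obtain ⟨z, hz⟩ := canonicalPartition_nonempty R
    have : z ∈ {v | partOf G v ∈ Q} := by rw [huniv]; trivial
    rw [Set.mem_ofPred_eq, partOf_eq hz] at this
    exact this

end ModularDecomposition

/-! ### Connected dominating sets and embeddings -/

section Transport

variable {V W : Type*} {G : SimpleGraph V} {H : SimpleGraph W}

/-- `X` is a connected dominating set of the subgraph of `G` that is induced by `R`. -/
def IsCDSOn (G : SimpleGraph V) (R X : Finset V) : Prop :=
  X ⊆ R ∧ (∀ v ∈ R, v ∈ X ∨ ∃ u ∈ X, G.Adj u v) ∧ (G.induce (X : Set V)).Connected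

theorem connected_induce_map_iff (φ : H ↪g G) (Y : Finset W) :
    (G.induce ((Y.map φ.toEmbedding : Finset V) : Set V)).Connected ↔
      (H.induce (Y : Set W)).Connected := by
  let e' : H.induce (Y : Set W) ≃g G.induce ((Y.map φ.toEmbedding : Finset V) : Set V) :=
    ⟨(Equiv.Set.image φ (Y : Set W) φ.injective).trans (Equiv.setCongr (by simp)), by
      intro a b
      exact φ.map_adj_iff⟩
  exact e'.connected_iff.symm

theorem isCDS_iff_isCDSOn (φ : H ↪g G) {R : Finset V} (hR : ∀ v, v ∈ R ↔ ∃ w, φ w = v)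
    (Y : Finset W) : IsCDS H Y ↔ IsCDSOn G R (Y.map φ.toEmbedding) := by
  have hmem : ∀ w, φ w ∈ Y.map φ.toEmbedding ↔ w ∈ Y := fun w => by
    simp
  refine ⟨fun h => ⟨fun v hv => ?_, fun v hv => ?_, (connected_induce_map_iff φ Y).2 h.2⟩,
    fun h => ⟨fun w => ?_, (connected_induce_map_iff φ Y).1 h.2.2⟩⟩
  · obtain ⟨w, _, rfl⟩ := Finset.mem_map.1 hv
    exact (hR _).2 ⟨w, rfl⟩
  · obtain ⟨w, rfl⟩ := (hR v).1 hv
    rcases h.1 w with h' | ⟨u, hu, huw⟩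
    · exact Or.inl ((hmem w).2 h')
    · exact Or.inr ⟨φ u, (hmem u).2 hu, φ.map_adj_iff.2 huw⟩
  · rcases h.2.1 (φ w) ((hR _).2 ⟨w, rfl⟩) with h' | ⟨u, hu, huw⟩
    · exact Or.inl ((hmem w).1 h')
    · obtain ⟨u', _, rfl⟩ := Finset.mem_map.1 hu
      exact Or.inr ⟨u', (hmem u').1 hu, φ.map_adj_iff.1 huw⟩

theorem IsCDS.nonempty {X : Finset V} (h : IsCDS G X) : X.Nonempty := by
  obtain ⟨x⟩ := h.2.nonempty
  exact ⟨x.1, x.2⟩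

theorem exists_mem_optimumCDS {c : V → ℕ} {X : Finset V} (hX : IsCDS G X) :
    ∃ Y ∈ optimumCDS G c, ∑ v ∈ Y, c v ≤ ∑ v ∈ X, c v := by
  obtain ⟨Y, hY, hmin⟩ := (measure fun X : Finset V => ∑ v ∈ X, c v).wf.has_min
    {X | IsCDS G X} ⟨X, hX⟩
  exact ⟨Y, ⟨hY, fun Z hZ => not_lt.1 (hmin Z hZ)⟩, not_lt.1 (hmin X hX)⟩

end Transport

/-! ### Prime nodes -/

section Prime

variable {V : Type*} [Finite V] {G : SimpleGraph V}

/-- If `p` were adjacent to all other vertices, the complement of `p` would be a module, and with at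
least three vertices a nontrivial one. -/
theorem IsPrimeGraph.exists_not_adj {W : Type*} {H : SimpleGraph W} (hH : IsPrimeGraph H) (p : W) :
    ∃ q, q ≠ p ∧ ¬ H.Adj p q := by
  by_contra hcon
  push Not at hcon
  have hM : IsModule H {p}ᶜ := by
    refine isModule_iff.2 fun v hv w hw x hx _ => ?_
    obtain rfl : x = p := by simpa using hx
    exact (hcon w hw).symm
  have hfin : Finite W := Nat.finite_of_card_ne_zero (by have := hH.1; omega)
  have hcard : ({p} : Set W).ncard + ({p} : Set W)ᶜ.ncard = Nat.card W :=
    Set.ncard_add_ncard_compl _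
  have h3 := hH.1
  rw [Set.ncard_singleton] at hcard
  rcases hH.2 _ hM with h | h | ⟨v, h⟩
  · rw [h, Set.ncard_empty] at hcard; omega
  · have : p ∈ ({p} : Set W)ᶜ := by rw [h]; trivial
    exact this rfl
  · rw [h, Set.ncard_singleton] at hcard; omega

/-- Domination is automatically total: a member of `Y` has a neighbour in `Y` by connectedness,
unless it is the only member, and then it would be adjacent to all vertices. -/
theorem IsCDS.exists_adj_of_prime {W : Type*} {H : SimpleGraph W} (hH : IsPrimeGraph H)
    {Y : Finset W} (hY : IsCDS H Y) (p : W) : ∃ q ∈ Y, H.Adj q p := by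
  by_cases hp : p ∈ Y
  · obtain ⟨q, hq, hne⟩ : ∃ q ∈ Y, q ≠ p := by
      by_contra hcon
      push Not at hcon
      obtain ⟨x, hx, hadj⟩ := hH.exists_not_adj p
      rcases hY.1 x with h | ⟨u, hu, hux⟩
      · exact hx (hcon x h)
      · rw [hcon u hu] at hux
        exact hadj hux
    obtain ⟨a, ha, b, hb, hab⟩ := exists_adj_of_connected hY.2 (S := {(⟨p, hp⟩ : (Y : Set W))})
      (u := ⟨p, hp⟩) (v := ⟨q, hq⟩) rfl (by simpa using hne)
    rw [Set.mem_singleton_iff] at ha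
    subst ha
    exact ⟨b.1, b.2, hab.symm⟩
  · exact (hY.1 p).resolve_left hp

theorem nontrivial_of_prime (h : IsPrimeGraph (modularQuotient G)) : Nontrivial V := by
  by_contra hcon
  rw [not_nontrivial_iff_subsingleton] at hcon
  have : Subsingleton (canonicalPartition G) := ⟨fun P Q => by
    obtain ⟨p, hp⟩ := canonicalPartition_nonempty P
    obtain ⟨q, hq⟩ := canonicalPartition_nonempty Q
    rw [Subsingleton.elim q p] at hq
    exact canonicalPartition_eq_of_mem hp hq⟩
  have h1 := h.1
  have := Finite.card_le_one_iff_subsingleton.2 this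
  omega

/-- A choice of one vertex in every part embeds the quotient graph. -/
def quotientEmbedding (f : canonicalPartition G → V) (hf : ∀ P, f P ∈ P.1) :
    modularQuotient G ↪g G where
  toFun := f
  inj' P Q h := canonicalPartition_eq_of_mem (hf P) (h ▸ hf Q)
  map_rel_iff' {P Q} := by
    by_cases h : P = Q
    · subst h; simp
    · exact (modularQuotient_adj_iff h (hf P) (hf Q)).symm

/-- Total domination in the quotient is what makes an arbitrary choice `f` work: the vertices of a
chosen part other than the chosen one are dominated from a neighbouring part. -/
theorem IsCDS.map_quotient (hG : IsPrimeGraph (modularQuotient G)) (f : canonicalPartition G → V)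
    (hf : ∀ P, f P ∈ P.1) {Y : Finset (canonicalPartition G)} (hY : IsCDS (modularQuotient G) Y) :
    IsCDS G (Y.map (quotientEmbedding f hf).toEmbedding) := by
  have := nontrivial_of_prime hG
  refine ⟨fun v => Or.inr ?_, (connected_induce_map_iff (quotientEmbedding f hf) Y).2 hY.2⟩
  obtain ⟨Q, hQ, hadj⟩ := hY.exists_adj_of_prime hG (partOf G v)
  exact ⟨f Q, Finset.mem_map.2 ⟨Q, hQ, rfl⟩,
    (modularQuotient_adj_iff hadj.ne (hf Q) (mem_partOf v)).1 hadj⟩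

theorem mem_projection {X : Finset V} {P : canonicalPartition G} :
    P ∈ projection G X ↔ ∃ x ∈ X, x ∈ P.1 := by
  simp [projection]

/-- Connectedness is checked on cuts: a cut of the projection pulls back to a cut of `X`, and a
crossing edge of `X` joins different parts. -/
theorem IsCDS.projection (hG : IsPrimeGraph (modularQuotient G)) {X : Finset V} (hX : IsCDS G X) :
    IsCDS (modularQuotient G) (projection G X) := by
  have := nontrivial_of_prime hG
  have hpart : ∀ x ∈ X, partOf G x ∈ CDSModTW.projection G X := fun x hx =>
    mem_projection.2 ⟨x, hx, mem_partOf x⟩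
  constructor
  · intro P
    obtain ⟨v, hv⟩ := canonicalPartition_nonempty P
    by_cases hP : P ∈ CDSModTW.projection G X
    · exact Or.inl hP
    rcases hX.1 v with h | ⟨u, hu, huv⟩
    · exact Or.inl (mem_projection.2 ⟨v, h, hv⟩)
    · refine Or.inr ⟨partOf G u, hpart u hu, ?_⟩
      exact (modularQuotient_adj_iff (fun h => hP (by rw [← h]; exact hpart u hu)) (mem_partOf u) hv).2 huv
  · obtain ⟨x, hx⟩ := hX.nonempty
    have : Nonempty ((CDSModTW.projection G X : Finset _) : Set (canonicalPartition G)) :=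
      ⟨⟨_, hpart x hx⟩⟩
    refine connected_of_forall_exists_adj fun S hS hS' => ?_
    obtain ⟨⟨P, hP⟩, hPS⟩ := hS
    obtain ⟨⟨Q, hQ⟩, hQS⟩ := hS'
    obtain ⟨u, hu, huP⟩ := mem_projection.1 hP
    obtain ⟨v, hv, hvQ⟩ := mem_projection.1 hQ
    let T : Set (X : Set V) := {x | (⟨partOf G x.1, hpart x.1 x.2⟩ :
      ((CDSModTW.projection G X : Finset _) : Set (canonicalPartition G))) ∈ S}
    have huT : (⟨u, hu⟩ : (X : Set V)) ∈ T := by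
      change (⟨partOf G u, _⟩ : ((CDSModTW.projection G X : Finset _) : Set _)) ∈ S
      simp only [partOf_eq huP]; exact hPS
    have hvT : (⟨v, hv⟩ : (X : Set V)) ∉ T := by
      change (⟨partOf G v, _⟩ : ((CDSModTW.projection G X : Finset _) : Set _)) ∉ S
      simp only [partOf_eq hvQ]; exact hQS
    obtain ⟨a, ha, b, hb, hab⟩ := exists_adj_of_connected hX.2 huT hvT
    refine ⟨_, ha, _, hb, ?_⟩
    refine (modularQuotient_adj_iff (fun h => hb ?_) (mem_partOf a.1) (mem_partOf b.1)).2 hab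
    change (⟨partOf G b.1, _⟩ : ((CDSModTW.projection G X : Finset _) : Set _)) ∈ S
    simp only [← h]; exact ha

variable {c w : V → ℕ} {r : canonicalPartition G → V}

theorem sum_map_quotientEmbedding {V : Type*} {G : SimpleGraph V}
    {r : canonicalPartition G → V} (hr : ∀ P, r P ∈ P.1) (Y : Finset (canonicalPartition G))
    (c : V → ℕ) :
    ∑ v ∈ Y.map (quotientEmbedding r hr).toEmbedding, c v = ∑ P ∈ Y, c (r P) :=
  Finset.sum_map _ _ _

/-- An optimum connected dominating set meets every part at most once, in a cheapest vertex. -/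
theorem sum_projection (hG : IsPrimeGraph (modularQuotient G)) (hc : ∀ v, 0 < c v)
    (hr : ∀ M, r M ∈ M.1 ∧ ∀ u ∈ M.1, toLex (c (r M), w (r M)) ≤ toLex (c u, w u))
    {X : Finset V} (hX : X ∈ optimumCDS G c) :
    ∑ M ∈ projection G X, c (r M) = ∑ v ∈ X, c v ∧
      ∑ M ∈ projection G X, w (r M) ≤ ∑ v ∈ X, w v := by
  classical
  have := nontrivial_of_prime hG
  have hlex : ∀ M, ∀ u ∈ M.1, c (r M) < c u ∨ c (r M) = c u ∧ w (r M) ≤ w u := fun M u hu => by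
    have := (hr M).2 u hu
    rwa [Prod.Lex.toLex_le_toLex] at this
  have hsel : ∀ P : canonicalPartition G, ∃ x ∈ P.1, (∃ y ∈ X, y ∈ P.1) → x ∈ X := by
    intro P
    by_cases h : ∃ y ∈ X, y ∈ P.1
    · obtain ⟨y, hy, hyP⟩ := h
      exact ⟨y, hyP, fun _ => hy⟩
    · obtain ⟨y, hy⟩ := canonicalPartition_nonempty P
      exact ⟨y, hy, fun h' => absurd h' h⟩
  -- `f` selects a vertex of `X` in every part that `X` meets. Lifting the projection along `f`
  -- gives a connected dominating subset of `X`.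
  choose f hf hfX using hsel
  have hproj := IsCDS.projection hG hX.1
  have hsub : (projection G X).map (quotientEmbedding f hf).toEmbedding ⊆ X := by
    intro v hv
    obtain ⟨P, hP, rfl⟩ := Finset.mem_map.1 hv
    exact hfX P (mem_projection.1 hP)
  -- A proper subset would be strictly cheaper, as all costs are positive; so `X` has exactly one
  -- vertex in every part that it meets.
  have heq : (projection G X).map (quotientEmbedding f hf).toEmbedding = X := by
    by_contra hne
    have := hX.2 _ (IsCDS.map_quotient hG f hf hproj)
    obtain ⟨v, hv, hv'⟩ := Finset.exists_of_ssubset (hsub.ssubset_of_ne hne)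
    have := Finset.sum_lt_sum_of_subset hsub hv hv' (hc v) (fun _ _ _ => Nat.zero_le _)
    omega
  have hcX : ∑ P ∈ projection G X, c (f P) = ∑ v ∈ X, c v := by
    rw [← sum_map_quotientEmbedding hf, heq]
  have hwX : ∑ P ∈ projection G X, w (f P) = ∑ v ∈ X, w v := by
    rw [← sum_map_quotientEmbedding hf, heq]
  have hle : ∀ P ∈ projection G X, c (r P) ≤ c (f P) := fun P _ => by
    have := hlex P (f P) (hf P); omega
  have hge := hX.2 _ (IsCDS.map_quotient hG r (fun P => (hr P).1) hproj)
  rw [sum_map_quotientEmbedding (fun P => (hr P).1)] at hge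
  have hceq : ∑ P ∈ projection G X, c (r P) = ∑ P ∈ projection G X, c (f P) :=
    (Finset.sum_le_sum hle).antisymm (by rw [hcX]; exact hge)
  refine ⟨by rw [hceq, hcX], ?_⟩
  rw [← hwX]
  refine Finset.sum_le_sum fun P hP => ?_
  -- The costs of `r` and `f` agree part by part, so the lexicographic comparison passes to the
  -- weights.
  have h1 := (Finset.sum_eq_sum_iff_of_le hle).1 hceq P hP
  have := hlex P (f P) (hf P)
  omega

theorem map_mem_optimumCDS (hG : IsPrimeGraph (modularQuotient G)) (hc : ∀ v, 0 < c v)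
    (hr : ∀ M, r M ∈ M.1 ∧ ∀ u ∈ M.1, toLex (c (r M), w (r M)) ≤ toLex (c u, w u))
    {Y : Finset (canonicalPartition G)}
    (hY : Y ∈ optimumCDS (modularQuotient G) fun M => c (r M)) :
    Y.map (quotientEmbedding r fun P => (hr P).1).toEmbedding ∈ optimumCDS G c := by
  refine ⟨IsCDS.map_quotient hG r _ hY.1, fun X hX => ?_⟩
  obtain ⟨X₀, hX₀, hle⟩ := exists_mem_optimumCDS (c := c) hX
  rw [sum_map_quotientEmbedding]
  refine le_trans ?_ hle
  rw [← (sum_projection hG hc hr hX₀).1]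
  exact hY.2 _ (IsCDS.projection hG hX₀.1)

theorem projection_mem_optimumCDS (hG : IsPrimeGraph (modularQuotient G)) (hc : ∀ v, 0 < c v)
    (hr : ∀ M, r M ∈ M.1 ∧ ∀ u ∈ M.1, toLex (c (r M), w (r M)) ≤ toLex (c u, w u))
    {X : Finset V} (hX : X ∈ optimumCDS G c) :
    projection G X ∈ optimumCDS (modularQuotient G) fun M => c (r M) := by
  refine ⟨IsCDS.projection hG hX.1, fun Y hY => ?_⟩
  rw [(sum_projection hG hc hr hX).1, ← sum_map_quotientEmbedding fun P => (hr P).1]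
  exact hX.2 _ (IsCDS.map_quotient hG r _ hY)

/-- Every quotient optimum of minimum weight lifts along `r` to an optimum of minimum weight in `G`,
which is unique; and lifting is injective. Such a quotient optimum exists because the projection of
the isolated set is one. -/
theorem isolates_quotient (hG : IsPrimeGraph (modularQuotient G)) (hc : ∀ v, 0 < c v)
    (hr : ∀ M, r M ∈ M.1 ∧ ∀ u ∈ M.1, toLex (c (r M), w (r M)) ≤ toLex (c u, w u))
    (hw : Isolates w (optimumCDS G c)) :
    Isolates (fun M => w (r M)) (optimumCDS (modularQuotient G) fun M => c (r M)) := by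
  obtain ⟨S, ⟨hS, hmin⟩, huniq⟩ := hw
  have hle : ∀ Y ∈ optimumCDS (modularQuotient G) (fun M => c (r M)),
      ∑ v ∈ S, w v ≤ ∑ M ∈ Y, w (r M) := fun Y hY => by
    have := hmin _ (map_mem_optimumCDS hG hc hr hY)
    rwa [sum_map_quotientEmbedding] at this
  have key : ∀ Y, IsMinWeight (fun M => w (r M))
      (optimumCDS (modularQuotient G) fun M => c (r M)) Y →
      Y.map (quotientEmbedding r fun P => (hr P).1).toEmbedding = S := by
    intro Y hY
    have hYS : ∑ M ∈ Y, w (r M) ≤ ∑ v ∈ S, w v :=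
      (hY.2 _ (projection_mem_optimumCDS hG hc hr hS)).trans (sum_projection hG hc hr hS).2
    refine huniq _ ⟨map_mem_optimumCDS hG hc hr hY.1, fun T hT => ?_⟩
    rw [sum_map_quotientEmbedding]
    exact hYS.trans (hmin T hT)
  have hproj : IsMinWeight (fun M => w (r M))
      (optimumCDS (modularQuotient G) fun M => c (r M)) (projection G S) :=
    ⟨projection_mem_optimumCDS hG hc hr hS, fun Y hY =>
      (sum_projection hG hc hr hS).2.trans (hle Y hY)⟩
  refine ⟨projection G S, hproj, fun Y hY => ?_⟩
  exact Finset.map_injective _ ((key Y hY).trans (key _ hproj).symm)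

end Prime

/-! ### Joined vertex sets and series nodes -/

section Joined

variable {V : Type*} {G : SimpleGraph V}

theorem sum_map_subtype {M : Set V} (X : Finset M) (c : V → ℕ) :
    ∑ v ∈ X.map (Function.Embedding.subtype _), c v = ∑ v ∈ X, c v :=
  Finset.sum_map _ _ _

/-- If all vertices outside `M` are adjacent to all vertices of `M`, then the connected dominating
sets of `G[M]` are connected dominating sets of `G`. -/
theorem IsCDS.of_induce {M : Set V} (hM : ∀ u ∈ M, ∀ v ∉ M, G.Adj u v) {X : Finset M}
    (hX : IsCDS (G.induce M) X) : IsCDS G (X.map (Function.Embedding.subtype _)) := by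
  refine ⟨fun v => ?_, (connected_induce_map_iff (SimpleGraph.Embedding.induce M) X).2 hX.2⟩
  by_cases hv : v ∈ M
  · rcases hX.1 ⟨v, hv⟩ with h | ⟨u, hu, huv⟩
    · exact Or.inl (Finset.mem_map.2 ⟨_, h, rfl⟩)
    · exact Or.inr ⟨u.1, Finset.mem_map.2 ⟨_, hu, rfl⟩, huv⟩
  · obtain ⟨x, hx⟩ := hX.nonempty
    exact Or.inr ⟨x.1, Finset.mem_map.2 ⟨_, hx, rfl⟩, hM _ x.2 _ hv⟩

theorem IsCDS.induce {M : Set V} {X : Finset V} (hX : IsCDS G X) (hXM : (X : Set V) ⊆ M) :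
    ∃ Y : Finset M, IsCDS (G.induce M) Y ∧ Y.map (Function.Embedding.subtype _) = X := by
  classical
  have hY : (X.subtype (· ∈ M)).map (Function.Embedding.subtype _) = X :=
    Finset.subtype_map_of_mem fun x hx => hXM hx
  refine ⟨X.subtype (· ∈ M), ⟨fun v => ?_, ?_⟩, hY⟩
  · rcases hX.1 v.1 with h | ⟨u, hu, huv⟩
    · exact Or.inl (by simpa using h)
    · exact Or.inr ⟨⟨u, hXM hu⟩, by simpa using hu, huv⟩
  · refine (connected_induce_map_iff (SimpleGraph.Embedding.induce M) _).1 ?_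
    have := hX.2
    rw [← hY] at this
    exact this

theorem HasCDS.of_induce {M : Set V} (hM : ∀ u ∈ M, ∀ v ∉ M, G.Adj u v) {c : V → ℕ} {b : ℤ}
    (h : HasCDS (G.induce M) (fun v => c v) b) : HasCDS G c b := by
  obtain ⟨X, hX, hb⟩ := h
  refine ⟨_, hX.of_induce hM, ?_⟩
  rwa [sum_map_subtype]

theorem isCDS_pair [DecidableEq V] {u v : V} (huv : u = v ∨ G.Adj u v)
    (h : ∀ x, x = u ∨ x = v ∨ G.Adj u x ∨ G.Adj v x) : IsCDS G {u, v} := by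
  constructor
  · intro x
    rcases h x with h | h | h | h
    · simp [h]
    · simp [h]
    · exact Or.inr ⟨u, by simp, h⟩
    · exact Or.inr ⟨v, by simp, h⟩
  · have : Nonempty (({u, v} : Finset V) : Set V) := ⟨⟨u, by simp⟩⟩
    refine connected_of_forall_exists_adj fun S ⟨a, ha⟩ ⟨b, hb⟩ => ⟨a, ha, b, hb, ?_⟩
    have hab : a.1 ≠ b.1 := fun h => hb (by rwa [← Subtype.ext h])
    have h1 := a.2
    have h2 := b.2
    simp only [Finset.coe_insert, Finset.coe_singleton, Set.mem_insert_iff,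
      Set.mem_singleton_iff] at h1 h2
    change G.Adj a.1 b.1
    rcases h1 with h1 | h1 <;> rcases h2 with h2 | h2 <;> rw [h1, h2] at hab ⊢
    · exact absurd rfl hab
    · exact huv.resolve_left hab
    · exact (huv.resolve_left hab.symm).symm
    · exact absurd rfl hab

section Series

variable [Finite V]

theorem nontrivial_of_isSeries (hG : IsSeries G) : Nontrivial V :=
  Finite.one_lt_card_iff_nontrivial.1 hG.1

theorem IsSeries.adj {V : Type*} {G : SimpleGraph V} (hG : IsSeries G) {M N : canonicalPartition G} (hMN : M ≠ N) {x y : V}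
    (hx : x ∈ M.1) (hy : y ∈ N.1) : G.Adj x y := by
  rw [← modularQuotient_adj_iff hMN hx hy, hG.2.2]
  exact hMN

theorem IsSeries.joined (hG : IsSeries G) {M : Set V} (hM : M ∈ canonicalPartition G) :
    ∀ u ∈ M, ∀ v ∉ M, G.Adj u v := by
  have := nontrivial_of_isSeries hG
  intro u hu v hv
  exact hG.adj (M := ⟨M, hM⟩) (N := partOf G v) (fun h => hv (by
    have := mem_partOf (G := G) v
    rwa [← h] at this)) hu (mem_partOf v)

/-- Distinct parts are completely joined. A solution within one part is a solution of that part, and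
any other solution contains two vertices of different parts, which suffice by themselves. -/
theorem IsSeries.hasCDS_iff (hG : IsSeries G) (c : V → ℕ) (b : ℤ) : HasCDS G c b ↔
    (∃ M ∈ canonicalPartition G, ∃ N ∈ canonicalPartition G, M ≠ N ∧
      ∃ x ∈ M, ∃ y ∈ N, ((c x + c y : ℕ) : ℤ) ≤ b) ∨
    ∃ M ∈ canonicalPartition G, HasCDS (G.induce M) (fun v => c v) b := by
  classical
  have := nontrivial_of_isSeries hG
  constructor
  · rintro ⟨X, hX, hb⟩
    obtain ⟨x, hx⟩ := hX.nonempty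
    by_cases h : (X : Set V) ⊆ (partOf G x).1
    · right
      obtain ⟨Y, hY, rfl⟩ := hX.induce h
      exact ⟨_, (partOf G x).2, Y, hY, by rwa [sum_map_subtype] at hb⟩
    · left
      obtain ⟨y, hy, hyx⟩ := Set.not_subset.1 h
      refine ⟨_, (partOf G x).2, _, (partOf G y).2, fun h => hyx (h ▸ mem_partOf y), x,
        mem_partOf x, y, mem_partOf y, le_trans ?_ hb⟩
      have hxy : x ≠ y := fun h => hyx (h ▸ mem_partOf x)
      rw [Nat.cast_le, ← Finset.sum_pair hxy]
      exact Finset.sum_le_sum_of_subset (by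
        intro z hz
        rcases Finset.mem_insert.1 hz with rfl | hz
        · exact hx
        · rw [Finset.mem_singleton.1 hz]; exact hy)
  · rintro (⟨M, hM, N, hN, hMN, x, hx, y, hy, hb⟩ | ⟨M, hM, h⟩)
    · have hne : (⟨M, hM⟩ : canonicalPartition G) ≠ ⟨N, hN⟩ := fun h => hMN (congrArg Subtype.val h)
      have hxy := hG.adj hne hx hy
      refine ⟨{x, y}, isCDS_pair (Or.inr hxy) fun z => ?_, ?_⟩
      · right; right
        by_cases hz : z ∈ M
        · exact Or.inr (hG.adj hne hz hy).symm
        · exact Or.inl (hG.joined hM x hx z hz)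
      · rwa [Finset.sum_pair hxy.ne]
    · exact h.of_induce (hG.joined hM)

/-- Since the optimum lies in `M`, the optima of `G[M]` have the same cost as those of `G` and are
optima of `G`; a second one of minimum weight would contradict isolation there. -/
theorem IsSeries.isolates (hG : IsSeries G) {c w : V → ℕ} (hw : Isolates w (optimumCDS G c))
    {X : Finset V} (hX : IsMinWeight w (optimumCDS G c) X) {M : Set V}
    (hM : M ∈ canonicalPartition G) (hXM : (X : Set V) ⊆ M) :
    Isolates (fun v : M => w v) (optimumCDS (G.induce M) fun v => c v) := by
  obtain ⟨Y, hY, rfl⟩ := hX.1.1.induce hXM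
  have hmap : ∀ Z ∈ optimumCDS (G.induce M) (fun v => c v),
      Z.map (Function.Embedding.subtype _) ∈ optimumCDS G c := by
    intro Z hZ
    refine ⟨hZ.1.of_induce (hG.joined hM), fun T hT => ?_⟩
    refine le_trans ?_ (hX.1.2 T hT)
    rw [sum_map_subtype, sum_map_subtype]
    exact hZ.2 Y hY
  have hYopt : Y ∈ optimumCDS (G.induce M) (fun v => c v) := by
    refine ⟨hY, fun Z hZ => ?_⟩
    have := hX.1.2 _ (hZ.of_induce (hG.joined hM))
    rwa [sum_map_subtype, sum_map_subtype] at this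
  refine ⟨Y, ⟨hYopt, fun Z hZ => ?_⟩, fun Z hZ => ?_⟩
  · have := hX.2 _ (hmap Z hZ)
    rwa [sum_map_subtype, sum_map_subtype] at this
  · have h1 : IsMinWeight w (optimumCDS G c) (Z.map (Function.Embedding.subtype _)) := by
      refine ⟨hmap Z hZ.1, fun T hT => le_trans ?_ (hX.2 T hT)⟩
      rw [sum_map_subtype, sum_map_subtype]
      exact hZ.2 Y hYopt
    exact Finset.map_injective _ (hw.unique h1 hX)

end Series

/-! ### Reduction to pairs and prime nodes -/

/-- This replaces the recursion over the modular decomposition. The set in question is the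
component, in the complement graph, of a vertex of the solution. The pair may degenerate to a single
vertex, which is counted only once in the cost. -/
theorem HasCDS.exists_pair_or_prime [Finite V] [DecidableEq V] {c : V → ℕ} {b : ℤ}
    (h : HasCDS G c b) :
    (∃ u v, (u = v ∨ G.Adj u v) ∧ (∀ x, x = u ∨ x = v ∨ G.Adj u x ∨ G.Adj v x) ∧
      ((c u + (if u = v then 0 else c v) : ℕ) : ℤ) ≤ b) ∨
    ∃ M, IsPrimeNode G M ∧ (∀ u ∈ M, ∀ v ∉ M, G.Adj u v) ∧
      HasCDS (G.induce M) (fun v => c v) b := by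
  obtain ⟨X, hX, hb⟩ := h
  obtain ⟨x, hx⟩ := hX.nonempty
  set C := Gᶜ.connectedComponentMk x with hC
  by_cases hXC : (X : Set V) ⊆ C.supp
  · obtain ⟨Y, hY, hYX⟩ := hX.induce hXC
    have hjoin : ∀ u ∈ C.supp, ∀ v ∉ C.supp, G.Adj u v := by
      intro u hu v hv
      by_contra hcon
      refine hv ?_
      rw [SimpleGraph.ConnectedComponent.mem_supp_iff] at hu ⊢
      rw [← hu]
      refine SimpleGraph.ConnectedComponent.sound (SimpleGraph.Adj.reachable ?_)
      exact (SimpleGraph.compl_adj _ _ _).2 ⟨fun h => hv (by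
        rw [h, SimpleGraph.ConnectedComponent.mem_supp_iff]; exact hu), fun h => hcon h.symm⟩
    have hco : (G.induce C.supp)ᶜ.Connected := by
      have e : (G.induce C.supp)ᶜ = Gᶜ.induce C.supp := by
        ext a b
        simp [SimpleGraph.compl_adj, Subtype.ext_iff]
      rw [e]
      exact C.connected_toSimpleGraph
    -- Given a cut of `C` without crossing edges, every vertex of `C` has a member of `Y` on its own
    -- side, namely itself or a neighbour. So `Y` meets both sides, and its connectedness produces a
    -- crossing edge.
    have hconn : (G.induce C.supp).Connected := by
      obtain ⟨y, hy⟩ := hY.nonempty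
      have : Nonempty C.supp := ⟨y⟩
      refine connected_of_forall_exists_adj fun S ⟨a, ha⟩ ⟨b, hb⟩ => ?_
      by_contra hcon
      push Not at hcon
      have hdom : ∀ z, ∃ t ∈ Y, (t ∈ S ↔ z ∈ S) := by
        intro z
        rcases hY.1 z with hz | ⟨t, ht, htz⟩
        · exact ⟨z, hz, Iff.rfl⟩
        · refine ⟨t, ht, fun h => ?_, fun h => ?_⟩
          · by_contra hz
            exact hcon t h z hz htz
          · by_contra hz
            exact hcon z h t hz htz.symm
      obtain ⟨a', ha', haS⟩ := hdom a
      obtain ⟨b', hb', hbS⟩ := hdom b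
      obtain ⟨p, hp, q, hq, hpq⟩ := exists_adj_of_connected hY.2
        (S := {t : (Y : Set C.supp) | t.1 ∈ S}) (u := ⟨a', ha'⟩) (v := ⟨b', hb'⟩)
        (haS.2 ha) (fun h => hb (hbS.1 h))
      exact hcon p.1 hp q.1 hq hpq
    by_cases hnt : Nontrivial C.supp
    · right
      refine ⟨C.supp, ⟨⟨⟨?_, fun N hN => ?_⟩, ?_⟩, isPrimeGraph_modularQuotient hconn hco⟩, hjoin,
        Y, hY, ?_⟩
      · exact isModule_iff.2 fun v hv w hw z hz _ => hjoin w hw z hz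
      · by_contra hcon
        push Not at hcon
        obtain ⟨h1, h2, h3⟩ := hcon
        obtain ⟨p, hpC, hpN⟩ := Set.not_disjoint_iff.1 h1
        obtain ⟨q, hqC, hqN⟩ := Set.not_subset.1 h2
        obtain ⟨z, hzN, hzC⟩ := Set.not_subset.1 h3
        -- If a module `N` overlaps `C`, co-connectedness gives a non-edge from `a` in `N ∩ C` to
        -- `b` in `C \ N`. But a vertex of `N` outside `C` is adjacent to `b`, hence so is `a`.
        obtain ⟨a, ha, b, hb, hab⟩ := exists_adj_of_connected hco
          (S := {t : C.supp | t.1 ∈ N}) (u := ⟨p, hpC⟩) (v := ⟨q, hqC⟩) hpN hqN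
        refine ((SimpleGraph.compl_adj _ _ _).1 hab).2 ?_
        exact (hN.adj_iff ha hzN hb).2 (hjoin b.1 b.2 z hzC).symm
      · exact ⟨x, rfl⟩
      · rwa [← hYX, sum_map_subtype] at hb
    · left
      have hsub := not_nontrivial_iff_subsingleton.1 hnt
      have hxC : x ∈ C.supp := rfl
      have hXx : X = {x} := by
        refine Finset.eq_singleton_iff_unique_mem.2 ⟨hx, fun y hy => ?_⟩
        exact congrArg Subtype.val (Subsingleton.elim (⟨y, hXC hy⟩ : C.supp) ⟨x, hxC⟩)
      subst hXx
      refine ⟨x, x, Or.inl rfl, fun z => ?_, by simpa using hb⟩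
      rcases hX.1 z with h | ⟨u, hu, huz⟩
      · exact Or.inl (Finset.mem_singleton.1 h)
      · rw [Finset.mem_singleton.1 hu] at huz
        exact Or.inr (Or.inr (Or.inl huz))
  · left
    -- Here the solution meets two co-components. Any vertex lies outside at least one of them and
    -- is adjacent to the chosen vertex there.
    obtain ⟨y, hy, hyC⟩ := Set.not_subset.1 hXC
    have hadj : ∀ p q, Gᶜ.connectedComponentMk p ≠ Gᶜ.connectedComponentMk q → G.Adj p q := by
      intro p q hpq
      by_contra hcon
      refine hpq (SimpleGraph.ConnectedComponent.sound (SimpleGraph.Adj.reachable ?_))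
      exact (SimpleGraph.compl_adj _ _ _).2 ⟨fun h => hpq (h ▸ rfl), hcon⟩
    have hxy : Gᶜ.connectedComponentMk x ≠ Gᶜ.connectedComponentMk y := fun h => hyC (by
      rw [SimpleGraph.ConnectedComponent.mem_supp_iff, hC, h])
    have hxy' : x ≠ y := fun h => hxy (h ▸ rfl)
    refine ⟨x, y, Or.inr (hadj x y hxy), fun z => ?_, ?_⟩
    · right; right
      by_cases hz : Gᶜ.connectedComponentMk x = Gᶜ.connectedComponentMk z
      · exact Or.inr (hadj y z fun h => hxy (hz.trans h.symm))
      · exact Or.inl (hadj x z hz)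
    · rw [if_neg hxy', ← Finset.sum_pair hxy']
      refine le_trans (Nat.cast_le.2 (Finset.sum_le_sum_of_subset ?_)) hb
      intro z hz
      rcases Finset.mem_insert.1 hz with rfl | hz
      · exact hx
      · rw [Finset.mem_singleton.1 hz]; exact hy

end Joined

/-! ### Counting cuts -/

section CutCount

set_option linter.unusedSectionVars false

variable {V : Type*} [Fintype V] [DecidableEq V] {G : SimpleGraph V}

/-- The maps `V → Fin 4` that vanish outside `U`. -/
def assignments (U : Finset V) : Finset (V → Fin 4) :=
  Finset.univ.filter fun σ => ∀ v, v ∉ U → σ v = 0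

theorem mem_assignments {U : Finset V} {σ : V → Fin 4} :
    σ ∈ assignments U ↔ ∀ v, v ∉ U → σ v = 0 := by
  simp [assignments]

theorem card_assignments (U : Finset V) : (assignments U).card = 4 ^ U.card := by
  have : assignments U = Fintype.piFinset fun v => if v ∈ U then Finset.univ else {0} := by
    ext σ
    rw [mem_assignments, Fintype.mem_piFinset]
    refine forall_congr' fun v => ?_
    by_cases h : v ∈ U <;> simp [h]
  rw [this, Fintype.card_piFinset]
  simp only [apply_ite Finset.card, Finset.card_univ, Fintype.card_fin, Finset.card_singleton]
  rw [Finset.prod_ite_mem]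
  simp

/-- An assignment is compatible if adjacent vertices with nonzero values have the same value. -/
def Compatible (G : SimpleGraph V) (σ : V → Fin 4) : Prop :=
  ∀ u v, G.Adj u v → σ u ≠ 0 → σ v ≠ 0 → σ u = σ v

/-- The weight of the value `a` at the vertex `v`. -/
def stateWeight (z : ℕ) (E : V → ℕ) (v : V) (a : Fin 4) : ℕ :=
  if a = 0 then 1 else if a = 1 then 3 else z ^ E v

open Classical in
/-- The weighted number of compatible assignments. -/
noncomputable def partitionFunction (G : SimpleGraph V) (R : Finset V) (z : ℕ) (E : V → ℕ) : ℕ :=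
  ∑ σ ∈ assignments R, if Compatible G σ then ∏ v ∈ R, stateWeight z E v (σ v) else 0

/-- The colourings with two colours that are constant on the components of `G[X]`. -/
def Colouring (G : SimpleGraph V) (X : Finset V) : Type _ :=
  {f : ↥(X : Set V) → Bool // ∀ a b, (G.induce (X : Set V)).Adj a b → f a = f b}

noncomputable instance (X : Finset V) : Fintype (Colouring G X) := by
  classical
  unfold Colouring
  infer_instance

/-- A colouring without bichromatic edges is a function on the components. This turns connectedness
into a statement modulo 4. -/
theorem card_colouring (X : Finset V) :
    Fintype.card (Colouring G X) =
      2 ^ Nat.card (G.induce (X : Set V)).ConnectedComponent := by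
  classical
  have e : Colouring G X ≃ ((G.induce (X : Set V)).ConnectedComponent → Bool) :=
    { toFun := fun f => SimpleGraph.ConnectedComponent.lift f.1 fun u v p _ => by
        induction p with
        | nil => rfl
        | cons h p ih => rename_i hp; exact (f.2 _ _ h).trans (ih hp.of_cons)
      invFun := fun g => ⟨fun x => g ((G.induce (X : Set V)).connectedComponentMk x), fun a b h => by
        exact congrArg g (SimpleGraph.ConnectedComponent.sound h.reachable)⟩
      left_inv := fun f => by
        apply Subtype.ext
        funext x
        rfl
      right_inv := fun g => by
        funext C
        induction C using SimpleGraph.ConnectedComponent.ind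
        rfl }
  rw [← Nat.card_eq_fintype_card, Nat.card_congr e, Nat.card_fun]
  simp

theorem card_colouring_of_connected {X : Finset V} (h : (G.induce (X : Set V)).Connected) :
    Fintype.card (Colouring G X) = 2 := by
  rw [card_colouring]
  have h1 : Subsingleton (G.induce (X : Set V)).ConnectedComponent :=
    h.preconnected.subsingleton_connectedComponent
  have h2 : Nonempty (G.induce (X : Set V)).ConnectedComponent :=
    h.nonempty.map (G.induce (X : Set V)).connectedComponentMk
  rw [Nat.card_unique, pow_one]

/-- The vertices of `R` that are not dominated by `X`. -/
noncomputable def undominated (G : SimpleGraph V) (R X : Finset V) : Finset V := by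
  classical
  exact R.filter fun v => v ∉ X ∧ ∀ u ∈ X, ¬ G.Adj u v

theorem mem_undominated {R X : Finset V} {v : V} :
    v ∈ undominated G R X ↔ v ∈ R ∧ v ∉ X ∧ ∀ u ∈ X, ¬ G.Adj u v := by
  simp [undominated]

/-- The coefficient of `X` in the partition function. -/
noncomputable def cutCoeff (G : SimpleGraph V) (R X : Finset V) : ℕ :=
  Fintype.card (Colouring G X) * 4 ^ (undominated G R X).card

/-- The vertices whose value is a colour. -/
def colouredSet (σ : V → Fin 4) : Finset V :=
  Finset.univ.filter fun v => 2 ≤ σ v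

/-- The assignment given by a colouring of `X` and a set `Y` of vertices with value `1`. -/
def combine {X : Finset V} (p : Colouring G X × Finset V) (v : V) : Fin 4 :=
  if h : v ∈ X then (if p.1.1 ⟨v, h⟩ then 2 else 3) else if v ∈ p.2 then 1 else 0

theorem combine_eq_two {X : Finset V} (p : Colouring G X × Finset V) {v : V} (h : v ∈ X) :
    combine p v = 2 ↔ p.1.1 ⟨v, h⟩ = true := by
  by_cases hf : p.1.1 ⟨v, h⟩ <;> simp [combine, h, hf]

theorem two_le_combine {X : Finset V} (p : Colouring G X × Finset V) (v : V) :
    2 ≤ combine p v ↔ v ∈ X := by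
  by_cases h : v ∈ X
  · by_cases hf : p.1.1 ⟨v, h⟩ <;> simp [combine, h, hf]
  · by_cases hY : v ∈ p.2 <;> simp [combine, h, hY]

theorem combine_eq_one {X : Finset V} (p : Colouring G X × Finset V) {v : V} (h : v ∉ X) :
    combine p v = 1 ↔ v ∈ p.2 := by
  by_cases hY : v ∈ p.2 <;> simp [combine, h, hY]

theorem combine_eq_zero {X : Finset V} (p : Colouring G X × Finset V) {v : V} :
    combine p v = 0 ↔ v ∉ X ∧ v ∉ p.2 := by
  by_cases h : v ∈ X
  · by_cases hf : p.1.1 ⟨v, h⟩ <;> simp [combine, h, hf]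
  · by_cases hY : v ∈ p.2 <;> simp [combine, h, hY]

/-- Undominated vertices have no neighbour among the coloured ones, so the value 1 never conflicts
with a colour; two adjacent vertices of value 1 do not conflict either. -/
theorem compatible_combine {R X : Finset V} (p : Colouring G X × Finset V)
    (hp : p.2 ⊆ undominated G R X) : Compatible G (combine p) := by
  have hY : ∀ v ∈ p.2, v ∉ X ∧ ∀ u ∈ X, ¬ G.Adj u v := fun v hv => (mem_undominated.1 (hp hv)).2
  intro u v huv hu hv
  rw [Ne, combine_eq_zero, not_and_or, not_not, not_not] at hu hv
  by_cases huX : u ∈ X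
  · have hvX : v ∈ X := by
      by_contra hvX
      exact (hY v (hv.resolve_left hvX)).2 u huX huv
    have := p.1.2 ⟨u, huX⟩ ⟨v, hvX⟩ huv
    simp only [combine, huX, hvX, dif_pos, this]
  · have hu' := hu.resolve_left huX
    have hvX : v ∉ X := fun hvX => (hY u hu').2 v hvX huv.symm
    rw [(combine_eq_one p huX).2 hu', (combine_eq_one p hvX).2 (hv.resolve_left hvX)]

theorem prod_stateWeight_combine {R X : Finset V} (hX : X ⊆ R) (z : ℕ) (E : V → ℕ)
    (p : Colouring G X × Finset V) (hp : p.2 ⊆ undominated G R X) :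
    ∏ v ∈ R, stateWeight z E v (combine p v) = 3 ^ p.2.card * z ^ ∑ v ∈ X, E v := by
  have h : ∀ v ∈ R, stateWeight z E v (combine p v) =
      (if v ∈ p.2 then 3 else 1) * (if v ∈ X then z ^ E v else 1) := by
    intro v _
    by_cases hvX : v ∈ X
    · have hY : v ∉ p.2 := fun h => (mem_undominated.1 (hp h)).2.1 hvX
      have h2 := (two_le_combine p v).2 hvX
      have h0 : combine p v ≠ 0 := fun h => by rw [h] at h2; exact absurd h2 (by decide)
      have h1 : combine p v ≠ 1 := fun h => by rw [h] at h2; exact absurd h2 (by decide)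
      simp [stateWeight, h0, h1, hY, hvX]
    · by_cases hY : v ∈ p.2
      · simp [stateWeight, (combine_eq_one p hvX).2 hY, hvX, hY]
      · simp [stateWeight, (combine_eq_zero p).2 ⟨hvX, hY⟩, hvX, hY]
  have hpR : p.2 ⊆ R := fun v hv => (mem_undominated.1 (hp hv)).1
  rw [Finset.prod_congr rfl h, Finset.prod_mul_distrib, Finset.prod_ite_mem, Finset.prod_ite_mem,
    Finset.inter_eq_right.2 hX, Finset.inter_eq_right.2 hpR, Finset.prod_const,
    Finset.prod_pow_eq_pow_sum]

open Classical in
-- The compatible assignments with coloured set `X` correspond to pairs of a colouring of `G[X]` and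
-- a set `Y` of undominated vertices that receive the value 1, and the weight of such a pair is `3 ^
-- |Y|` times the monomial of `X`.
theorem sum_fiber {R X : Finset V} (hX : X ⊆ R) (z : ℕ) (E : V → ℕ) :
    ∑ σ ∈ assignments R with colouredSet σ = X,
      (if Compatible G σ then ∏ v ∈ R, stateWeight z E v (σ v) else 0) =
      cutCoeff G R X * z ^ ∑ v ∈ X, E v := by
  rw [← Finset.sum_filter]
  have h1 : cutCoeff G R X * z ^ ∑ v ∈ X, E v =
      ∑ p ∈ (Finset.univ : Finset (Colouring G X)) ×ˢ (undominated G R X).powerset,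
        3 ^ p.2.card * z ^ ∑ v ∈ X, E v := by
    rw [← Finset.sum_mul, Finset.sum_product, cutCoeff]
    congr 1
    -- Summing `3 ^ |Y|` over all sets `Y` of undominated vertices gives `(3 + 1)` to their number.
    have := Finset.sum_pow_mul_eq_add_pow 3 1 (undominated G R X)
    simp only [one_pow, mul_one] at this
    simp only [this, Finset.sum_const, Finset.card_univ, smul_eq_mul]
  rw [h1]
  symm
  refine Finset.sum_nbij (fun p => combine p) ?_ ?_ ?_ ?_
  · intro p hp
    have hp2 : p.2 ⊆ undominated G R X := Finset.mem_powerset.1 (Finset.mem_product.1 hp).2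
    refine Finset.mem_filter.2 ⟨Finset.mem_filter.2 ⟨mem_assignments.2 fun v hv => ?_, ?_⟩,
      compatible_combine p hp2⟩
    · exact (combine_eq_zero p).2 ⟨fun h => hv (hX h), fun h => hv (mem_undominated.1 (hp2 h)).1⟩
    · ext v
      simp [colouredSet, two_le_combine]
  · intro p hp q hq hpq
    have hp2 : p.2 ⊆ undominated G R X := by simpa using hp
    have hq2 : q.2 ⊆ undominated G R X := by simpa using hq
    have hpq' : ∀ v, combine p v = combine q v := fun v => congrFun hpq v
    refine Prod.ext (Subtype.ext (funext fun x => ?_)) (Finset.ext fun v => ?_)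
    · have h1 := combine_eq_two p x.2
      have h2 := combine_eq_two q x.2
      rw [hpq', h2] at h1
      exact Bool.eq_iff_iff.2 h1.symm
    · by_cases hv : v ∈ X
      · exact ⟨fun h => absurd hv (mem_undominated.1 (hp2 h)).2.1,
          fun h => absurd hv (mem_undominated.1 (hq2 h)).2.1⟩
      · rw [← combine_eq_one p hv, ← combine_eq_one q hv, hpq']
  · intro σ hσ
    have hσ' := Finset.mem_filter.1 (Finset.mem_coe.1 hσ)
    obtain ⟨hσ1, hcomp⟩ := hσ'
    obtain ⟨hR, hcol⟩ := Finset.mem_filter.1 hσ1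
    rw [mem_assignments] at hR
    have hX' : ∀ v, v ∈ X ↔ 2 ≤ σ v := fun v => by rw [← hcol]; simp [colouredSet]
    have hnz : ∀ v, v ∈ X → σ v ≠ 0 := fun v hv h => by
      have := (hX' v).1 hv
      rw [h] at this
      exact absurd this (by decide)
    refine ⟨(⟨fun x => decide (σ x.1 = 2), fun a b hab => ?_⟩,
      Finset.univ.filter fun v => σ v = 1), ?_, ?_⟩
    · have := hcomp a.1 b.1 hab (hnz _ a.2) (hnz _ b.2)
      simp only [this]
    · rw [Finset.mem_coe, Finset.mem_product, Finset.mem_powerset]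
      refine ⟨Finset.mem_univ _, fun v hv => ?_⟩
      have hv1 : σ v = 1 := by simpa using hv
      refine mem_undominated.2 ⟨?_, ?_, fun u hu huv => ?_⟩
      · by_contra h
        rw [hR v h] at hv1
        exact absurd hv1 (by decide)
      · rw [hX', hv1]; decide
      · have := hcomp u v huv (hnz u hu) (by rw [hv1]; decide)
        have h2 := (hX' u).1 hu
        rw [this, hv1] at h2
        exact absurd h2 (by decide)
    · funext v
      -- Decoding followed by encoding is the identity on the four values: `true` stands for 2 and
      -- `false` for 3.
      have : ∀ a : Fin 4, (if 2 ≤ a then (if a = 2 then 2 else 3) else if a = 1 then 1 else 0) = a := by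
        decide
      rw [← this (σ v)]
      by_cases hv : v ∈ X
      · have h2 := (hX' v).1 hv
        simp [combine, hv, h2]
      · have h2 := mt (hX' v).2 hv
        simp [combine, hv, h2]
  · intro p hp
    exact (prod_stateWeight_combine hX z E p (Finset.mem_powerset.1 (Finset.mem_product.1 hp).2)).symm

theorem partitionFunction_eq (R : Finset V) (z : ℕ) (E : V → ℕ) :
    partitionFunction G R z E =
      ∑ X ∈ R.powerset, cutCoeff G R X * z ^ ∑ v ∈ X, E v := by
  rw [partitionFunction, ← Finset.sum_fiberwise_of_maps_to (g := colouredSet) (t := R.powerset)]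
  · exact Finset.sum_congr rfl fun X hX => sum_fiber (Finset.mem_powerset.1 hX) z E
  · intro σ hσ
    rw [Finset.mem_powerset]
    intro v hv
    by_contra h
    have : 2 ≤ σ v := by simpa [colouredSet] using hv
    rw [mem_assignments.1 hσ v h] at this
    exact absurd this (by decide)

/-- Evaluate at `z = 1`: there are `4 ^ |R|` assignments, each of weight at most `3 ^ |R|`. -/
theorem sum_cutCoeff_le (R : Finset V) : ∑ X ∈ R.powerset, cutCoeff G R X ≤ 12 ^ R.card := by
  have h := partitionFunction_eq (G := G) R 1 0
  simp only [one_pow, mul_one] at h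
  rw [← h, partitionFunction]
  calc _ ≤ ∑ σ ∈ assignments R, 3 ^ R.card := by
        refine Finset.sum_le_sum fun σ _ => ?_
        split
        · refine (Finset.prod_le_pow_card _ _ 3 fun v _ => ?_)
          unfold stateWeight
          split_ifs <;> simp
        · exact Nat.zero_le _
    _ = 12 ^ R.card := by
        rw [Finset.sum_const, card_assignments, smul_eq_mul, ← mul_pow, show 4 * 3 = 12 from rfl]

/-- A solution has two colourings and no undominated vertex. Otherwise either there is an
undominated vertex, which contributes a factor 4, or there are at least two components, which give
at least four colourings. -/
theorem cutCoeff_mod_four {R X : Finset V} (hR : R.Nonempty) (hX : X ⊆ R) :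
    (IsCDSOn G R X → cutCoeff G R X = 2) ∧ (¬ IsCDSOn G R X → 4 ∣ cutCoeff G R X) := by
  constructor
  · rintro ⟨-, hdom, hconn⟩
    have : undominated G R X = ∅ := by
      rw [Finset.eq_empty_iff_forall_notMem]
      intro v hv
      obtain ⟨hvR, hvX, hv⟩ := mem_undominated.1 hv
      obtain ⟨u, hu, huv⟩ := (hdom v hvR).resolve_left hvX
      exact hv u hu huv
    rw [cutCoeff, this, card_colouring_of_connected hconn]
    simp
  · intro h
    by_cases hdom : ∀ v ∈ R, v ∈ X ∨ ∃ u ∈ X, G.Adj u v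
    · have hconn : ¬ (G.induce (X : Set V)).Connected := fun hc => h ⟨hX, hdom, hc⟩
      refine Dvd.dvd.mul_right ?_ _
      rw [card_colouring]
      refine pow_dvd_pow 2 (n := Nat.card (G.induce (X : Set V)).ConnectedComponent) (m := 2) ?_
      by_contra hlt
      have hsub : Subsingleton (G.induce (X : Set V)).ConnectedComponent := by
        rw [← Finite.card_le_one_iff_subsingleton]
        omega
      -- The empty set has no components, but it dominates nothing; this is where `R` must be
      -- nonempty.
      obtain ⟨v, hv⟩ := hR
      have hne : Nonempty (X : Set V) := by
        rcases hdom v hv with h | ⟨u, hu, -⟩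
        · exact ⟨⟨v, h⟩⟩
        · exact ⟨⟨u, hu⟩⟩
      exact hconn ⟨fun a b => SimpleGraph.ConnectedComponent.exact (Subsingleton.elim _ _)⟩
    · push Not at hdom
      obtain ⟨v, hvR, hvX, hv⟩ := hdom
      have : v ∈ undominated G R X := mem_undominated.2 ⟨hvR, hvX, hv⟩
      have hpos : (undominated G R X).card ≠ 0 := Finset.card_ne_zero_of_mem this
      exact Dvd.dvd.mul_left (dvd_pow_self 4 hpos) _

/-- Coefficient extraction. -/
theorem sum_mul_pow_div_mod {ι : Type*} (S : Finset ι) (a e : ι → ℕ) {z : ℕ} (hz : 4 ∣ z)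
    (ha : ∑ X ∈ S, a X < z) (i : ℕ) :
    (∑ X ∈ S, a X * z ^ e X) / z ^ i % 4 = (∑ X ∈ S with e X = i, a X) % 4 := by
  have hzpos : 0 < z := by omega
  -- Split according to the exponent. The part below `z ^ i` disappears in the division because the
  -- sum of all coefficients is less than `z`, so nothing is carried; the part above is a multiple
  -- of `z` and vanishes modulo 4.
  have hsplit : ∀ X ∈ S, a X * z ^ e X = (if e X < i then a X * z ^ e X else 0) +
      z ^ i * ((if e X = i then a X else 0) + z * (if i < e X then a X * z ^ (e X - i - 1) else 0)) := by
    intro X _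
    rcases lt_trichotomy (e X) i with h | h | h
    · simp [h, h.ne, h.not_gt]
    · simp [h, mul_comm]
    · have : z ^ e X = z ^ i * (z * z ^ (e X - i - 1)) := by
        rw [← pow_succ', ← pow_add]; congr 1; omega
      simp only [h.not_gt, h.ne', h, if_true, if_false, zero_add, this]
      ring
  rw [Finset.sum_congr rfl hsplit, Finset.sum_add_distrib, ← Finset.mul_sum, Finset.sum_add_distrib,
    ← Finset.mul_sum, ← Finset.sum_filter (p := fun X => e X = i)]
  have hlow : ∑ X ∈ S, (if e X < i then a X * z ^ e X else 0) < z ^ i := by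
    rcases Nat.eq_zero_or_pos i with rfl | hi
    · simp
    · calc ∑ X ∈ S, (if e X < i then a X * z ^ e X else 0) ≤ ∑ X ∈ S, a X * z ^ (i - 1) := by
            refine Finset.sum_le_sum fun X _ => ?_
            split
            · exact Nat.mul_le_mul_left _ (Nat.pow_le_pow_right hzpos (by omega))
            · exact Nat.zero_le _
        _ = (∑ X ∈ S, a X) * z ^ (i - 1) := (Finset.sum_mul _ _ _).symm
        _ < z * z ^ (i - 1) := Nat.mul_lt_mul_of_pos_right ha (Nat.pow_pos hzpos)
        _ = z ^ i := by rw [← pow_succ']; congr 1; omega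
  rw [Nat.add_mul_div_left _ _ (Nat.pow_pos hzpos), Nat.div_eq_of_lt hlow, zero_add]
  obtain ⟨y, rfl⟩ := hz
  rw [mul_assoc, Nat.add_mul_mod_self_left]

/-- The digit of `z ^ i` is 2 modulo 4 exactly when the number of solutions of combined weight `i`
is odd. An odd number is not zero, and one solution is an odd number. -/
theorem partitionFunction_div_mod {R : Finset V} (hR : R.Nonempty) {z : ℕ} (hz : 4 ∣ z)
    (hz' : 12 ^ R.card < z) (E : V → ℕ) (i : ℕ) :
    partitionFunction G R z E / z ^ i % 4 =
      2 * {X : Finset V | IsCDSOn G R X ∧ ∑ v ∈ X, E v = i}.ncard % 4 := by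
  classical
  rw [partitionFunction_eq, sum_mul_pow_div_mod _ _ _ hz ((sum_cutCoeff_le R).trans_lt hz')]
  have h1 : (∑ X ∈ R.powerset with ∑ v ∈ X, E v = i, cutCoeff G R X) % 4 =
      (∑ X ∈ R.powerset with ∑ v ∈ X, E v = i, if IsCDSOn G R X then 2 else 0) % 4 := by
    rw [Finset.sum_nat_mod]
    conv_rhs => rw [Finset.sum_nat_mod]
    congr 1
    refine Finset.sum_congr rfl fun X hX => ?_
    have hX' := Finset.mem_powerset.1 (Finset.mem_filter.1 hX).1
    obtain ⟨h1, h2⟩ := cutCoeff_mod_four (G := G) hR hX'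
    split
    · next h => rw [h1 h]
    · next h => rw [Nat.mod_eq_zero_of_dvd (h2 h)]
  rw [h1, ← Finset.sum_filter, Finset.sum_const, smul_eq_mul, mul_comm, Finset.filter_filter,
    ← Set.ncard_coe_finset]
  congr 3
  ext X
  simp only [Finset.coe_filter, Finset.mem_powerset, Set.mem_ofPred_eq]
  exact ⟨fun h => ⟨h.2.2, h.2.1⟩, fun h => ⟨h.1.1, h.2, h.1⟩⟩

/-- This permits computing modulo `z ^ (∑ v, E v + 1)`, which keeps the numbers in the tables short
without losing the value. -/
theorem partitionFunction_lt {R : Finset V} {z : ℕ} (hz' : 12 ^ R.card < z) (E : V → ℕ) :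
    partitionFunction G R z E < z ^ (∑ v, E v + 1) := by
  have hzpos : 0 < z := (Nat.zero_le _).trans_lt hz'
  rw [partitionFunction_eq]
  calc _ ≤ ∑ X ∈ R.powerset, cutCoeff G R X * z ^ ∑ v, E v :=
        Finset.sum_le_sum fun X _ => Nat.mul_le_mul_left _ (Nat.pow_le_pow_right hzpos
          (Finset.sum_le_sum_of_subset (Finset.subset_univ X)))
    _ = (∑ X ∈ R.powerset, cutCoeff G R X) * z ^ ∑ v, E v := (Finset.sum_mul _ _ _).symm
    _ < z * z ^ ∑ v, E v :=
        Nat.mul_lt_mul_of_pos_right ((sum_cutCoeff_le R).trans_lt hz') (Nat.pow_pos hzpos)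
    _ = _ := (pow_succ' _ _).symm

end CutCount

/-! ### Dynamic programming over a tree of bags -/

section TreeSum

set_option linter.unusedSectionVars false

variable {V : Type*} [Fintype V] [DecidableEq V] {A : Type*} [CommSemiring A]

/-- Replace the values outside `U` by `0`. -/
def mask (U : Finset V) (σ : V → Fin 4) : V → Fin 4 := fun v => if v ∈ U then σ v else 0

theorem mask_mem_assignments (U : Finset V) (σ : V → Fin 4) : mask U σ ∈ assignments U :=
  mem_assignments.2 fun v hv => by simp [mask, hv]

theorem mask_congr {U : Finset V} {σ τ : V → Fin 4} (h : ∀ v ∈ U, σ v = τ v) :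
    mask U σ = mask U τ := by
  funext v
  by_cases hv : v ∈ U
  · simp [mask, hv, h v hv]
  · simp [mask, hv]

theorem mask_eq_self {U : Finset V} {σ : V → Fin 4} (h : σ ∈ assignments U) : mask U σ = σ := by
  funext v
  by_cases hv : v ∈ U
  · simp [mask, hv]
  · simp [mask, hv, mem_assignments.1 h v hv]

/-- As assignments vanish outside their supports, adding two of them with disjoint supports glues
them together. -/
theorem sum_assignments_union {U D : Finset V} (h : Disjoint U D) (φ : (V → Fin 4) → A) :
    ∑ σ ∈ assignments (U ∪ D), φ σ = ∑ σ ∈ assignments U, ∑ δ ∈ assignments D, φ (σ + δ) := by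
  rw [← Finset.sum_product' (f := fun σ δ => φ (σ + δ))]
  have hD : ∀ v ∈ U, v ∉ D := fun v hv => Finset.disjoint_left.1 h hv
  refine Finset.sum_bij' (fun σ _ => (mask U σ, mask D σ)) (fun p _ => p.1 + p.2) ?_ ?_ ?_ ?_ ?_
  · intro σ _
    exact Finset.mem_product.2 ⟨mask_mem_assignments U σ, mask_mem_assignments D σ⟩
  · intro p hp
    obtain ⟨h1, h2⟩ := Finset.mem_product.1 hp
    refine mem_assignments.2 fun v hv => ?_
    rw [Finset.mem_union, not_or] at hv
    simp [mem_assignments.1 h1 v hv.1, mem_assignments.1 h2 v hv.2]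
  · intro σ hσ
    funext v
    by_cases hU : v ∈ U
    · simp [mask, hU, hD v hU]
    · by_cases hv : v ∈ D
      · simp [mask, hU, hv]
      · have := mem_assignments.1 hσ v (by simp [hU, hv])
        simp [mask, hU, hv, this]
  · intro p hp
    obtain ⟨h1, h2⟩ := Finset.mem_product.1 hp
    refine Prod.ext ?_ ?_ <;> funext v
    · by_cases hU : v ∈ U
      · simp [mask, hU, mem_assignments.1 h2 v (hD v hU)]
      · simp [mask, hU, mem_assignments.1 h1 v hU]
    · by_cases hv : v ∈ D
      · have hU : v ∉ U := fun hU => hD v hU hv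
        simp [mask, hv, mem_assignments.1 h1 v hU]
      · simp [mask, hv, mem_assignments.1 h2 v hv]
  · intro σ hσ
    congr 1
    funext v
    by_cases hU : v ∈ U
    · simp [mask, hU, hD v hU]
    · by_cases hv : v ∈ D
      · simp [mask, hU, hv]
      · have := mem_assignments.1 hσ v (by simp [hU, hv])
        simp [mask, hU, hv, this]

/-- The inner sum of the recurrence, over assignments with a prescribed restriction to the
separator, becomes a free sum over the values at the new vertices. -/
theorem sum_assignments_of_mask_eq {S B : Finset V} (h : S ⊆ B) {c : V → Fin 4}
    (hc : c ∈ assignments S) (φ : (V → Fin 4) → A) :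
    ∑ b ∈ assignments B with mask S b = c, φ b = ∑ δ ∈ assignments (B \ S), φ (c + δ) := by
  have hdis : Disjoint S (B \ S) := Finset.disjoint_sdiff
  rw [Finset.sum_filter, ← Finset.union_sdiff_of_subset h, sum_assignments_union hdis]
  rw [Finset.sum_eq_single c]
  · rw [Finset.union_sdiff_of_subset h]
    refine Finset.sum_congr rfl fun δ hδ => if_pos ?_
    rw [mask_congr (τ := c), mask_eq_self hc]
    intro v hv
    simp [mem_assignments.1 hδ v (by simp [hv])]
  · intro σ hσ hne
    refine Finset.sum_eq_zero fun δ hδ => if_neg fun h' => hne ?_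
    rw [← h', mask_congr (τ := σ), mask_eq_self hσ]
    intro v hv
    simp [mem_assignments.1 hδ v (by simp [hv])]
  · exact fun h' => absurd hc h'

/-- A sequence of bags such that every bag meets the earlier ones only within its parent. -/
structure BagTree (m : ℕ) (B : ℕ → Finset V) (par : ℕ → ℕ) : Prop where
  pos : 1 ≤ m
  bag_zero : B 0 = ∅
  par_one : par 1 = 0
  par_pos : ∀ i, 2 ≤ i → i ≤ m → 1 ≤ par i
  par_lt : ∀ i, 1 ≤ i → i ≤ m → par i < i
  mem_par : ∀ i, 1 ≤ i → i ≤ m → ∀ j < i, ∀ v, v ∈ B i → v ∈ B j → v ∈ B (par i)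

/-- The part of a bag that it shares with its parent. -/
def sep (B : ℕ → Finset V) (par : ℕ → ℕ) (i : ℕ) : Finset V := B i ∩ B (par i)

/-- The recurrence for the partial sums below bag `i`. -/
def TreeRecurrence (m : ℕ) (B : ℕ → Finset V) (par : ℕ → ℕ) (f : V → Fin 4 → A)
    (χ : ℕ → (V → Fin 4) → A) (g : ℕ → (V → Fin 4) → A) (i : ℕ) : Prop :=
  ∀ c ∈ assignments (sep B par i), g i c =
    ∑ b ∈ assignments (B i) with mask (sep B par i) b = c,
      χ i b * (∏ v ∈ B i \ sep B par i, f v (b v)) *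
        ∏ j ∈ Finset.Icc 1 m with par j = i, g j (mask (sep B par j) b)

/-- The total sum is folded up bag by bag, from the last to the first. The values in `A` are
arbitrary, so that the statement can be used modulo a number. -/
theorem BagTree.sum_eq {m : ℕ} {B : ℕ → Finset V} {par : ℕ → ℕ} (hB : BagTree m B par)
    {f : V → Fin 4 → A} {χ g : ℕ → (V → Fin 4) → A}
    (hχ : ∀ i σ, χ i σ = χ i (mask (B i) σ))
    (hg : ∀ i, 1 ≤ i → i ≤ m → TreeRecurrence m B par f χ g i) :
    g 1 0 = ∑ σ ∈ assignments ((Finset.range (m + 1)).biUnion B),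
      (∏ v ∈ (Finset.range (m + 1)).biUnion B, f v (σ v)) * ∏ i ∈ Finset.Icc 1 m, χ i σ := by
  set U : ℕ → Finset V := fun i => (Finset.range i).biUnion B with hU
  have hBU : ∀ j i, j < i → B j ⊆ U i := fun j i hj =>
    Finset.subset_biUnion_of_mem B (Finset.mem_range.2 hj)
  -- The partially folded sum: the bags before `i` are still expanded, and each later bag whose
  -- parent is before `i` is represented by its table entry. `T (m + 1)` is the total sum and `T 1`
  -- is the table of the root.
  set T : ℕ → A := fun i => ∑ σ ∈ assignments (U i), (∏ v ∈ U i, f v (σ v)) *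
    ((∏ j ∈ Finset.Ico 1 i, χ j σ) *
      ∏ j ∈ Finset.Ico i (m + 1) with par j < i, g j (mask (sep B par j) σ)) with hT
  have hstep : ∀ i, 1 ≤ i → i ≤ m → T (i + 1) = T i := by
    intro i h1 hm
    set S := sep B par i with hS
    set D := B i \ S with hD
    have hSB : S ⊆ B i := Finset.inter_subset_left
    have hSU : S ⊆ U i := Finset.inter_subset_right.trans (hBU _ _ (hB.par_lt i h1 hm))
    -- The vertices of bag `i` that occurred earlier are exactly the shared ones, so `D` consists of
    -- genuinely new vertices and is disjoint from `U i`.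
    have hint : ∀ v ∈ B i, v ∈ U i → v ∈ S := by
      intro v hv hvU
      obtain ⟨j, hj, hvj⟩ := Finset.mem_biUnion.1 hvU
      exact Finset.mem_inter.2 ⟨hv, hB.mem_par i h1 hm j (Finset.mem_range.1 hj) v hv hvj⟩
    have hdis : Disjoint (U i) D := by
      rw [Finset.disjoint_left]
      intro v hvU hvD
      exact (Finset.mem_sdiff.1 hvD).2 (hint v (Finset.mem_sdiff.1 hvD).1 hvU)
    have hUi : U (i + 1) = U i ∪ D := by
      have : U (i + 1) = U i ∪ B i := by
        simp only [hU, Finset.range_add_one, Finset.biUnion_insert, Finset.union_comm]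
      rw [this]
      ext v
      simp only [Finset.mem_union, hD, Finset.mem_sdiff]
      constructor
      · rintro (h | h)
        · exact Or.inl h
        · by_cases hv : v ∈ S
          · exact Or.inl (hSU hv)
          · exact Or.inr ⟨h, hv⟩
      · rintro (h | h)
        · exact Or.inl h
        · exact Or.inr h.1
    simp only [hT]
    rw [hUi, sum_assignments_union hdis]
    refine Finset.sum_congr rfl fun σ hσ => ?_
    have hσD : ∀ v ∈ D, σ v = 0 := fun v hv =>
      mem_assignments.1 hσ v fun h => Finset.disjoint_left.1 hdis h hv
    have hterm : ∀ δ ∈ assignments D,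
        (∏ v ∈ U i ∪ D, f v ((σ + δ) v)) * ((∏ j ∈ Finset.Ico 1 (i + 1), χ j (σ + δ)) *
          ∏ j ∈ Finset.Ico (i + 1) (m + 1) with par j < i + 1, g j (mask (sep B par j) (σ + δ))) =
        ((∏ v ∈ U i, f v (σ v)) * ((∏ j ∈ Finset.Ico 1 i, χ j σ) *
          ∏ j ∈ Finset.Ico (i + 1) (m + 1) with par j < i, g j (mask (sep B par j) σ))) *
        (χ i (mask S σ + δ) * (∏ v ∈ D, f v ((mask S σ + δ) v)) *
          ∏ j ∈ Finset.Icc 1 m with par j = i, g j (mask (sep B par j) (mask S σ + δ))) := by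
      intro δ hδ
      have hδU : ∀ v ∈ U i, δ v = 0 := fun v hv =>
        mem_assignments.1 hδ v fun h => Finset.disjoint_left.1 hdis hv h
      have e1 : ∏ v ∈ U i ∪ D, f v ((σ + δ) v) =
          (∏ v ∈ U i, f v (σ v)) * ∏ v ∈ D, f v ((mask S σ + δ) v) := by
        rw [Finset.prod_union hdis]
        congr 1
        · exact Finset.prod_congr rfl fun v hv => by simp [hδU v hv]
        · refine Finset.prod_congr rfl fun v hv => ?_
          have : v ∉ S := (Finset.mem_sdiff.1 hv).2
          simp [hσD v hv, mask, this]
      have hagree : ∀ v ∈ B i, (σ + δ) v = (mask S σ + δ) v := by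
        intro v hv
        by_cases hvS : v ∈ S
        · simp [mask, hvS]
        · simp [mask, hvS, hσD v (Finset.mem_sdiff.2 ⟨hv, hvS⟩)]
      have e2 : ∏ j ∈ Finset.Ico 1 (i + 1), χ j (σ + δ) =
          (∏ j ∈ Finset.Ico 1 i, χ j σ) * χ i (mask S σ + δ) := by
        rw [Finset.prod_Ico_succ_top h1]
        congr 1
        · refine Finset.prod_congr rfl fun j hj => ?_
          rw [hχ j, hχ j σ]
          congr 1
          exact mask_congr fun v hv => by
            simp [hδU v (hBU j i (Finset.mem_Ico.1 hj).2 hv)]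
        · rw [hχ i, hχ i (mask S σ + δ), mask_congr hagree]
      -- The pending bags after expanding bag `i` are the old pending ones and the children of `i`.
      -- The tables of the former do not see the new vertices, those of the latter depend only on
      -- values inside bag `i`.
      have e3 : ∏ j ∈ Finset.Ico (i + 1) (m + 1) with par j < i + 1,
            g j (mask (sep B par j) (σ + δ)) =
          (∏ j ∈ Finset.Ico (i + 1) (m + 1) with par j < i, g j (mask (sep B par j) σ)) *
          ∏ j ∈ Finset.Icc 1 m with par j = i, g j (mask (sep B par j) (mask S σ + δ)) := by
        have hset : (Finset.Ico (i + 1) (m + 1)).filter (fun j => par j < i + 1) =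
            (Finset.Ico (i + 1) (m + 1)).filter (fun j => par j < i) ∪
            (Finset.Icc 1 m).filter (fun j => par j = i) := by
          ext j
          simp only [Finset.mem_filter, Finset.mem_union, Finset.mem_Ico, Finset.mem_Icc]
          constructor
          · rintro ⟨⟨a1, a2⟩, a3⟩
            rcases Nat.lt_succ_iff_lt_or_eq.1 a3 with h | h
            · exact Or.inl ⟨⟨a1, a2⟩, h⟩
            · exact Or.inr ⟨⟨by omega, by omega⟩, h⟩
          · rintro (⟨⟨a1, a2⟩, a3⟩ | ⟨⟨a1, a2⟩, a3⟩)
            · exact ⟨⟨a1, a2⟩, by omega⟩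
            · have := hB.par_lt j a1 a2
              exact ⟨⟨by omega, by omega⟩, by omega⟩
        rw [hset, Finset.prod_union]
        · congr 1
          · refine Finset.prod_congr rfl fun j hj => ?_
            congr 1
            refine mask_congr fun v hv => ?_
            have : v ∈ U i := hBU (par j) i (Finset.mem_filter.1 hj).2 (Finset.mem_inter.1 hv).2
            simp [hδU v this]
          · refine Finset.prod_congr rfl fun j hj => ?_
            congr 1
            refine mask_congr fun v hv => hagree v ?_
            have := (Finset.mem_inter.1 hv).2
            rwa [(Finset.mem_filter.1 hj).2] at this
        · rw [Finset.disjoint_left]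
          intro j hj hj'
          have := (Finset.mem_filter.1 hj).2
          have := (Finset.mem_filter.1 hj').2
          omega
      rw [e1, e2, e3]
      ring
    rw [Finset.sum_congr rfl hterm, ← Finset.mul_sum, ← sum_assignments_of_mask_eq hSB
      (mask_mem_assignments S σ) (fun b => χ i b * (∏ v ∈ D, f v (b v)) *
          ∏ j ∈ Finset.Icc 1 m with par j = i, g j (mask (sep B par j) b)),
      ← hg i h1 hm _ (mask_mem_assignments S σ)]
    -- Before the expansion bag `i` itself is pending; its table entry is the factor that the
    -- recurrence has just produced.
    have hset : (Finset.Ico i (m + 1)).filter (fun j => par j < i) =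
        insert i ((Finset.Ico (i + 1) (m + 1)).filter (fun j => par j < i)) := by
      ext j
      simp only [Finset.mem_filter, Finset.mem_insert, Finset.mem_Ico]
      constructor
      · rintro ⟨⟨a1, a2⟩, a3⟩
        by_cases h : j = i
        · exact Or.inl h
        · exact Or.inr ⟨⟨by omega, a2⟩, a3⟩
      · rintro (rfl | ⟨⟨a1, a2⟩, a3⟩)
        · exact ⟨⟨le_rfl, by omega⟩, hB.par_lt j h1 hm⟩
        · exact ⟨⟨by omega, a2⟩, a3⟩
    rw [hset, Finset.prod_insert (by simp)]
    ring
  have hall : ∀ k, k ≤ m → T (m + 1 - k) = T (m + 1) := by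
    intro k
    induction k with
    | zero => intro _; rfl
    | succ k ih =>
      intro hk
      rw [← ih (by omega), show m + 1 - k = (m + 1 - (k + 1)) + 1 by omega]
      exact (hstep _ (by omega) (by omega)).symm
  have h1 : T 1 = g 1 0 := by
    have hU1 : U 1 = ∅ := by simp [hU, hB.bag_zero]
    have hA : assignments (∅ : Finset V) = {0} := by
      ext σ
      rw [mem_assignments, Finset.mem_singleton]
      exact ⟨fun h => funext fun v => h v (by simp), fun h => by simp [h]⟩
    have hset : (Finset.Ico 1 (m + 1)).filter (fun j => par j < 1) = {1} := by
      ext j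
      simp only [Finset.mem_filter, Finset.mem_Ico, Finset.mem_singleton]
      have := hB.pos
      constructor
      · rintro ⟨⟨a1, a2⟩, a3⟩
        by_contra h
        have := hB.par_pos j (by omega) (by omega)
        omega
      · rintro rfl
        exact ⟨⟨le_rfl, by omega⟩, by rw [hB.par_one]; norm_num⟩
    have hz : mask (sep B par 1) (0 : V → Fin 4) = 0 := by
      funext v; simp [mask]
    simp only [hT, hU1, hA, hset, Finset.sum_singleton, Finset.prod_singleton, Finset.prod_empty,
      Finset.Ico_self, one_mul, hz]
  have h2 := hall m le_rfl
  rw [show m + 1 - m = 1 by omega, h1] at h2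
  rw [h2]
  simp only [hT]
  refine Finset.sum_congr rfl fun σ _ => ?_
  rw [Finset.filter_eq_empty_iff.2 (by simp), Finset.prod_empty, mul_one]
  rfl

open Classical in
/-- The indicator function of compatibility within a vertex set. -/
noncomputable def localFactor (G : SimpleGraph V) (S : Finset V) (σ : V → Fin 4) : A :=
  if ∀ u ∈ S, ∀ v ∈ S, G.Adj u v → σ u ≠ 0 → σ v ≠ 0 → σ u = σ v then 1 else 0

/-- Every edge within `R` lies in some bag, so global compatibility is the product of the local
factors. A local factor may test the same edge in several bags, which is harmless for 0-1 values. -/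
theorem BagTree.eq_partitionFunction {m : ℕ} {B : ℕ → Finset V} {par : ℕ → ℕ}
    (hB : BagTree m B par) {G : SimpleGraph V} {R : Finset V} {z : ℕ} {E : V → ℕ}
    {g : ℕ → (V → Fin 4) → A} (hR : (Finset.range (m + 1)).biUnion B = R)
    (hG : ∀ u ∈ R, ∀ v ∈ R, G.Adj u v → ∃ i ∈ Finset.Icc 1 m, u ∈ B i ∧ v ∈ B i)
    (hg : ∀ i, 1 ≤ i → i ≤ m → TreeRecurrence m B par (fun v a => (stateWeight z E v a : A))
      (fun i => localFactor G (B i)) g i) :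
    g 1 0 = (partitionFunction G R z E : A) := by
  classical
  rw [hB.sum_eq (fun i σ => ?_) hg, hR, partitionFunction, Nat.cast_sum]
  · refine Finset.sum_congr rfl fun σ hσ => ?_
    have hnz : ∀ v, σ v ≠ 0 → v ∈ R := fun v hv => by
      by_contra h
      exact hv (mem_assignments.1 hσ v h)
    by_cases hc : Compatible G σ
    · rw [if_pos hc, Finset.prod_eq_one (s := Finset.Icc 1 m), mul_one, Nat.cast_prod]
      exact fun i _ => if_pos fun u _ v _ => hc u v
    · rw [if_neg hc, Nat.cast_zero]
      unfold Compatible at hc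
      push Not at hc
      obtain ⟨u, v, huv, hu, hv, hne⟩ := hc
      obtain ⟨i, hi, hui, hvi⟩ := hG u (hnz u hu) v (hnz v hv) huv
      rw [Finset.prod_eq_zero hi, mul_zero]
      exact if_neg fun h => hne (h u hui v hvi huv hu hv)
  · unfold localFactor
    congr 1
    refine propext ⟨fun h u hu v hv => ?_, fun h u hu v hv => ?_⟩ <;>
    · have := h u hu v hv
      simpa [mask, hu, hv] using this

end TreeSum

/-! ### The isolation lemma for independent fair coins -/

section Isolation

open MeasureTheory

/-- The number with the binary digits `ω a, …, ω (a + j - 1)`. -/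
def bitsValue (ω : ℕ → Bool) (a : ℕ) : ℕ → ℕ
  | 0 => 0
  | j + 1 => 2 * bitsValue ω a j + (ω (a + j)).toNat

theorem bitsValue_lt (ω : ℕ → Bool) (a j : ℕ) : bitsValue ω a j < 2 ^ j := by
  induction j with
  | zero => simp [bitsValue]
  | succ j ih =>
    have := Bool.toNat_lt (ω (a + j))
    rw [bitsValue, pow_succ]
    omega

theorem bitsValue_congr {ω ω' : ℕ → Bool} {a j : ℕ} :
    bitsValue ω a j = bitsValue ω' a j ↔ ∀ i < j, ω (a + i) = ω' (a + i) := by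
  induction j with
  | zero => simp [bitsValue]
  | succ j ih =>
    have h1 := Bool.toNat_lt (ω (a + j))
    have h2 := Bool.toNat_lt (ω' (a + j))
    rw [bitsValue, bitsValue]
    constructor
    · intro h i hi
      rcases Nat.lt_succ_iff_lt_or_eq.1 hi with h' | rfl
      · exact ih.1 (by omega) i h'
      · cases h3 : ω (a + i) <;> cases h4 : ω' (a + i) <;> simp_all <;> omega
    · intro h
      rw [ih.2 fun i hi => h i (by omega), h j (by omega)]

/-- The weights obtained from the coin tosses, with `l` bits each. -/
def coinWeight {n : ℕ} (ω : ℕ → Bool) (l : ℕ) (v : Fin n) : ℕ :=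
  bitsValue ω (v * l) l

theorem measurable_coinWeight (n l : ℕ) :
    Measurable fun (ω : ℕ → Bool) (v : Fin n) => coinWeight ω l v := by
  refine measurable_pi_lambda _ fun v => ?_
  unfold coinWeight
  generalize v * l = a
  induction l with
  | zero => exact measurable_const
  | succ j ih =>
    refine (ih.const_mul 2).add ?_
    exact (measurable_of_countable Bool.toNat).comp (measurable_pi_apply _)

/-- The vertex `v` distinguishes two members of minimum weight. -/
def Ambiguous {V : Type*} (F : Set (Finset V)) (v : V) (w : V → ℕ) : Prop :=
  ∃ X Y, IsMinWeight w F X ∧ IsMinWeight w F Y ∧ v ∈ X ∧ v ∉ Y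

/-- If the minimum is attained twice, the two sets differ at some vertex. -/
theorem exists_ambiguous {V : Type*} {F : Set (Finset V)} (hF : F.Nonempty) {w : V → ℕ}
    (h : ¬ Isolates w F) : ∃ v, Ambiguous F v w := by
  obtain ⟨X, hX, hmin⟩ := exists_minimalFor_of_wellFoundedLT (· ∈ F) (fun X => ∑ v ∈ X, w v) hF
  have hX' : IsMinWeight w F X := ⟨hX, fun T hT => by
    rcases le_total (∑ v ∈ X, w v) (∑ v ∈ T, w v) with h | h
    exacts [h, hmin hT h]⟩
  have : ∃ Y, IsMinWeight w F Y ∧ Y ≠ X := by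
    by_contra! hc
    exact h ⟨X, hX', hc⟩
  obtain ⟨Y, hY, hne⟩ := this
  by_contra! hc
  refine hne (Finset.ext fun v => ⟨fun hv => ?_, fun hv => ?_⟩)
  · by_contra h'
    exact hc v ⟨Y, X, hY, hX', hv, h'⟩
  · by_contra h'
    exact hc v ⟨X, Y, hX', hY, hv, h'⟩

/-- With the other weights fixed, compare the least weight of a member containing `v`, not counting
`v` itself, with the least weight of a member avoiding `v`. Ambiguity says that `w v` is their
difference, so at most one value is possible. -/
theorem Ambiguous.eq_of_eqOn {V : Type*} {F : Set (Finset V)} {v : V} {w w' : V → ℕ}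
    (h : Ambiguous F v w) (h' : Ambiguous F v w') (hw : ∀ u, u ≠ v → w u = w' u) : w v = w' v := by
  classical
  obtain ⟨X, Y, hX, hY, hvX, hvY⟩ := h
  obtain ⟨X', Y', hX', hY', hvX', hvY'⟩ := h'
  have e : ∀ {Z : Finset V}, v ∉ Z → ∑ u ∈ Z, w u = ∑ u ∈ Z, w' u := fun hZ =>
    Finset.sum_congr rfl fun u hu => hw u fun h => hZ (h ▸ hu)
  have e' : ∀ {Z : Finset V}, v ∈ Z → ∑ u ∈ Z, w u + w' v = ∑ u ∈ Z, w' u + w v := fun {Z} hZ => by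
    rw [← Finset.add_sum_erase Z w hZ, ← Finset.add_sum_erase Z w' hZ,
      e (Finset.notMem_erase v Z)]
    ring
  have h1 := hY.2 Y' hY'.1
  have h2 := hY'.2 Y hY.1
  have h3 := hX.2 Y hY.1
  have h4 := hY.2 X hX.1
  have h5 := hX'.2 Y' hY'.1
  have h6 := hY'.2 X' hX'.1
  have h7 := hX.2 X' hX'.1
  have h8 := hX'.2 X hX.1
  have := e hvY
  have := e hvY'
  have := e' hvX
  have := e' hvX'
  omega

instance : IsProbabilityMeasure coinMeasure := by
  unfold coinMeasure; infer_instance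

/-- Flipping a fixed set of coins preserves the distribution. This replaces conditioning on the
other coins in the isolation lemma. -/
theorem map_xor_coinMeasure (d : ℕ → Bool) :
    coinMeasure.map (fun (ω : ℕ → Bool) i => xor (d i) (ω i)) = coinMeasure := by
  unfold coinMeasure
  rw [Measure.infinitePi_map_pi (f := fun i b => xor (d i) b) _ fun i => measurable_of_countable _]
  congr 1
  funext i
  refine Measure.ext_of_singleton fun b => ?_
  rw [Measure.map_apply (measurable_of_countable _) (measurableSet_singleton b)]
  have : (fun b' => xor (d i) b') ⁻¹' {b} = {xor (d i) b} := by
    ext x; cases x <;> cases b <;> cases d i <;> simp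
  rw [this, PMF.toMeasure_apply_singleton _ _ (measurableSet_singleton _),
    PMF.toMeasure_apply_singleton _ _ (measurableSet_singleton _)]
  simp

/-- The `2 ^ l` ways of flipping the coins of `v` move the ambiguous event to pairwise disjoint
events of the same probability, since at most one weight of `v` is ambiguous once the other coins
are fixed. -/
theorem coinMeasure_ambiguous_le {n : ℕ} (F : Set (Finset (Fin n))) (l : ℕ) (v : Fin n) :
    coinMeasure {ω | Ambiguous F v (coinWeight ω l)} ≤ (2 ^ l : ENNReal)⁻¹ := by
  set A := {ω : ℕ → Bool | Ambiguous F v (coinWeight ω l)} with hA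
  have hAm : MeasurableSet A := measurable_coinWeight n l (t := {w | Ambiguous F v w})
    (MeasurableSet.of_discrete)
  -- The pattern `e` placed on the block of coins belonging to `v`, extended by `false`.
  let d : (Fin l → Bool) → ℕ → Bool := fun e i =>
    if h : v * l ≤ i ∧ i - v * l < l then e ⟨i - v * l, h.2⟩ else false
  let T : (Fin l → Bool) → (ℕ → Bool) → ℕ → Bool := fun e ω i => xor (d e i) (ω i)
  have hT : ∀ e, Measurable (T e) := fun e => measurable_pi_lambda _ fun i =>
    (measurable_of_countable (xor (d e i))).comp (measurable_pi_apply i)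
  have hTA : ∀ e, coinMeasure (T e ⁻¹' A) = coinMeasure A := fun e => by
    rw [← Measure.map_apply (hT e) hAm, map_xor_coinMeasure]
  have hdisj : Pairwise (Function.onFun Disjoint fun e => T e ⁻¹' A) := by
    intro e e' hne
    refine Set.disjoint_left.2 fun ω h h' => hne ?_
    have key := Ambiguous.eq_of_eqOn (v := v) h h' fun u hu => by
      refine bitsValue_congr.2 fun i hi => ?_
      -- Different vertices use disjoint blocks of coins, so the weight of `u` is not affected.
      have : ¬ (v * l ≤ u * l + i ∧ u * l + i - v * l < l) := by
        rintro ⟨h1, h2⟩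
        refine hu (Fin.ext ?_)
        have h3 : (v : ℕ) < u + 1 := Nat.lt_of_mul_lt_mul_right (a := l) (by rw [add_mul]; omega)
        have h4 : (u : ℕ) < v + 1 := Nat.lt_of_mul_lt_mul_right (a := l) (by rw [add_mul]; omega)
        omega
      simp only [T, d, dif_neg this]
    funext i
    have := bitsValue_congr.1 key i i.2
    have hi : (v * l ≤ v * l + i ∧ v * l + (i : ℕ) - v * l < l) := ⟨by omega, by omega⟩
    simp only [T, d, add_tsub_cancel_left] at this
    simpa using this
  have hsum := measure_iUnion (μ := coinMeasure) hdisj fun e => hT e hAm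
  simp only [hTA, tsum_fintype, Finset.sum_const, Finset.card_univ, Fintype.card_fun,
    Fintype.card_bool, Fintype.card_fin, nsmul_eq_mul, Nat.cast_pow, Nat.cast_ofNat] at hsum
  rw [← one_div, ENNReal.le_div_iff_mul_le (by simp) (by simp), mul_comm, ← hsum]
  exact prob_le_one

/-- The isolation lemma of Mulmuley, Vazirani and Vazirani. -/
theorem coinMeasure_not_isolates_le {n : ℕ} {F : Set (Finset (Fin n))} (hF : F.Nonempty) {l : ℕ}
    (hl : 2 * n ≤ 2 ^ l) :
    coinMeasure {ω | ¬ Isolates (coinWeight (n := n) ω l) F} ≤ 1 / 2 := by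
  calc coinMeasure {ω | ¬ Isolates (coinWeight (n := n) ω l) F}
      ≤ coinMeasure (⋃ v, {ω | Ambiguous F v (coinWeight ω l)}) := by
        refine measure_mono fun ω h => ?_
        obtain ⟨v, hv⟩ := exists_ambiguous hF h
        exact Set.mem_iUnion.2 ⟨v, hv⟩
    _ ≤ ∑ v, coinMeasure {ω | Ambiguous F v (coinWeight ω l)} := measure_iUnion_fintype_le _ _
    _ ≤ ∑ _v : Fin n, (2 ^ l : ENNReal)⁻¹ :=
        Finset.sum_le_sum fun v _ => coinMeasure_ambiguous_le F l v
    _ ≤ 1 / 2 := by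
        rw [Finset.sum_const, Finset.card_univ, Fintype.card_fin, nsmul_eq_mul,
          ENNReal.le_div_iff_mul_le (by simp) (by simp), mul_right_comm, ← div_eq_mul_inv]
        refine ENNReal.div_le_of_le_mul ?_
        rw [one_mul, mul_comm]
        exact_mod_cast hl

end Isolation

/-! ### A loop language -/

/-- Programs whose loops are counted: `loop big r rb p` runs `p` for `r = 0, 1, …, m - 1`, where `m` is
the content of register `rb`. The flag `big` marks the loops that may run exponentially often. -/
inductive LP
  | asg (r : ℕ) (e : Expr)
  | sto (a : ℕ) (e₁ e₂ : Expr)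
  | flip (r : ℕ)
  | seq (p q : LP)
  | ite (e : Expr) (p q : LP)
  | loop (big : Bool) (r rb : ℕ) (p : LP)

/-- The program of the random access machine that a loop program stands for. -/
def LP.compile : LP → Program
  | .asg r e => .assign r e
  | .sto a e₁ e₂ => .store a e₁ e₂
  | .flip r => .flip r
  | .seq p q => .seq p.compile q.compile
  | .ite e p q => .ite e p.compile q.compile
  | .loop _ r rb p => .seq (.assign r (.const 0))
      (.while (.op .lt (.reg r) (.reg rb))
        (.seq p.compile (.assign r (.op .add (.reg r) (.const 1)))))

/-- Whether a register may be modified. -/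
def LP.modR : LP → ℕ → Bool
  | .asg r _, x => x == r
  | .sto _ _ _, _ => false
  | .flip r, x => x == r
  | .seq p q, x => p.modR x || q.modR x
  | .ite _ p q, x => p.modR x || q.modR x
  | .loop _ r _ p, x => x == r || p.modR x

/-- Whether an array may be modified. -/
def LP.modA : LP → ℕ → Bool
  | .asg _ _, _ => false
  | .sto a _ _, x => x == a
  | .flip _, _ => false
  | .seq p q, x => p.modA x || q.modA x
  | .ite _ p q, x => p.modA x || q.modA x
  | .loop _ _ _ p, x => p.modA x

/-- Whether coins may be tossed. -/
def LP.flips : LP → Bool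
  | .asg _ _ => false
  | .sto _ _ _ => false
  | .flip _ => true
  | .seq p q => p.flips || q.flips
  | .ite _ p q => p.flips || q.flips
  | .loop _ _ _ p => p.flips

/-- In a memory with entries of at most `Λ` bits the value of an expression `e` has at most
`e.sizeFactor * (Λ + 1)` bits. -/
def Expr.sizeFactor : Expr → ℕ
  | .const a => a.size
  | .reg _ => 1
  | .load _ _ => 1
  | .op _ e₁ e₂ => e₁.sizeFactor + e₂.sizeFactor + 1

/-- The analogous factor for the cost of evaluating an expression. -/
def Expr.costFactor : Expr → ℕ
  | .const a => a.size + 1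
  | .reg _ => 2
  | .load _ e => e.costFactor + e.sizeFactor + 2
  | .op _ e₁ e₂ => e₁.costFactor + e₂.costFactor + e₁.sizeFactor + e₂.sizeFactor + 1

/-- A time bound for a loop program, if all entries of the memory have at most `Λ` bits and the loops
run at most `Λ` times, and those marked as big at most `K` times. -/
def LP.timeBound (Λ K : ℕ) : LP → ℕ
  | .asg _ e => (e.costFactor + e.sizeFactor + 1) * (Λ + 1)
  | .sto _ e₁ e₂ =>
      (e₁.costFactor + e₂.costFactor + e₁.sizeFactor + e₂.sizeFactor + 1) * (Λ + 1)
  | .flip _ => 1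
  | .seq p q => p.timeBound Λ K + q.timeBound Λ K
  | .ite e p q =>
      (e.costFactor + e.sizeFactor + 1) * (Λ + 1) + (p.timeBound Λ K + q.timeBound Λ K)
  | .loop big _ _ p => 2 + ((bif big then K else Λ) + 1) * (20 * (Λ + 1)) +
      (bif big then K else Λ) * p.timeBound Λ K

/-- The nesting depth of big loops. -/
def LP.bigDepth : LP → ℕ
  | .asg _ _ => 0
  | .sto _ _ _ => 0
  | .flip _ => 0
  | .seq p q => max p.bigDepth q.bigDepth
  | .ite _ p q => max p.bigDepth q.bigDepth
  | .loop big _ _ p => (bif big then 1 else 0) + p.bigDepth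

open Polynomial in
-- Sequences and branches take the larger nesting depth, so the power of `K` counts only nested big
-- loops. All other contributions are polynomial in `Λ`.
theorem LP.exists_timeBound_le (p : LP) : ∃ q : Polynomial ℕ, ∀ Λ K, 1 ≤ K →
    p.timeBound Λ K ≤ K ^ p.bigDepth * q.eval Λ := by
  have hpow : ∀ {K a b c q : ℕ}, 1 ≤ K → a ≤ b → c ≤ K ^ a * q → c ≤ K ^ b * q :=
    fun hK hab h => h.trans (Nat.mul_le_mul_right _ (Nat.pow_le_pow_right hK hab))
  induction p with
  | asg r e => exact ⟨C (e.costFactor + e.sizeFactor + 1) * (X + 1), fun Λ K _ => by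
      simp [LP.timeBound, LP.bigDepth]⟩
  | sto a e₁ e₂ => exact ⟨C (e₁.costFactor + e₂.costFactor + e₁.sizeFactor + e₂.sizeFactor + 1) *
      (X + 1), fun Λ K _ => by simp [LP.timeBound, LP.bigDepth]⟩
  | flip r => exact ⟨1, fun Λ K _ => by simp [LP.timeBound, LP.bigDepth]⟩
  | seq p₁ p₂ ih₁ ih₂ =>
    obtain ⟨q₁, h₁⟩ := ih₁
    obtain ⟨q₂, h₂⟩ := ih₂
    refine ⟨q₁ + q₂, fun Λ K hK => ?_⟩
    have a₁ := hpow hK (le_max_left p₁.bigDepth p₂.bigDepth) (h₁ Λ K hK)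
    have a₂ := hpow hK (le_max_right p₁.bigDepth p₂.bigDepth) (h₂ Λ K hK)
    simp only [LP.timeBound, LP.bigDepth, eval_add, mul_add]
    exact add_le_add a₁ a₂
  | ite e p₁ p₂ ih₁ ih₂ =>
    obtain ⟨q₁, h₁⟩ := ih₁
    obtain ⟨q₂, h₂⟩ := ih₂
    refine ⟨C (e.costFactor + e.sizeFactor + 1) * (X + 1) + (q₁ + q₂), fun Λ K hK => ?_⟩
    have a₁ := hpow hK (le_max_left p₁.bigDepth p₂.bigDepth) (h₁ Λ K hK)
    have a₂ := hpow hK (le_max_right p₁.bigDepth p₂.bigDepth) (h₂ Λ K hK)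
    have a₀ : (e.costFactor + e.sizeFactor + 1) * (Λ + 1) ≤
        K ^ max p₁.bigDepth p₂.bigDepth * ((e.costFactor + e.sizeFactor + 1) * (Λ + 1)) :=
      Nat.le_mul_of_pos_left _ (Nat.pow_pos hK)
    simp only [LP.timeBound, LP.bigDepth, eval_add, eval_mul, eval_C, eval_X, eval_one, mul_add]
    simp only [mul_add] at a₀
    exact add_le_add a₀ (add_le_add a₁ a₂)
  | loop big r rb p ih =>
    obtain ⟨q, h⟩ := ih
    cases big with
    | false =>
      refine ⟨2 + (X + 1) * (20 * (X + 1)) + X * q, fun Λ K hK => ?_⟩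
      have := Nat.mul_le_mul_left Λ (h Λ K hK)
      have h1 : 1 ≤ K ^ p.bigDepth := Nat.pow_pos hK
      simp only [LP.timeBound, LP.bigDepth, eval_add, eval_mul, eval_X, eval_one, cond_false,
        zero_add, eval_ofNat]
      generalize K ^ p.bigDepth = A at *
      nlinarith [Nat.le_mul_of_pos_left (2 + (Λ + 1) * (20 * (Λ + 1))) h1]
    | true =>
      refine ⟨2 + 2 * (20 * (X + 1)) + q, fun Λ K hK => ?_⟩
      have := Nat.mul_le_mul_left K (h Λ K hK)
      have h1 : 1 ≤ K ^ p.bigDepth := Nat.pow_pos hK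
      simp only [LP.timeBound, LP.bigDepth, eval_add, eval_mul, eval_X, eval_one, cond_true,
        pow_add, pow_one, eval_ofNat]
      generalize K ^ p.bigDepth = A at *
      have e1 : K ≤ K * A := Nat.le_mul_of_pos_right _ h1
      have e2 : 1 ≤ K * A := hK.trans e1
      nlinarith [Nat.mul_le_mul_right (20 * (Λ + 1)) e1, Nat.mul_le_mul_right (20 * (Λ + 1)) e2]

/-! ### Semantics of expressions -/

@[simp] theorem State.setReg_reg (s : State) (r a x : ℕ) :
    (s.setReg r a).reg x = if x = r then a else s.reg x := by
  simp [State.setReg, Function.update_apply]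

@[simp] theorem State.setReg_arr (s : State) (r a : ℕ) : (s.setReg r a).arr = s.arr := rfl

@[simp] theorem State.setReg_tossed (s : State) (r a : ℕ) : (s.setReg r a).tossed = s.tossed := rfl

@[simp] theorem State.setArr_reg (s : State) (i j a : ℕ) : (s.setArr i j a).reg = s.reg := rfl

@[simp] theorem State.setArr_tossed (s : State) (i j a : ℕ) :
    (s.setArr i j a).tossed = s.tossed := rfl

@[simp] theorem State.setArr_arr (s : State) (i j a x : ℕ) :
    (s.setArr i j a).arr x = if x = i then Function.update (s.arr i) j a else s.arr x := by
  simp only [State.setArr, Function.update_apply]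

/-- All entries of the memory have at most `Λ` bits. -/
structure State.Bdd (Λ : ℕ) (s : State) : Prop where
  reg : ∀ r, s.reg r < 2 ^ Λ
  arr : ∀ a i, s.arr a i < 2 ^ Λ

theorem Expr.size_eval_le {Λ : ℕ} {s : State} (hs : s.Bdd Λ) (e : Expr) :
    (e.eval s).size ≤ e.sizeFactor * (Λ + 1) := by
  have hsmall : ∀ {a : ℕ}, a < 2 ^ Λ → a.size ≤ 1 * (Λ + 1) := fun h =>
    (Nat.size_le.2 h).trans (by omega)
  induction e with
  | const a => simp only [Expr.eval, Expr.sizeFactor]; nlinarith [Nat.zero_le (a.size * Λ)]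
  | reg r => exact hsmall (hs.reg r)
  | load a e _ => exact hsmall (hs.arr a _)
  | op o e₁ e₂ ih₁ ih₂ =>
    simp only [Expr.eval, Expr.sizeFactor]
    have key : (o.eval (e₁.eval s) (e₂.eval s)).size ≤ (e₁.eval s).size + (e₂.eval s).size + 1 := by
      generalize e₁.eval s = a
      generalize e₂.eval s = b
      have ha := Nat.lt_size_self a
      have hb := Nat.lt_size_self b
      cases o with
      | add =>
        apply Nat.size_le.2
        have h1 : 2 ^ a.size ≤ 2 ^ (a.size + b.size) := Nat.pow_le_pow_right (by norm_num) (by omega)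
        have h2 : 2 ^ b.size ≤ 2 ^ (a.size + b.size) := Nat.pow_le_pow_right (by norm_num) (by omega)
        rw [pow_succ]
        simp only [Op.eval]
        omega
      | sub => exact (Nat.size_le_size (Nat.sub_le a b)).trans (by omega)
      | mul =>
        apply Nat.size_le.2
        rw [pow_succ, pow_add]
        simp only [Op.eval]
        have := Nat.mul_lt_mul'' ha hb
        omega
      | div => exact (Nat.size_le_size (Nat.div_le_self a b)).trans (by omega)
      | lt => simp only [Op.eval]; split <;> simp
      | eq => simp only [Op.eval]; split <;> simp
    nlinarith

theorem Expr.cost_le {Λ : ℕ} {s : State} (hs : s.Bdd Λ) (e : Expr) :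
    e.cost s ≤ e.costFactor * (Λ + 1) := by
  induction e with
  | const a => simp only [Expr.cost, Expr.costFactor]; nlinarith [Nat.zero_le ((a.size + 1) * Λ)]
  | reg r =>
    have := Nat.size_le.2 (hs.reg r)
    simp only [Expr.cost, Expr.costFactor]; omega
  | load a e ih =>
    have h1 := Nat.size_le.2 (hs.arr a (e.eval s))
    have h2 := e.size_eval_le hs
    simp only [Expr.cost, Expr.costFactor]; nlinarith
  | op o e₁ e₂ ih₁ ih₂ =>
    have h1 := e₁.size_eval_le hs
    have h2 := e₂.size_eval_le hs
    simp only [Expr.cost, Expr.costFactor]; nlinarith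

/-! ### Partial correctness, frames and time together -/

/-- The parts of the memory that a loop program leaves alone. -/
structure Frame (p : LP) (s s' : State) : Prop where
  reg : ∀ r, p.modR r = false → s'.reg r = s.reg r
  arr : ∀ a, p.modA a = false → s'.arr a = s.arr a
  tossed : p.flips = false → s'.tossed = s.tossed

/-- Started in `s`, the loop program halts within its time bound, in a state that satisfies `Q`. -/
def Runs (Λ K : ℕ) (ω : ℕ → Bool) (p : LP) (s : State) (Q : State → Prop) : Prop :=
  ∃ t s', Exec ω p.compile s t s' ∧ t ≤ p.timeBound Λ K ∧ s'.Bdd Λ ∧ Frame p s s' ∧ Q s'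

section Rules

variable {Λ K : ℕ} {ω : ℕ → Bool} {s : State} {Q : State → Prop}

theorem State.Bdd.setReg (hs : s.Bdd Λ) {r a : ℕ} (ha : a < 2 ^ Λ) : (s.setReg r a).Bdd Λ where
  reg x := by rw [State.setReg_reg]; split; exacts [ha, hs.reg x]
  arr := hs.arr

theorem State.Bdd.setArr (hs : s.Bdd Λ) {i j a : ℕ} (ha : a < 2 ^ Λ) :
    (s.setArr i j a).Bdd Λ where
  reg := hs.reg
  arr x y := by
    rw [State.setArr_arr]
    split
    · rw [Function.update_apply]; split; exacts [ha, hs.arr i y]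
    · exact hs.arr x y

theorem Runs.mono {p : LP} {P : State → Prop} (h : Runs Λ K ω p s P)
    (hPQ : ∀ s', s'.Bdd Λ → Frame p s s' → P s' → Q s') : Runs Λ K ω p s Q := by
  obtain ⟨t, s', h₁, h₂, h₃, h₄, h₅⟩ := h
  exact ⟨t, s', h₁, h₂, h₃, h₄, hPQ s' h₃ h₄ h₅⟩

theorem Runs.asg (hs : s.Bdd Λ) {r : ℕ} {e : Expr} (he : e.eval s < 2 ^ Λ)
    (hQ : Q (s.setReg r (e.eval s))) : Runs Λ K ω (.asg r e) s Q := by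
  refine ⟨_, _, Exec.assign r e s, ?_, hs.setReg he, ⟨fun x hx => ?_, fun _ _ => rfl, fun _ => rfl⟩, hQ⟩
  · have h1 := e.size_eval_le hs
    have h2 := e.cost_le hs
    simp only [LP.timeBound]; nlinarith
  · simp only [LP.modR, beq_eq_false_iff_ne] at hx
    simp [hx]

theorem Runs.sto (hs : s.Bdd Λ) {a : ℕ} {e₁ e₂ : Expr} (he : e₂.eval s < 2 ^ Λ)
    (hQ : Q (s.setArr a (e₁.eval s) (e₂.eval s))) : Runs Λ K ω (.sto a e₁ e₂) s Q := by
  refine ⟨_, _, Exec.store a e₁ e₂ s, ?_, hs.setArr he, ⟨fun _ _ => rfl, fun x hx => ?_, fun _ => rfl⟩, hQ⟩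
  · have h1 := e₁.size_eval_le hs
    have h2 := e₁.cost_le hs
    have h3 := e₂.size_eval_le hs
    have h4 := e₂.cost_le hs
    simp only [LP.timeBound]; nlinarith
  · simp only [LP.modA, beq_eq_false_iff_ne] at hx
    simp [hx]

theorem Runs.flip (hs : s.Bdd Λ) (hΛ : 0 < Λ) {r : ℕ}
    (hQ : Q { s.setReg r (ω s.tossed).toNat with tossed := s.tossed + 1 }) :
    Runs Λ K ω (.flip r) s Q := by
  have h2 : (ω s.tossed).toNat < 2 ^ Λ :=
    (Bool.toNat_lt _).trans_le (by simpa using Nat.pow_le_pow_right (n := 2) (by norm_num) hΛ)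
  have hb := hs.setReg (r := r) h2
  refine ⟨_, _, Exec.flip r s, le_rfl, ⟨hb.reg, hb.arr⟩,
    ⟨fun x hx => ?_, fun _ _ => rfl, fun h => by simp [LP.flips] at h⟩, hQ⟩
  simp only [LP.modR, beq_eq_false_iff_ne] at hx
  change (s.setReg _ _).reg x = _
  simp [hx]

theorem Runs.seq {p q : LP} {P : State → Prop} (hp : Runs Λ K ω p s P)
    (hq : ∀ s₁, s₁.Bdd Λ → Frame p s s₁ → P s₁ → Runs Λ K ω q s₁ Q) :
    Runs Λ K ω (.seq p q) s Q := by
  obtain ⟨t₁, s₁, h₁, h₂, h₃, h₄, h₅⟩ := hp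
  obtain ⟨t₂, s₂, g₁, g₂, g₃, g₄, g₅⟩ := hq s₁ h₃ h₄ h₅
  refine ⟨_, _, .seq h₁ g₁, add_le_add h₂ g₂, g₃, ⟨fun r hr => ?_, fun a ha => ?_, fun h => ?_⟩, g₅⟩
  · simp only [LP.modR, Bool.or_eq_false_iff] at hr
    rw [g₄.reg r hr.2, h₄.reg r hr.1]
  · simp only [LP.modA, Bool.or_eq_false_iff] at ha
    rw [g₄.arr a ha.2, h₄.arr a ha.1]
  · simp only [LP.flips, Bool.or_eq_false_iff] at h
    rw [g₄.tossed h.2, h₄.tossed h.1]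

theorem Runs.ite (hs : s.Bdd Λ) {e : Expr} {p q : LP}
    (hp : e.eval s ≠ 0 → Runs Λ K ω p s Q) (hq : e.eval s = 0 → Runs Λ K ω q s Q) :
    Runs Λ K ω (.ite e p q) s Q := by
  have h1 := e.size_eval_le hs
  have h2 := e.cost_le hs
  by_cases he : e.eval s = 0
  · obtain ⟨t, s', h₁, h₂, h₃, h₄, h₅⟩ := hq he
    refine ⟨_, _, .ite_false he h₁, ?_, h₃, ⟨fun r hr => ?_, fun a ha => ?_, fun h => ?_⟩, h₅⟩
    · simp only [LP.timeBound]; nlinarith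
    · simp only [LP.modR, Bool.or_eq_false_iff] at hr
      exact h₄.reg r hr.2
    · simp only [LP.modA, Bool.or_eq_false_iff] at ha
      exact h₄.arr a ha.2
    · simp only [LP.flips, Bool.or_eq_false_iff] at h
      exact h₄.tossed h.2
  · obtain ⟨t, s', h₁, h₂, h₃, h₄, h₅⟩ := hp he
    refine ⟨_, _, .ite_true he h₁, ?_, h₃, ⟨fun r hr => ?_, fun a ha => ?_, fun h => ?_⟩, h₅⟩
    · simp only [LP.timeBound]; nlinarith
    · simp only [LP.modR, Bool.or_eq_false_iff] at hr
      exact h₄.reg r hr.1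
    · simp only [LP.modA, Bool.or_eq_false_iff] at ha
      exact h₄.arr a ha.1
    · simp only [LP.flips, Bool.or_eq_false_iff] at h
      exact h₄.tossed h.1

/-- Loops, by an invariant that does not mention the loop counter. -/
theorem Runs.loop {big : Bool} {r rb N : ℕ} {p : LP} (I : ℕ → State → Prop) (hs : s.Bdd Λ)
    (hN : s.reg rb = N) (hNb : N ≤ bif big then K else Λ)
    (hwf : (p.modR r || p.modR rb || r == rb) = false)
    (hI : ∀ i s' a, I i s' → I i (s'.setReg r a)) (h0 : I 0 s)
    (hstep : ∀ i < N, ∀ s', s'.Bdd Λ → Frame (.loop big r rb p) s s' → s'.reg r = i → I i s' →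
      Runs Λ K ω p s' (I (i + 1)))
    (hQ : ∀ s', s'.Bdd Λ → Frame (.loop big r rb p) s s' → I N s' → Q s') :
    Runs Λ K ω (.loop big r rb p) s Q := by
  simp only [Bool.or_eq_false_iff, beq_eq_false_iff_ne] at hwf
  obtain ⟨⟨hr, hrb⟩, hne⟩ := hwf
  -- A generous bound for one test and one increment of the counter: each of the two expressions
  -- costs at most `7 * (Λ + 1)`, and storing the result adds little.
  set c := 20 * (Λ + 1) with hc
  set T := p.timeBound Λ K with hT
  -- Induction on the number `m` of remaining rounds; the final failing test accounts for the `+ 1`.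
  have main : ∀ m i s', i + m = N → s'.Bdd Λ → Frame (.loop big r rb p) s s' → s'.reg r = i →
      I i s' → ∃ t s'', Exec ω (.while (.op .lt (.reg r) (.reg rb))
        (.seq p.compile (.assign r (.op .add (.reg r) (.const 1))))) s' t s'' ∧
        t ≤ (m + 1) * c + m * T ∧ s''.Bdd Λ ∧ Frame (.loop big r rb p) s s'' ∧ I N s'' := by
    intro m
    induction m with
    | zero =>
      intro i s' him hb hf hri hIi
      have hrb' : s'.reg rb = N := by
        rw [hf.reg rb (by simp [LP.modR, hrb, Ne.symm hne]), hN]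
      have hev : (Expr.op .lt (.reg r) (.reg rb)).eval s' = 0 := by
        simp only [Expr.eval, Op.eval, hri, hrb']; rw [if_neg]; omega
      refine ⟨_, s', .while_false hev, ?_, hb, hf, by rwa [show N = i by omega]⟩
      rw [hev]
      have h1 := Expr.cost_le hb (Expr.op .lt (.reg r) (.reg rb))
      simp only [Expr.costFactor, Expr.sizeFactor] at h1
      simp only [Nat.size_zero]
      omega
    | succ m ih =>
      intro i s' him hb hf hri hIi
      have hrb' : s'.reg rb = N := by
        rw [hf.reg rb (by simp [LP.modR, hrb, Ne.symm hne]), hN]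
      have hev : (Expr.op .lt (.reg r) (.reg rb)).eval s' = 1 := by
        simp only [Expr.eval, Op.eval, hri, hrb']; rw [if_pos]; omega
      obtain ⟨t₁, s₁, e₁, ht₁, b₁, f₁, i₁⟩ := hstep i (by omega) s' hb hf hri hIi
      have hr₁ : s₁.reg r = i := by rw [f₁.reg r hr, hri]
      have hv : (Expr.op .add (.reg r) (.const 1)).eval s₁ = i + 1 := by
        simp [Expr.eval, Op.eval, hr₁]
      -- The incremented counter fits because it is at most the content of the bound register.
      have hlt : i + 1 < 2 ^ Λ := by
        have := hb.reg rb
        omega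
      have f₂ : Frame (.loop big r rb p) s (s₁.setReg r (i + 1)) := by
        refine ⟨fun x hx => ?_, fun a ha => ?_, fun h => ?_⟩
        · have hx' := hx
          simp only [LP.modR, Bool.or_eq_false_iff, beq_eq_false_iff_ne] at hx'
          rw [State.setReg_reg, if_neg hx'.1, f₁.reg x hx'.2, hf.reg x hx]
        · rw [State.setReg_arr, f₁.arr a ha, hf.arr a ha]
        · rw [State.setReg_tossed, f₁.tossed h, hf.tossed h]
      obtain ⟨t₂, s₂, e₂, ht₂, b₂, f₃, i₂⟩ := ih (i + 1) (s₁.setReg r (i + 1)) (by omega)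
        (b₁.setReg hlt) f₂ (by simp) (hI _ _ _ i₁)
      have e₃ := Exec.assign (ω := ω) r (Expr.op .add (.reg r) (.const 1)) s₁
      rw [hv] at e₃
      refine ⟨_, s₂, .while_true (by rw [hev]; exact one_ne_zero) (.seq e₁ e₃) e₂, ?_, b₂, f₃, i₂⟩
      have h1 := Expr.cost_le hb (Expr.op .lt (.reg r) (.reg rb))
      have h2 := Expr.cost_le b₁ (Expr.op .add (.reg r) (.const 1))
      have h3 := Nat.size_le.2 hlt
      simp only [Expr.costFactor, Expr.sizeFactor, Nat.size_one] at h1 h2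
      rw [hev, Nat.size_one]
      nlinarith
  have hr0 : Frame (.loop big r rb p) s (s.setReg r 0) :=
    ⟨fun x hx => by
      simp only [LP.modR, Bool.or_eq_false_iff, beq_eq_false_iff_ne] at hx
      simp [hx.1], fun _ _ => rfl, fun _ => rfl⟩
  obtain ⟨t, s', e, ht, b, f, i⟩ := main N 0 (s.setReg r 0) (by omega)
    (hs.setReg (Nat.pow_pos (by norm_num))) hr0 (by simp) (hI _ _ _ h0)
  refine ⟨_, s', .seq (Exec.assign r (.const 0) s) e, ?_, b, f, hQ s' b f i⟩
  simp only [LP.timeBound, Expr.cost, Expr.eval, Nat.size_zero, ← hc, ← hT]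
  have := Nat.mul_le_mul_right T hNb
  have := Nat.mul_le_mul_right c (Nat.succ_le_succ hNb)
  simp only [Nat.succ_eq_add_one] at this
  omega

/-- Loops that update a single register. -/
theorem Runs.fold {big : Bool} {r rb acc N : ℕ} {e : Expr} (F : ℕ → ℕ) (hs : s.Bdd Λ)
    (hN : s.reg rb = N) (hNb : N ≤ bif big then K else Λ)
    (hwf : ((r == acc) || (rb == acc) || r == rb) = false)
    (h0 : s.reg acc = F 0)
    (hstep : ∀ i < N, e.eval ((s.setReg acc (F i)).setReg r i) = F (i + 1) ∧ F (i + 1) < 2 ^ Λ)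
    (hQ : ∀ s', s'.Bdd Λ → Frame (.loop big r rb (.asg acc e)) s s' → s'.reg acc = F N → Q s') :
    Runs Λ K ω (.loop big r rb (.asg acc e)) s Q := by
  refine Runs.loop (I := fun i s' => s'.reg acc = F i) hs hN hNb hwf ?_ h0 ?_ hQ
  · intro i s' a h
    simp only [Bool.or_eq_false_iff, beq_eq_false_iff_ne] at hwf
    rw [State.setReg_reg, if_neg (Ne.symm hwf.1.1)]
    exact h
  · intro i hi s' hb hf hr hI
    -- The body changes only the accumulator, so frame condition and invariant determine the whole
    -- state. Users need to evaluate `e` only in this explicit state.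
    have : s' = (s.setReg acc (F i)).setReg r i := by
      obtain ⟨g, a, t⟩ := s'
      have h1 : g = ((s.setReg acc (F i)).setReg r i).reg := by
        funext x
        rw [State.setReg_reg, State.setReg_reg]
        split
        · next h => rw [h]; exact hr
        · split
          · next h => rw [h]; exact hI
          · next h h' => exact hf.reg x (by simp [LP.modR, h, h'])
      have h2 : a = s.arr := by funext x; exact hf.arr x rfl
      have h3 : t = s.tossed := hf.tossed rfl
      subst h1 h2 h3
      rfl
    obtain ⟨h1, h2⟩ := hstep i hi
    rw [← this] at h1
    exact Runs.asg hb (by rwa [h1]) (by simp [h1])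

/-- Loops that fill an initial segment of an array. -/
theorem Runs.fill {big : Bool} {r rb a N : ℕ} {e : Expr} (f : ℕ → ℕ) (hs : s.Bdd Λ)
    (hN : s.reg rb = N) (hNb : N ≤ bif big then K else Λ) (hwf : (r == rb) = false)
    (hstep : ∀ i < N, ∀ s', s'.reg = (s.setReg r i).reg → (∀ x, x ≠ a → s'.arr x = s.arr x) →
      (∀ x, i ≤ x → s'.arr a x = s.arr a x) → e.eval s' = f i ∧ f i < 2 ^ Λ)
    (hQ : ∀ s', s'.Bdd Λ → Frame (.loop big r rb (.sto a (.reg r) e)) s s' →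
      (∀ i < N, s'.arr a i = f i) → Q s') :
    Runs Λ K ω (.loop big r rb (.sto a (.reg r) e)) s Q := by
  refine Runs.loop (I := fun i s' => (∀ j < i, s'.arr a j = f j) ∧ ∀ j, i ≤ j → s'.arr a j = s.arr a j)
    hs hN hNb (by simpa [LP.modR] using hwf) (fun i s' b h => h) ⟨by simp, by simp⟩ ?_
    (fun s' hb hf h => hQ s' hb hf h.1)
  intro i hi s' hb hf hr hI
  obtain ⟨h1, h2⟩ := hstep i hi s' (by
      funext x
      rw [State.setReg_reg]
      split
      · next h => rw [h]; exact hr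
      · next h => exact hf.reg x (by simp [LP.modR, h]))
    (fun x hx => hf.arr x (by simp [LP.modA, hx])) hI.2
  refine Runs.sto hb (by rwa [h1]) ⟨fun j hj => ?_, fun j hj => ?_⟩
  · simp only [State.setArr_arr, if_true, Function.update_apply, Expr.eval, hr, h1]
    split
    · next h => rw [h]
    · exact hI.1 j (by omega)
  · simp only [State.setArr_arr, if_true, Function.update_apply, Expr.eval, hr, h1]
    rw [if_neg (by omega)]
    exact hI.2 j (by omega)

end Rules

/-! ### Notation for expressions -/

instance : Add Expr := ⟨.op .add⟩
instance : Sub Expr := ⟨.op .sub⟩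
instance : Mul Expr := ⟨.op .mul⟩
instance : Div Expr := ⟨.op .div⟩
instance : Mod Expr := ⟨fun a b => a - a / b * b⟩
instance (a : ℕ) : OfNat Expr a := ⟨.const a⟩

/-- The expression with value `1` if `a < b` and `0` otherwise. -/
abbrev Expr.lt (a b : Expr) : Expr := .op .lt a b

/-- The expression with value `1` if `a = b` and `0` otherwise. -/
abbrev Expr.eq (a b : Expr) : Expr := .op .eq a b

namespace Expr

variable (s : State) (a b : Expr)

@[simp] theorem eval_add : (a + b).eval s = a.eval s + b.eval s := rfl
@[simp] theorem eval_sub : (a - b).eval s = a.eval s - b.eval s := rfl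
@[simp] theorem eval_mul : (a * b).eval s = a.eval s * b.eval s := rfl
@[simp] theorem eval_div : (a / b).eval s = a.eval s / b.eval s := rfl
@[simp] theorem eval_mod : (a % b).eval s = a.eval s % b.eval s := by
  change a.eval s - a.eval s / b.eval s * b.eval s = _
  have := Nat.div_add_mod' (a.eval s) (b.eval s)
  omega
@[simp] theorem eval_two : (2 : Expr).eval s = 2 := rfl
@[simp] theorem eval_three : (3 : Expr).eval s = 3 := rfl
@[simp] theorem eval_four : (4 : Expr).eval s = 4 := rfl
@[simp] theorem eval_sixteen : (16 : Expr).eval s = 16 := rfl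
@[simp] theorem eval_zero : (0 : Expr).eval s = 0 := rfl
@[simp] theorem eval_one : (1 : Expr).eval s = 1 := rfl
@[simp] theorem eval_lt : (Expr.lt a b).eval s = if a.eval s < b.eval s then 1 else 0 := rfl
@[simp] theorem eval_eq : (Expr.eq a b).eval s = if a.eval s = b.eval s then 1 else 0 := rfl
@[simp] theorem eval_reg (r : ℕ) : (Expr.reg r).eval s = s.reg r := rfl
@[simp] theorem eval_load (r : ℕ) : (Expr.load r a).eval s = s.arr r (a.eval s) := rfl

end Expr

section

variable {Λ K : ℕ} {ω : ℕ → Bool} {s : State} {Q : State → Prop}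

theorem Runs.asg_seq (hs : s.Bdd Λ) {r : ℕ} {e : Expr} {q : LP} (he : e.eval s < 2 ^ Λ)
    (hq : (s.setReg r (e.eval s)).Bdd Λ → Runs Λ K ω q (s.setReg r (e.eval s)) Q) :
    Runs Λ K ω (.seq (.asg r e) q) s Q :=
  Runs.seq (P := fun s' => s' = s.setReg r (e.eval s)) (Runs.asg hs he rfl)
    fun _ hb _ h => by subst h; exact hq hb

theorem Runs.sto_seq (hs : s.Bdd Λ) {a : ℕ} {e₁ e₂ : Expr} {q : LP} (he : e₂.eval s < 2 ^ Λ)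
    (hq : (s.setArr a (e₁.eval s) (e₂.eval s)).Bdd Λ →
      Runs Λ K ω q (s.setArr a (e₁.eval s) (e₂.eval s)) Q) :
    Runs Λ K ω (.seq (.sto a e₁ e₂) q) s Q :=
  Runs.seq (P := fun s' => s' = s.setArr a (e₁.eval s) (e₂.eval s)) (Runs.sto hs he rfl)
    fun _ hb _ h => by subst h; exact hq hb

end

/-! ### Search in a digraph -/

/-- The invariant of a search from `x` in the digraph with adjacency matrix `E` on `0, …, N - 1`: the
set `S` of vertices found so far, their list `ord` in the order of discovery, at the positions
`1, …, cnt`, their positions `pos`, and the positions `par` of their predecessors. -/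
structure SearchInv (N : ℕ) (E : ℕ → ℕ) (x : ℕ) (S ord pos par : ℕ → ℕ) (cnt : ℕ) : Prop where
  le_one : ∀ b < N, S b ≤ 1
  cnt_pos : 1 ≤ cnt
  of_ord : ∀ i, 1 ≤ i → i ≤ cnt → ord i < N ∧ S (ord i) = 1 ∧ pos (ord i) = i
  of_pos : ∀ b < N, S b = 1 → 1 ≤ pos b ∧ pos b ≤ cnt ∧ ord (pos b) = b
  ord_one : ord 1 = x
  par_one : par 1 = 0
  of_par : ∀ i, 2 ≤ i → i ≤ cnt → 1 ≤ par i ∧ par i < i ∧ E (ord (par i) * N + ord i) ≠ 0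

/-- The set found is closed under taking out-neighbours. -/
def SearchClosed (N : ℕ) (E S : ℕ → ℕ) : Prop :=
  ∀ a < N, ∀ b < N, S a = 1 → E (a * N + b) ≠ 0 → S b = 1

namespace SearchInv

variable {N : ℕ} {E : ℕ → ℕ} {x : ℕ} {S ord pos par : ℕ → ℕ} {cnt : ℕ}

theorem cnt_le (h : SearchInv N E x S ord pos par cnt) : cnt ≤ N := by
  have := Finset.card_le_card_of_injOn (s := Finset.Icc 1 cnt) (t := Finset.range N) ord
    (fun i hi => by
      have := Finset.mem_Icc.1 hi
      simpa using (h.of_ord i this.1 this.2).1)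
    (fun i hi j hj hij => by
      have hi := Finset.mem_Icc.1 hi
      have hj := Finset.mem_Icc.1 hj
      rw [← (h.of_ord i hi.1 hi.2).2.2, hij, (h.of_ord j hj.1 hj.2).2.2])
  simpa using this

theorem start (hx : x < N) (hS : ∀ b < N, S b = if b = x then 1 else 0)
    (ho : ord 1 = x) (hp : pos x = 1) (hpar : par 1 = 0) : SearchInv N E x S ord pos par 1 where
  le_one b hb := by rw [hS b hb]; split <;> simp
  cnt_pos := le_rfl
  of_ord i h1 h2 := by
    obtain rfl : i = 1 := by omega
    rw [ho, hS x hx]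
    simp [hx, hp]
  of_pos b hb h := by
    rw [hS b hb] at h
    have : b = x := by by_contra h'; simp [h'] at h
    subst this
    simp [hp, ho]
  ord_one := ho
  par_one := hpar
  of_par i h1 h2 := by omega

/-- One discovery along the edge from `a` to `b`: `b` is appended at position `cnt + 1` with the
position of `a` as parent, so parents precede children. -/
theorem add (h : SearchInv N E x S ord pos par cnt) {a b : ℕ} (ha : a < N) (hb : b < N)
    (hSa : S a = 1) (hSb : S b = 0) (hE : E (a * N + b) ≠ 0) :
    SearchInv N E x (Function.update S b 1) (Function.update ord (cnt + 1) b)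
      (Function.update pos b (cnt + 1)) (Function.update par (cnt + 1) (pos a)) (cnt + 1) where
  le_one c hc := by
    rw [Function.update_apply]; split
    · exact le_rfl
    · exact h.le_one c hc
  cnt_pos := by omega
  of_ord i h1 h2 := by
    rcases Nat.lt_or_ge cnt i with hi | hi
    · obtain rfl : i = cnt + 1 := by omega
      simp [hb]
    · have hne : i ≠ cnt + 1 := by omega
      obtain ⟨o1, o2, o3⟩ := h.of_ord i h1 hi
      have : ord i ≠ b := fun e => by rw [e, hSb] at o2; exact absurd o2 (by norm_num)
      simp [hne, this, o1, o2, o3]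
  of_pos c hc hSc := by
    by_cases hcb : c = b
    · subst hcb; simp
    · simp only [Function.update_apply, hcb, if_false] at hSc ⊢
      obtain ⟨p1, p2, p3⟩ := h.of_pos c hc hSc
      refine ⟨p1, by omega, ?_⟩
      rw [if_neg (by omega), p3]
  ord_one := by
    have := h.cnt_pos
    rw [Function.update_apply, if_neg (by omega), h.ord_one]
  par_one := by
    have := h.cnt_pos
    rw [Function.update_apply, if_neg (by omega), h.par_one]
  of_par i h1 h2 := by
    have := h.cnt_pos
    rcases Nat.lt_or_ge cnt i with hi | hi
    · obtain rfl : i = cnt + 1 := by omega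
      obtain ⟨p1, p2, p3⟩ := h.of_pos a ha hSa
      simp only [Function.update_apply, if_true]
      rw [if_neg (by omega), p3]
      exact ⟨p1, by omega, hE⟩
    · obtain ⟨p1, p2, p3⟩ := h.of_par i h1 hi
      simp only [Function.update_apply]
      rw [if_neg (by omega : ¬ i = cnt + 1), if_neg (by omega), if_neg (by omega)]
      exact ⟨p1, p2, p3⟩

/-- Every vertex that is found belongs to all closed sets that contain the start vertex. -/
theorem mem_of_closed (h : SearchInv N E x S ord pos par cnt) {P : ℕ → Prop} (hx : P x)
    (hP : ∀ a < N, ∀ b < N, P a → E (a * N + b) ≠ 0 → P b) {b : ℕ} (hb : b < N) (hSb : S b = 1) :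
    P b := by
  have key : ∀ i, 1 ≤ i → i ≤ cnt → P (ord i) := by
    intro i
    induction i using Nat.strong_induction_on with
    | _ i ih =>
      intro h1 h2
      by_cases hi : i = 1
      · rw [hi, h.ord_one]; exact hx
      · obtain ⟨p1, p2, p3⟩ := h.of_par i (by omega) h2
        exact hP _ (h.of_ord _ p1 (by omega)).1 _ (h.of_ord i h1 h2).1 (ih _ p2 p1 (by omega)) p3
  obtain ⟨p1, p2, p3⟩ := h.of_pos b hb hSb
  rw [← p3]
  exact key _ p1 p2

end SearchInv

/-- Search from the vertex in register `22` in the digraph whose adjacency matrix is in array `2`; its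
number of vertices is in register `20`, and the square of this number in register `21`. -/
def searchProg : LP :=
  .seq (.loop false 26 20 (.sto 1 (.reg 26) 0)) <|
  .seq (.sto 1 (.reg 22) 1) <|
  .seq (.asg 23 1) <|
  .seq (.sto 3 1 (.reg 22)) <|
  .seq (.sto 4 (.reg 22) 1) <|
  .seq (.sto 5 1 0) <|
  .loop false 24 20 <| .loop false 25 21 <|
    .ite (.load 1 (.reg 25 / .reg 20) * (1 - .load 1 (.reg 25 % .reg 20)) * .load 2 (.reg 25))
      (.seq (.asg 23 (.reg 23 + 1)) <|
       .seq (.sto 1 (.reg 25 % .reg 20) 1) <|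
       .seq (.sto 3 (.reg 23) (.reg 25 % .reg 20)) <|
       .seq (.sto 4 (.reg 25 % .reg 20) (.reg 23)) <|
       .sto 5 (.reg 23) (.load 4 (.reg 25 / .reg 20)))
      -- Register 27 is never read; here and below this assignment stands for doing nothing.
      (.asg 27 0)

/-- The search scans all pairs in each of `N` rounds. Every round either leaves a closed set or
discovers a new vertex, and at most `N` vertices can be discovered. -/
theorem searchProg_spec {Λ K : ℕ} {ω : ℕ → Bool} {s : State} {Q : State → Prop} {N x : ℕ}
    (hs : s.Bdd Λ) (hN : s.reg 20 = N) (hNN : s.reg 21 = N * N) (hx : s.reg 22 = x) (hxN : x < N)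
    (hΛ : N * N < Λ)
    (hQ : ∀ s', s'.Bdd Λ → Frame searchProg s s' →
      SearchInv N (s.arr 2) x (s'.arr 1) (s'.arr 3) (s'.arr 4) (s'.arr 5) (s'.reg 23) →
      SearchClosed N (s.arr 2) (s'.arr 1) → Q s') :
    Runs Λ K ω searchProg s Q := by
  have hNpos : 0 < N := by omega
  have hNΛ : N ≤ Λ := by nlinarith
  have hpow : Λ < 2 ^ Λ := Nat.lt_two_pow_self
  have one_lt : 1 < 2 ^ Λ := by omega
  -- all states below agree with the initial one on the part of the memory that is never written
  suffices h : Runs Λ K ω searchProg s (fun s' =>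
      SearchInv N (s.arr 2) x (s'.arr 1) (s'.arr 3) (s'.arr 4) (s'.arr 5) (s'.reg 23) ∧
      SearchClosed N (s.arr 2) (s'.arr 1)) from h.mono fun s' hb hf h => hQ s' hb hf h.1 h.2
  refine Runs.seq (Runs.fill (f := fun _ => 0) (Q := fun s' => ∀ i < N, s'.arr 1 i = 0) hs hN hNΛ rfl
    (fun i hi s' _ _ _ => by simp) (fun s' _ _ h => h)) ?_
  intro s₁ hb₁ hf₁ h₁
  have r20 : s₁.reg 20 = N := by rw [hf₁.reg 20 rfl, hN]
  have r21 : s₁.reg 21 = N * N := by rw [hf₁.reg 21 rfl, hNN]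
  have r22 : s₁.reg 22 = x := by rw [hf₁.reg 22 rfl, hx]
  have a2 : s₁.arr 2 = s.arr 2 := by rw [hf₁.arr 2 rfl]
  refine Runs.sto_seq hb₁ one_lt fun hb => ?_
  refine Runs.asg_seq hb one_lt fun hb => ?_
  refine Runs.sto_seq hb (hb.reg 22) fun hb => ?_
  refine Runs.sto_seq hb one_lt fun hb => ?_
  refine Runs.sto_seq hb (by simp) fun hb => ?_
  generalize hs₂ : State.setArr _ _ _ _ = s₂ at hb ⊢
  replace hs₂ := hs₂.symm
  have q20 : s₂.reg 20 = N := by simp [hs₂, r20]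
  have q21 : s₂.reg 21 = N * N := by simp [hs₂, r21]
  have q2 : s₂.arr 2 = s.arr 2 := by simp [hs₂, a2]
  have hinv : SearchInv N (s.arr 2) x (s₂.arr 1) (s₂.arr 3) (s₂.arr 4) (s₂.arr 5) (s₂.reg 23) := by
    have e : s₂.reg 23 = 1 := by simp [hs₂]
    rw [e]
    refine SearchInv.start hxN (fun b hb => ?_) (by simp [hs₂, r22]) (by simp [hs₂, r22])
      (by simp [hs₂])
    simp only [hs₂, State.setArr_arr, State.setReg_arr, State.setArr_reg, State.setReg_reg,
      Expr.eval_reg, Expr.eval_one, r22]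
    simp [Function.update_apply, h₁ b hb]
  -- Start with one vertex, so without closure at least `i + 1` vertices are known after `i` rounds;
  -- `i = N` is impossible.
  refine Runs.loop (I := fun i s' =>
      SearchInv N (s.arr 2) x (s'.arr 1) (s'.arr 3) (s'.arr 4) (s'.arr 5) (s'.reg 23) ∧
      (SearchClosed N (s.arr 2) (s'.arr 1) ∨ i + 1 ≤ s'.reg 23)) hb q20 hNΛ rfl
    (fun i s' a h => by simpa using h) ⟨hinv, Or.inr hinv.cnt_pos⟩ ?_ ?_
  · intro i hi s₃ hb₃ hf₃ _ hI
    have p20 : s₃.reg 20 = N := by rw [hf₃.reg 20 rfl, q20]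
    have p21 : s₃.reg 21 = N * N := by rw [hf₃.reg 21 rfl, q21]
    have p2 : s₃.arr 2 = s.arr 2 := by rw [hf₃.arr 2 rfl, q2]
    -- Within a round, the pair `(a, b)` has the number `e = a * N + b`. Either nothing has changed
    -- and all pairs scanned so far satisfy the closure condition, or a vertex was found and the set
    -- at the start of the round was not closed.
    refine Runs.loop (I := fun e s' =>
      SearchInv N (s.arr 2) x (s'.arr 1) (s'.arr 3) (s'.arr 4) (s'.arr 5) (s'.reg 23) ∧
      ((s'.arr 1 = s₃.arr 1 ∧ s'.reg 23 = s₃.reg 23 ∧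
        ∀ e' < e, s'.arr 1 (e' / N) = 1 → s.arr 2 e' ≠ 0 → s'.arr 1 (e' % N) = 1) ∨
       (s₃.reg 23 < s'.reg 23 ∧ ¬ SearchClosed N (s.arr 2) (s₃.arr 1)))) hb₃ p21
      (le_of_lt hΛ) rfl (fun i s' a h => by simpa using h) ⟨hI.1, Or.inl ⟨rfl, rfl, by simp⟩⟩ ?_ ?_
    · intro e he s₄ hb₄ hf₄ hr₄ hI₄
      have o20 : s₄.reg 20 = N := by rw [hf₄.reg 20 rfl, p20]
      have o2 : s₄.arr 2 = s.arr 2 := by rw [hf₄.arr 2 rfl, p2]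
      have ha : e / N < N := Nat.div_lt_of_lt_mul he
      have hbN : e % N < N := Nat.mod_lt _ hNpos
      have hdm : e / N * N + e % N = e := Nat.div_add_mod' e N
      refine Runs.ite hb₄ (fun hc => ?_) (fun hc => ?_)
      · simp only [Expr.eval_mul, Expr.eval_load, Expr.eval_div, Expr.eval_reg, hr₄, o20,
          Expr.eval_sub, Expr.eval_one, Expr.eval_mod, o2, mul_ne_zero_iff] at hc
        obtain ⟨⟨c1, c2⟩, c3⟩ := hc
        have c1' : s₄.arr 1 (e / N) = 1 := by
          have := hI₄.1.le_one _ ha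
          omega
        have c2' : s₄.arr 1 (e % N) = 0 := by omega
        have hnew := hI₄.1.add ha hbN c1' c2' (by rwa [hdm])
        have hcnt := hnew.cnt_le
        have hcntlt : s₄.reg 23 + 1 < 2 ^ Λ := by omega
        refine Runs.asg_seq hb₄ (by simpa using hcntlt) fun hb => ?_
        refine Runs.sto_seq hb one_lt fun hb => ?_
        refine Runs.sto_seq hb (by simp [hr₄, o20]; omega) fun hb => ?_
        refine Runs.sto_seq hb (by simpa using hcntlt) fun hb => ?_
        refine Runs.sto hb (hb.arr 4 _) ?_
        have hne : e / N ≠ e % N := fun h => by rw [h, c2'] at c1'; exact absurd c1' (by norm_num)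
        refine ⟨by simpa [hr₄, o20, Function.update_apply, hne] using hnew, Or.inr ⟨?_, ?_⟩⟩
        · simp only [Expr.eval_add, Expr.eval_reg, Expr.eval_one, State.setArr_reg,
            State.setReg_reg, if_true]
          rcases hI₄.2 with h | h <;> omega
        · rcases hI₄.2 with h | h
          · intro hcl
            have := hcl _ ha _ hbN (by rw [← h.1]; exact c1') (by rwa [hdm])
            rw [← h.1, c2'] at this
            exact absurd this (by norm_num)
          · exact h.2
      · simp only [Expr.eval_mul, Expr.eval_load, Expr.eval_div, Expr.eval_reg, hr₄, o20,
          Expr.eval_sub, Expr.eval_one, Expr.eval_mod, o2] at hc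
        refine Runs.asg hb₄ (by simp) ?_
        refine ⟨by simpa using hI₄.1, ?_⟩
        refine hI₄.2.imp (fun h => ⟨by simpa using h.1, by simpa using h.2.1, ?_⟩)
          (fun h => by simpa using h)
        intro e' he' g1 g2
        rcases Nat.lt_or_ge e' e with hlt | hge
        · exact h.2.2 e' hlt g1 g2
        · obtain rfl : e' = e := by omega
          have := hI₄.1.le_one _ hbN
          simp only [State.setReg_arr] at g1 ⊢
          rw [g1] at hc
          rcases mul_eq_zero.1 hc with h' | h'
          · omega
          · exact absurd h' g2
    · intro s₄ hb₄ hf₄ hI₄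
      refine ⟨hI₄.1, ?_⟩
      rcases hI₄.2 with h | h
      · left
        intro a ha b hb' h1 h2
        have hlt : a * N + b < N * N := by nlinarith
        have e1 : (a * N + b) / N = a := by
          rw [mul_comm, Nat.mul_add_div hNpos, Nat.div_eq_of_lt hb', add_zero]
        have e2 : (a * N + b) % N = b := by
          rw [mul_comm, Nat.mul_add_mod, Nat.mod_eq_of_lt hb']
        have := h.2.2 (a * N + b) hlt (by rwa [e1]) h2
        rwa [e2] at this
      · rcases hI.2 with h' | h'
        · exact absurd h' h.2
        · right; omega
  · intro s₃ hb₃ hf₃ hI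
    refine ⟨hI.1, hI.2.resolve_right fun h => ?_⟩
    have := hI.1.cnt_le
    omega

/-! ### Enumerating assignments -/

section Digits

variable {n : ℕ}

/-- The number of elements of `B` that are smaller than `v`. -/
def countBelow (B : Finset (Fin n)) (v : ℕ) : ℕ := (B.filter fun u => u.1 < v).card

theorem countBelow_zero (B : Finset (Fin n)) : countBelow B 0 = 0 := by simp [countBelow]

theorem countBelow_succ (B : Finset (Fin n)) {v : ℕ} (hv : v < n) :
    countBelow B (v + 1) = countBelow B v + if ⟨v, hv⟩ ∈ B then 1 else 0 := by
  have h : B.filter (fun u => u.1 < v + 1) =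
      B.filter (fun u => u.1 < v) ∪ B.filter (fun u => u = ⟨v, hv⟩) := by
    ext u
    simp only [Finset.mem_filter, Finset.mem_union, Fin.ext_iff]
    constructor
    · rintro ⟨h1, h2⟩
      rcases Nat.lt_succ_iff_lt_or_eq.1 h2 with h | h
      · exact Or.inl ⟨h1, h⟩
      · exact Or.inr ⟨h1, h⟩
    · rintro (⟨h1, h2⟩ | ⟨h1, h2⟩)
      · exact ⟨h1, by omega⟩
      · exact ⟨h1, by omega⟩
  rw [countBelow, h, Finset.card_union_of_disjoint, Finset.filter_eq']
  · congr 1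
    split <;> simp
  · rw [Finset.disjoint_left]
    intro u h1 h2
    have h1 := (Finset.mem_filter.1 h1).2
    rw [(Finset.mem_filter.1 h2).2] at h1
    exact lt_irrefl _ h1

theorem countBelow_self (B : Finset (Fin n)) : countBelow B n = B.card := by
  rw [countBelow, Finset.filter_true_of_mem fun u _ => u.2]

/-- The assignment on `B` whose values are the digits of `k` in base four. -/
def digits (B : Finset (Fin n)) (k : ℕ) (v : Fin n) : Fin 4 :=
  if v ∈ B then ⟨k / 4 ^ countBelow B v % 4, Nat.mod_lt _ (by norm_num)⟩ else 0

theorem digits_val (B : Finset (Fin n)) (k : ℕ) (v : Fin n) :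
    (digits B k v : ℕ) = (if v ∈ B then 1 else 0) * (k / 4 ^ countBelow B v % 4) := by
  unfold digits
  split <;> simp

/-- The digits read up to vertex `v` determine the number modulo `4 ^ countBelow B v`; at the end
the modulus exceeds the number. -/
theorem digits_injOn (B : Finset (Fin n)) :
    Set.InjOn (digits B) (Finset.range (4 ^ B.card) : Finset ℕ) := by
  intro k hk l hl hkl
  have key : ∀ v, v ≤ n → k % 4 ^ countBelow B v = l % 4 ^ countBelow B v := by
    intro v
    induction v with
    | zero => intro _; simp [countBelow_zero, Nat.mod_one]
    | succ v ih =>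
      intro hv
      rw [countBelow_succ B hv]
      split
      · next h =>
        have h1 := congrArg (fun a : Fin 4 => (a : ℕ)) (congrFun hkl ⟨v, hv⟩)
        simp only [digits_val, h, if_true, one_mul] at h1
        rw [Nat.mod_pow_succ, Nat.mod_pow_succ, ih (by omega), h1]
      · exact ih (by omega)
  have := key n le_rfl
  rw [countBelow_self] at this
  rwa [Nat.mod_eq_of_lt (by simpa using hk), Nat.mod_eq_of_lt (by simpa using hl)] at this

/-- An injective map between sets of equal size: counting to `4 ^ B.card` runs through every
assignment on the bag once. -/
theorem image_digits (B : Finset (Fin n)) :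
    (Finset.range (4 ^ B.card)).image (digits B) = assignments B := by
  refine Finset.eq_of_subset_of_card_le ?_ ?_
  · intro σ hσ
    obtain ⟨k, _, rfl⟩ := Finset.mem_image.1 hσ
    exact mem_assignments.2 fun v hv => by simp [digits, hv]
  · rw [Finset.card_image_of_injOn (digits_injOn B), card_assignments, Finset.card_range]

/-- The values of an assignment at the first `v` vertices as a number in base four. -/
def hcode (σ : Fin n → Fin 4) : ℕ → ℕ
  | 0 => 0
  | v + 1 => 4 * hcode σ v + if h : v < n then (σ ⟨v, h⟩ : ℕ) else 0

theorem hcode_lt (σ : Fin n → Fin 4) (v : ℕ) : hcode σ v < 4 ^ v := by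
  induction v with
  | zero => simp [hcode]
  | succ v ih =>
    rw [hcode, pow_succ]
    split
    · next h => have := (σ ⟨v, h⟩).2; omega
    · omega

theorem hcode_injective : Function.Injective fun σ : Fin n → Fin 4 => hcode σ n := by
  intro σ τ h
  have key : ∀ v, v ≤ n → hcode σ v = hcode τ v → ∀ u : Fin n, u.1 < v → σ u = τ u := by
    intro v
    induction v with
    | zero => intro _ _ u hu; omega
    | succ v ih =>
      intro hv he u hu
      rw [hcode, hcode, dif_pos (show v < n from hv), dif_pos (show v < n from hv)] at he
      have h1 := (σ ⟨v, hv⟩).2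
      have h2 := (τ ⟨v, hv⟩).2
      rcases Nat.lt_succ_iff_lt_or_eq.1 hu with h | h
      · exact ih (by omega) (by omega) u h
      · have : u = ⟨v, hv⟩ := Fin.ext h
        subst this
        exact Fin.ext (by omega)
  exact funext fun u => key n le_rfl h u u.2

theorem hcode_zero (v : ℕ) : hcode (0 : Fin n → Fin 4) v = 0 := by
  induction v with
  | zero => rfl
  | succ v ih => rw [hcode, ih]; split <;> simp

end Digits

/-! ### The program for one bag -/

/-- The entry for bag `i` and vertex `v` in the table of bags. -/
abbrev bagExpr (i v : Expr) : Expr := .load 10 (i * .reg 1 + v)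

/-- The part of the memory that the dynamic program reads. -/
structure TreeMem {n : ℕ} (G : SimpleGraph (Fin n)) (z : ℕ) (E : Fin n → ℕ) (B : ℕ → Finset (Fin n))
    (par : ℕ → ℕ) (m Bd : ℕ) (s : State) : Prop where
  r1 : s.reg 1 = n
  r2 : s.reg 2 = n * n
  r8 : s.reg 8 = Bd
  r12 : s.reg 12 = m
  r15 : s.reg 15 = m + 1
  adj : ∀ u (hu : u < n) v (hv : v < n), G.Adj ⟨u, hu⟩ ⟨v, hv⟩ ∧ s.arr 0 (1 + (u * n + v)) = 1 ∨
    ¬ G.Adj ⟨u, hu⟩ ⟨v, hv⟩ ∧ s.arr 0 (1 + (u * n + v)) = 0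
  weight : ∀ v (hv : v < n), s.arr 7 v = z ^ E ⟨v, hv⟩
  bag : ∀ i ≤ m, ∀ v (hv : v < n), s.arr 10 (i * n + v) = if ⟨v, hv⟩ ∈ B i then 1 else 0
  par : s.arr 5 = par

section Tree

variable {Λ K : ℕ} {ω : ℕ → Bool} {s : State} {Q : State → Prop} {n : ℕ} {G : SimpleGraph (Fin n)}
  {z : ℕ} {E : Fin n → ℕ} {B : ℕ → Finset (Fin n)} {par : ℕ → ℕ} {m Bd : ℕ}

theorem TreeMem.of_frame (h : TreeMem G z E B par m Bd s) {p : LP} {s' : State} (hf : Frame p s s')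
    (hp : (p.modR 1 || p.modR 2 || p.modR 8 || p.modR 12 || p.modR 15 || p.modA 0 || p.modA 5 ||
      p.modA 7 || p.modA 10) = false) : TreeMem G z E B par m Bd s' := by
  simp only [Bool.or_eq_false_iff] at hp
  obtain ⟨⟨⟨⟨⟨⟨⟨⟨h1, h2⟩, h8⟩, h12⟩, h15⟩, a0⟩, a5⟩, a7⟩, a10⟩ := hp
  exact
    { r1 := by rw [hf.reg 1 h1, h.r1]
      r2 := by rw [hf.reg 2 h2, h.r2]
      r8 := by rw [hf.reg 8 h8, h.r8]
      r12 := by rw [hf.reg 12 h12, h.r12]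
      r15 := by rw [hf.reg 15 h15, h.r15]
      adj := by rw [hf.arr 0 a0]; exact h.adj
      weight := by rw [hf.arr 7 a7]; exact h.weight
      bag := by rw [hf.arr 10 a10]; exact h.bag
      par := by rw [hf.arr 5 a5]; exact h.par }

/-- Store the digits of register `31` at the elements of the bag in register `30`. -/
def digitsProg : LP :=
  .seq (.asg 33 (.reg 31)) <|
  .loop false 32 1 <|
    .seq (.sto 11 (.reg 32) (bagExpr (.reg 30) (.reg 32) * (.reg 33 % 4)))
      -- The divisor is 4 at members of the bag and 1 elsewhere, so a digit is consumed only when it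
      -- has been used.
      (.asg 33 (.reg 33 / (1 + 3 * bagExpr (.reg 30) (.reg 32))))

theorem digitsProg_spec (hs : s.Bdd Λ) (hm : TreeMem G z E B par m Bd s) {i k : ℕ}
    (hi : s.reg 30 = i) (him : i ≤ m) (hk : s.reg 31 = k) (hn : n ≤ Λ) (hΛ : 2 ≤ Λ)
    (hQ : ∀ s', s'.Bdd Λ → Frame digitsProg s s' →
      (∀ v (hv : v < n), s'.arr 11 v = digits (B i) k ⟨v, hv⟩) → Q s') :
    Runs Λ K ω digitsProg s Q := by
  have h4 : 4 ≤ 2 ^ Λ := by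
    calc 4 = 2 ^ 2 := by norm_num
      _ ≤ 2 ^ Λ := Nat.pow_le_pow_right (by norm_num) hΛ
  suffices h : Runs Λ K ω digitsProg s
      (fun s' => ∀ v (hv : v < n), s'.arr 11 v = digits (B i) k ⟨v, hv⟩) from
    h.mono fun s' hb hf h => hQ s' hb hf h
  refine Runs.asg_seq hs (hs.reg 31) fun hb => ?_
  refine Runs.loop (I := fun v s' => (∀ u (hu : u < n), u < v → s'.arr 11 u = digits (B i) k ⟨u, hu⟩) ∧
    s'.reg 33 = k / 4 ^ countBelow (B i) v) hb (by simpa using hm.r1) hn rfl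
    (fun v s' a h => by simpa using h) ?_ ?_ (fun s' _ _ h v hv => h.1 v hv hv)
  · refine ⟨by simp, ?_⟩
    simp [hk, countBelow_zero]
  · intro v hv s' hb' hf hr hI
    have e1 : s'.reg 1 = n := by rw [hf.reg 1 rfl]; simpa using hm.r1
    have e30 : s'.reg 30 = i := by rw [hf.reg 30 rfl]; simpa using hi
    have e10 : s'.arr 10 (i * n + v) = if ⟨v, hv⟩ ∈ B i then 1 else 0 := by
      rw [hf.arr 10 rfl]; simpa using hm.bag i him v hv
    have ev : (bagExpr (.reg 30) (.reg 32) * (.reg 33 % 4) : Expr).eval s' =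
        digits (B i) k ⟨v, hv⟩ := by
      simp only [Expr.eval_mul, Expr.eval_load, Expr.eval_add, Expr.eval_reg, Expr.eval_mod, e1, e30,
        hr, e10, hI.2, Expr.eval_four, digits_val]
    refine Runs.sto_seq hb' (by rw [ev]; exact (Fin.is_lt _).trans_le h4) fun hb₂ => ?_
    rw [ev] at hb₂ ⊢
    refine Runs.asg hb₂ ((Nat.div_le_self _ _).trans_lt (hb₂.reg 33)) ⟨fun u hu huv => ?_, ?_⟩
    · simp only [State.setReg_arr, State.setArr_arr, if_true, Expr.eval_reg, hr,
        Function.update_apply]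
      split
      · next h => subst h; rfl
      · exact hI.1 u hu (by omega)
    · simp only [Expr.eval_div, Expr.eval_reg, State.setArr_reg, State.setReg_reg, if_true, hI.2,
        Expr.eval_add, Expr.eval_one, Expr.eval_mul, Expr.eval_three, Expr.eval_load,
        State.setArr_arr, e30, e1, hr]
      rw [if_neg (by norm_num), e10, countBelow_succ (B i) hv]
      split
      · rw [pow_add, pow_one, Nat.div_div_eq_div_mul]
      · simp

/-- Compute the code of the stored assignment, restricted to the part of bag `j` that it shares with
its parent. -/
def codeProg (j : ℕ) : LP :=
  .seq (.asg 34 0) <|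
  .loop false 32 1 <| .asg 34 (4 * .reg 34 +
    bagExpr (.reg j) (.reg 32) * bagExpr (.load 5 (.reg j)) (.reg 32) * .load 11 (.reg 32))

theorem codeProg_spec (hs : s.Bdd Λ) (hm : TreeMem G z E B par m Bd s) {r j : ℕ}
    (hr : ((r == 32) || (r == 34)) = false) (hj : s.reg r = j) (hjm : j ≤ m) (hpj : par j ≤ m)
    {σ : Fin n → Fin 4} (hσ : ∀ v (hv : v < n), s.arr 11 v = σ ⟨v, hv⟩) (hn : 2 * n ≤ Λ)
    (hQ : ∀ s', s'.Bdd Λ → Frame (codeProg r) s s' →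
      s'.reg 34 = hcode (mask (sep B par j) σ) n → Q s') :
    Runs Λ K ω (codeProg r) s Q := by
  simp only [Bool.or_eq_false_iff, beq_eq_false_iff_ne] at hr
  suffices h : Runs Λ K ω (codeProg r) s
      (fun s' => s'.reg 34 = hcode (mask (sep B par j) σ) n) from
    h.mono fun s' hb hf h => hQ s' hb hf h
  refine Runs.asg_seq hs (by simp) fun hb => ?_
  refine Runs.fold (F := fun v => hcode (mask (sep B par j) σ) v) hb (by simpa using hm.r1)
    (show n ≤ Λ by omega) rfl (by simp [hcode]) (fun v hv => ⟨?_, ?_⟩) (fun s' _ _ h => h)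
  · simp only [Expr.eval_mul, Expr.eval_load, Expr.eval_add, Expr.eval_reg, Expr.eval_four,
      State.setReg_reg, State.setReg_arr, if_true, hr.1, hr.2, hj, hm.r1, hm.par, if_false, hcode,
      dif_pos hv]
    norm_num
    rw [hm.bag j hjm v hv, hm.bag _ hpj v hv, hσ v hv]
    by_cases h1 : (⟨v, hv⟩ : Fin n) ∈ B j <;> by_cases h2 : (⟨v, hv⟩ : Fin n) ∈ B (par j) <;>
      simp [mask, sep, h1, h2]
  · calc hcode _ (v + 1) < 4 ^ (v + 1) := hcode_lt _ _
      _ ≤ 4 ^ n := Nat.pow_le_pow_right (by norm_num) hv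
      _ = 2 ^ (2 * n) := by rw [pow_mul]; norm_num
      _ ≤ 2 ^ Λ := Nat.pow_le_pow_right (by norm_num) hn

end Tree

/-! ### One term of the recurrence: local factor, new weights, tables of children -/

section Tree

variable {Λ K : ℕ} {ω : ℕ → Bool} {s : State} {Q : State → Prop} {n : ℕ} {G : SimpleGraph (Fin n)}
  {z : ℕ} {E : Fin n → ℕ} {B : ℕ → Finset (Fin n)} {par : ℕ → ℕ} {m Bd : ℕ}

theorem mul_add_div_of_lt {n u v : ℕ} (hv : v < n) : (u * n + v) / n = u := by
  rw [mul_comm, Nat.mul_add_div (by omega), Nat.div_eq_of_lt hv, add_zero]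

theorem mul_add_mod_of_lt' {n u v : ℕ} (hv : v < n) : (u * n + v) % n = v := by
  rw [mul_comm, Nat.mul_add_mod, Nat.mod_eq_of_lt hv]

theorem mul_add_lt {n m u v : ℕ} (hu : u < m) (hv : v < n) : u * n + v < m * n := by
  have := Nat.mul_le_mul_right n (Nat.succ_le_of_lt hu)
  rw [Nat.succ_mul] at this
  omega

/-- Multiply register `35` by the indicator of compatibility of the stored assignment. -/
def edgeProg : LP :=
  .loop false 32 2 <| .asg 35 (.reg 35 * (1 -
    bagExpr (.reg 30) (.reg 32 / .reg 1) * bagExpr (.reg 30) (.reg 32 % .reg 1) *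
    .load 0 (1 + .reg 32) * .lt 0 (.load 11 (.reg 32 / .reg 1)) *
    .lt 0 (.load 11 (.reg 32 % .reg 1)) *
    (1 - .eq (.load 11 (.reg 32 / .reg 1)) (.load 11 (.reg 32 % .reg 1)))))

theorem edgeProg_spec (hs : s.Bdd Λ) (hm : TreeMem G z E B par m Bd s) {i : ℕ}
    (hi : s.reg 30 = i) (him : i ≤ m) {σ : Fin n → Fin 4}
    (hσ : ∀ v (hv : v < n), s.arr 11 v = σ ⟨v, hv⟩) (h35 : s.reg 35 = 1) (hn : n * n ≤ Λ)
    (hΛ : 2 ≤ Λ)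
    (hQ : ∀ s', s'.Bdd Λ → Frame edgeProg s s' → s'.reg 35 = localFactor G (B i) σ → Q s') :
    Runs Λ K ω edgeProg s Q := by
  classical
  -- The ordered pair of vertices number `e` does not violate compatibility within the bag. Register
  -- `35` stays 1 as long as all pairs seen are good.
  let good : ℕ → Prop := fun e => ∀ (hu : e / n < n) (hv : e % n < n), ⟨e / n, hu⟩ ∈ B i →
    ⟨e % n, hv⟩ ∈ B i → G.Adj ⟨e / n, hu⟩ ⟨e % n, hv⟩ → σ ⟨e / n, hu⟩ ≠ 0 → σ ⟨e % n, hv⟩ ≠ 0 →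
    σ ⟨e / n, hu⟩ = σ ⟨e % n, hv⟩
  have hone : 1 < 2 ^ Λ := Nat.one_lt_two_pow (by omega)
  refine Runs.fold (F := fun e => if ∀ e' < e, good e' then 1 else 0) hs hm.r2 hn rfl
    (by simpa using h35) (fun e he => ⟨?_, ?_⟩) (fun s' hb hf h => hQ s' hb hf ?_)
  · have hnpos : 0 < n := Nat.pos_of_ne_zero (by rintro rfl; omega)
    have hu : e / n < n := Nat.div_lt_of_lt_mul he
    have hv : e % n < n := Nat.mod_lt _ hnpos
    have ha := hm.adj _ hu _ hv
    rw [Nat.div_add_mod'] at ha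
    have hval : ∀ v, (0 < (σ v : ℕ) ↔ σ v ≠ 0) := fun v => by
      rw [Nat.pos_iff_ne_zero, Ne, Ne, Fin.ext_iff]; rfl
    have hstep : (if ∀ e' < e + 1, good e' then 1 else 0) =
        (if ∀ e' < e, good e' then 1 else 0) * if good e then 1 else 0 := by
      have : (∀ e' < e + 1, good e') ↔ (∀ e' < e, good e') ∧ good e :=
        ⟨fun h => ⟨fun e' he' => h e' (by omega), h e (by omega)⟩, fun h e' he' => by
          rcases Nat.lt_succ_iff_lt_or_eq.1 he' with h' | h'
          · exact h.1 e' h'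
          · rw [h']; exact h.2⟩
      rw [if_congr this rfl rfl]
      by_cases h1 : ∀ e' < e, good e'
      · by_cases h2 : good e
        · rw [if_pos ⟨h1, h2⟩, if_pos h1, if_pos h2]
        · rw [if_neg fun h => h2 h.2, if_neg h2, mul_zero]
      · rw [if_neg fun h => h1 h.1, if_neg h1, zero_mul]
    rw [hstep]
    have hb1 := hm.bag i him _ hu
    have hb2 := hm.bag i him _ hv
    have hs1 := hσ _ hu
    have hs2 := hσ _ hv
    simp only [Expr.eval_mul, Expr.eval_load, Expr.eval_add, Expr.eval_reg, Expr.eval_sub,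
      Expr.eval_one, Expr.eval_zero, Expr.eval_div, Expr.eval_mod, Expr.eval_lt, Expr.eval_eq,
      State.setReg_reg, State.setReg_arr, if_true, hi, hm.r1]
    norm_num only [if_false]
    rw [hb1, hb2, hs1, hs2]
    refine congrArg _ ?_
    have hgood : good e ↔ (⟨e / n, hu⟩ ∈ B i → ⟨e % n, hv⟩ ∈ B i → G.Adj ⟨e / n, hu⟩ ⟨e % n, hv⟩ →
        σ ⟨e / n, hu⟩ ≠ 0 → σ ⟨e % n, hv⟩ ≠ 0 → σ ⟨e / n, hu⟩ = σ ⟨e % n, hv⟩) :=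
      ⟨fun h => h hu hv, fun h _ _ => h⟩
    simp only [hgood, hval, Fin.val_inj]
    rcases ha with ⟨ha, ha'⟩ | ⟨ha, ha'⟩ <;> rw [ha'] <;>
    by_cases h1 : (⟨e / n, hu⟩ : Fin n) ∈ B i <;> by_cases h2 : (⟨e % n, hv⟩ : Fin n) ∈ B i <;>
    by_cases h3 : σ ⟨e / n, hu⟩ = 0 <;> by_cases h4 : σ ⟨e % n, hv⟩ = 0 <;>
    by_cases h5 : σ ⟨e / n, hu⟩ = σ ⟨e % n, hv⟩ <;> simp [ha, h1, h2, h3, h4, h5]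
  · split <;> omega
  · rw [h, localFactor]
    congr 1
    refine propext ⟨fun h u hu v hv huv => ?_, fun h e _ hu hv a b => h _ a _ b⟩
    have hlt : u.1 * n + v.1 < n * n := mul_add_lt u.2 v.2
    have := h (u.1 * n + v.1) hlt
    simp only [good, mul_add_div_of_lt v.2, mul_add_mod_of_lt' v.2] at this
    exact this u.2 v.2 hu hv huv

/-- Multiply register `35` by the weights of the vertices that are not shared with the parent. -/
def weightProg : LP :=
  .loop false 32 1 <| .asg 35 (.reg 35 *
    (1 - bagExpr (.reg 30) (.reg 32) * (1 - bagExpr (.load 5 (.reg 30)) (.reg 32)) +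
      bagExpr (.reg 30) (.reg 32) * (1 - bagExpr (.load 5 (.reg 30)) (.reg 32)) *
      (.eq (.load 11 (.reg 32)) 0 + 3 * .eq (.load 11 (.reg 32)) 1 +
        .lt 1 (.load 11 (.reg 32)) * .load 7 (.reg 32))) % .reg 8)

theorem stateWeight_eq (v : Fin n) (a : Fin 4) : stateWeight z E v a =
    (if (a : ℕ) = 0 then 1 else 0) + 3 * (if (a : ℕ) = 1 then 1 else 0) +
      (if 1 < (a : ℕ) then 1 else 0) * z ^ E v := by
  unfold stateWeight
  fin_cases a <;> simp

theorem weightProg_spec (hs : s.Bdd Λ) (hm : TreeMem G z E B par m Bd s) {i : ℕ}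
    (hi : s.reg 30 = i) (him : i ≤ m) (hpi : par i ≤ m) {σ : Fin n → Fin 4}
    (hσ : ∀ v (hv : v < n), s.arr 11 v = σ ⟨v, hv⟩) {L : ℕ} (h35 : s.reg 35 = L % Bd)
    (hn : n ≤ Λ) (hBd : 0 < Bd)
    (hQ : ∀ s', s'.Bdd Λ → Frame weightProg s s' →
      s'.reg 35 = (L * ∏ v ∈ B i \ sep B par i, stateWeight z E v (σ v)) % Bd → Q s') :
    Runs Λ K ω weightProg s Q := by
  have hBdΛ : Bd < 2 ^ Λ := hm.r8 ▸ hs.reg 8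
  -- Only the new vertices of the bag contribute; the shared ones are weighted at the ancestor where
  -- they first occur. Reduction modulo `Bd` in every round keeps the register small.
  refine Runs.fold (F := fun v => (L * ∏ x ∈ Finset.range v, if h : x < n then
      (if ⟨x, h⟩ ∈ B i \ sep B par i then stateWeight z E ⟨x, h⟩ (σ ⟨x, h⟩) else 1) else 1) % Bd)
    hs hm.r1 hn rfl (by simpa using h35) (fun v hv => ⟨?_, (Nat.mod_lt _ hBd).trans hBdΛ⟩)
    (fun s' hb hf h => hQ s' hb hf ?_)
  · simp only [Expr.eval_mul, Expr.eval_load, Expr.eval_add, Expr.eval_reg, Expr.eval_sub,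
      Expr.eval_one, Expr.eval_zero, Expr.eval_mod, Expr.eval_lt, Expr.eval_eq, Expr.eval_three,
      State.setReg_reg, State.setReg_arr, if_true, hi, hm.r1, hm.r8, hm.par]
    norm_num only [if_false]
    rw [hm.bag i him v hv, hm.bag _ hpi v hv, hσ v hv, hm.weight v hv, Finset.prod_range_succ,
      dif_pos hv, ← mul_assoc, stateWeight_eq]
    conv_rhs => rw [Nat.mul_mod]
    conv_lhs => rw [Nat.mul_mod, Nat.mod_mod]
    congr 3
    by_cases h1 : (⟨v, hv⟩ : Fin n) ∈ B i <;> by_cases h2 : (⟨v, hv⟩ : Fin n) ∈ B (par i) <;>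
      simp [sep, h1, h2]
  · rw [h]
    congr 2
    rw [Finset.prod_range]
    simp only [Fin.is_lt, dif_pos, Fin.eta]
    rw [Finset.prod_ite_mem, Finset.univ_inter]

/-- The table entry for bag `j` and a code. -/
def tableEntry (m : ℕ) (s : State) (j : ℕ) (c : Fin n → Fin 4) : ℕ :=
  s.arr 12 (hcode c n * (m + 1) + j)

/-- Multiply register `35` by the table entries of the children of the bag in register `30`. -/
def childProg : LP :=
  .loop false 36 15 <|
    -- Bag 0 must be excluded explicitly, since the parent array is meaningless there.
    .ite (.lt 0 (.reg 36) * .eq (.load 5 (.reg 36)) (.reg 30))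
      (.seq (codeProg 36)
        (.asg 35 (.reg 35 * .load 12 (.reg 34 * .reg 15 + .reg 36) % .reg 8)))
      (.asg 27 0)

theorem childProg_spec (hs : s.Bdd Λ) (hm : TreeMem G z E B par m Bd s) {i : ℕ}
    (hi : s.reg 30 = i) (him : i ≤ m) {σ : Fin n → Fin 4}
    (hσ : ∀ v (hv : v < n), s.arr 11 v = σ ⟨v, hv⟩) {L : ℕ} (h35 : s.reg 35 = L % Bd)
    (hn : 2 * n ≤ Λ) (hmΛ : m + 1 ≤ Λ) (hBd : 0 < Bd)
    (hQ : ∀ s', s'.Bdd Λ → Frame childProg s s' →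
      s'.reg 35 = (L * ∏ j ∈ Finset.Icc 1 m with par j = i,
        tableEntry m s j (mask (sep B par j) σ)) % Bd → Q s') :
    Runs Λ K ω childProg s Q := by
  have hBdΛ : Bd < 2 ^ Λ := hm.r8 ▸ hs.reg 8
  refine Runs.loop (I := fun k s' => s'.reg 35 = (L * ∏ j ∈ (Finset.range k).filter
      fun j => 0 < j ∧ par j = i, tableEntry m s j (mask (sep B par j) σ)) % Bd)
    hs hm.r15 hmΛ rfl (fun k s' a h => by simpa using h) (by simpa using h35) ?_
    (fun s' hb hf h => hQ s' hb hf ?_)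
  · intro k hk s' hb hf hr hI
    have hm' := hm.of_frame hf rfl
    have e30 : s'.reg 30 = i := by rw [hf.reg 30 rfl, hi]
    have hcond : (Expr.lt 0 (.reg 36) * .eq (.load 5 (.reg 36)) (.reg 30) : Expr).eval s' =
        (if 0 < k then 1 else 0) * if par k = i then 1 else 0 := by
      simp only [Expr.eval_mul, Expr.eval_lt, Expr.eval_eq, Expr.eval_load, Expr.eval_reg,
        Expr.eval_zero, hr, e30, hm'.par]
    refine Runs.ite hb (fun hc => ?_) (fun hc => ?_)
    · rw [hcond] at hc
      have hk0 : 0 < k := by by_contra h; simp [h] at hc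
      have hpk : par k = i := by by_contra h; simp [h] at hc
      refine Runs.seq (codeProg_spec (σ := σ) hb hm' rfl hr (by omega) (by omega)
        (by rw [hf.arr 11 rfl]; exact hσ) hn
        (fun s₁ hb₁ hf₁ h₁ => show s₁.reg 34 = _ from h₁)) fun s₁ hb₁ hf₁ h₁ => ?_
      have hm₁ := hm'.of_frame hf₁ rfl
      have ev : (Expr.reg 35 * .load 12 (.reg 34 * .reg 15 + .reg 36) % .reg 8 : Expr).eval s₁ =
          (L * ∏ j ∈ (Finset.range (k + 1)).filter fun j => 0 < j ∧ par j = i,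
            tableEntry m s j (mask (sep B par j) σ)) % Bd := by
        rw [Finset.range_add_one, Finset.filter_insert, if_pos ⟨hk0, hpk⟩, Finset.prod_insert (by simp),
          mul_left_comm, mul_comm]
        simp only [Expr.eval_mul, Expr.eval_load, Expr.eval_add, Expr.eval_reg, Expr.eval_mod, h₁,
          hm₁.r15, hm₁.r8, hf₁.reg 36 rfl, hr, hf₁.reg 35 rfl, hf₁.arr 12 rfl, hf.arr 12 rfl]
        rw [show s'.reg 35 = _ from hI, Nat.mul_mod, Nat.mod_mod, ← Nat.mul_mod]
        rfl
      refine Runs.asg hb₁ (by rw [ev]; exact (Nat.mod_lt _ hBd).trans hBdΛ) ?_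
      simp only [State.setReg_reg, if_true, ev]
    · rw [hcond] at hc
      refine Runs.asg hb (by simp) ?_
      have hno : ¬ (0 < k ∧ par k = i) := fun h => by simp [h.1, h.2] at hc
      simp only [State.setReg_reg]
      rw [Finset.range_add_one, Finset.filter_insert, if_neg hno]
      simpa using hI
  · rw [h]
    congr 2
    refine Finset.prod_congr (Finset.ext fun j => ?_) fun _ _ => rfl
    simp only [Finset.mem_filter, Finset.mem_range, Finset.mem_Icc]
    constructor <;> rintro ⟨h1, h2⟩ <;> refine ⟨by omega, ?_⟩
    · exact h2.2
    · exact ⟨by omega, h2⟩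

/-- The value of one term of the recurrence. -/
noncomputable def termValue (G : SimpleGraph (Fin n)) (z : ℕ) (E : Fin n → ℕ)
    (B : ℕ → Finset (Fin n)) (par : ℕ → ℕ) (m : ℕ) (s : State) (i : ℕ) (σ : Fin n → Fin 4) : ℕ :=
  localFactor G (B i) σ * (∏ v ∈ B i \ sep B par i, stateWeight z E v (σ v)) *
    ∏ j ∈ Finset.Icc 1 m with par j = i, tableEntry m s j (mask (sep B par j) σ)

/-- Compute one term of the recurrence. -/
def termProg : LP :=
  .seq (.asg 35 1) <| .seq edgeProg <| .seq weightProg childProg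

theorem termProg_spec (hs : s.Bdd Λ) (hm : TreeMem G z E B par m Bd s) {i : ℕ}
    (hi : s.reg 30 = i) (him : i ≤ m) (hpi : par i ≤ m) {σ : Fin n → Fin 4}
    (hσ : ∀ v (hv : v < n), s.arr 11 v = σ ⟨v, hv⟩)
    (hn : 2 * n ≤ Λ) (hnn : n * n ≤ Λ) (hmΛ : m + 1 ≤ Λ) (hΛ : 2 ≤ Λ) (hBd : 1 < Bd)
    (hQ : ∀ s', s'.Bdd Λ → Frame termProg s s' →
      s'.reg 35 = termValue G z E B par m s i σ % Bd → Q s') :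
    Runs Λ K ω termProg s Q := by
  have hone : 1 < 2 ^ Λ := Nat.one_lt_two_pow (by omega)
  suffices h : Runs Λ K ω termProg s
      (fun s' => s'.reg 35 = termValue G z E B par m s i σ % Bd) from
    h.mono fun s' hb hf h => hQ s' hb hf h
  refine Runs.asg_seq hs (by simpa using hone) fun hb => ?_
  generalize hs₀ : s.setReg 35 _ = s₀ at hb ⊢
  have hf₀ : Frame (.asg 35 1) s s₀ := by
    subst hs₀
    refine ⟨fun r hr => ?_, fun _ _ => rfl, fun _ => rfl⟩
    have : r ≠ 35 := by simpa [LP.modR] using hr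
    simp [this]
  have hm₀ := hm.of_frame hf₀ rfl
  refine Runs.seq (edgeProg_spec hb hm₀ (by rw [hf₀.reg 30 rfl, hi]) him
    (by rw [hf₀.arr 11 rfl]; exact hσ) (by subst hs₀; simp) hnn hΛ
    (fun s₁ _ _ h => show s₁.reg 35 = _ from h)) fun s₁ hb₁ hf₁ h₁ => ?_
  have hm₁ := hm₀.of_frame hf₁ rfl
  refine Runs.seq (weightProg_spec hb₁ hm₁ (L := localFactor G (B i) σ)
    (by rw [hf₁.reg 30 rfl, hf₀.reg 30 rfl, hi]) him hpi
    (by rw [hf₁.arr 11 rfl, hf₀.arr 11 rfl]; exact hσ) ?_ (by omega) (by omega)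
    (fun s₂ _ _ h => show s₂.reg 35 = _ from h)) fun s₂ hb₂ hf₂ h₂ => ?_
  · rw [h₁, Nat.mod_eq_of_lt]
    unfold localFactor
    split <;> omega
  have hm₂ := hm₁.of_frame hf₂ rfl
  refine childProg_spec hb₂ hm₂ (by rw [hf₂.reg 30 rfl, hf₁.reg 30 rfl, hf₀.reg 30 rfl, hi]) him
    (by rw [hf₂.arr 11 rfl, hf₁.arr 11 rfl, hf₀.arr 11 rfl]; exact hσ) h₂ hn hmΛ (by omega)
    fun s₃ hb₃ hf₃ h₃ => ?_
  rw [h₃]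
  unfold termValue tableEntry
  rw [hf₂.arr 12 rfl, hf₁.arr 12 rfl, hf₀.arr 12 rfl]

end Tree

/-! ### The table of one bag, and the dynamic program over all bags -/

section Tree

variable {Λ K : ℕ} {ω : ℕ → Bool} {s : State} {Q : State → Prop} {n : ℕ} {G : SimpleGraph (Fin n)}
  {z : ℕ} {E : Fin n → ℕ} {B : ℕ → Finset (Fin n)} {par : ℕ → ℕ} {m Bd : ℕ}

theorem mod_of_table_index {x m j : ℕ} (h : j ≤ m) : (x * (m + 1) + j) % (m + 1) = j :=
  mul_add_mod_of_lt' (by omega)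

/-- Compute in register `37` the number of assignments on the bag in register `30`. -/
def countProg : LP :=
  .seq (.asg 37 1) <|
  .loop false 32 1 <| .asg 37 (.reg 37 * (1 + 3 * bagExpr (.reg 30) (.reg 32)))

theorem countProg_spec (hs : s.Bdd Λ) (hm : TreeMem G z E B par m Bd s) {i : ℕ}
    (hi : s.reg 30 = i) (him : i ≤ m) (hn : 2 * n < Λ)
    (hQ : ∀ s', s'.Bdd Λ → Frame countProg s s' → s'.reg 37 = 4 ^ (B i).card → Q s') :
    Runs Λ K ω countProg s Q := by
  have hone : 1 < 2 ^ Λ := Nat.one_lt_two_pow (by omega)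
  suffices h : Runs Λ K ω countProg s (fun s' => s'.reg 37 = 4 ^ (B i).card) from
    h.mono fun s' hb hf h => hQ s' hb hf h
  refine Runs.asg_seq hs (by simpa using hone) fun hb => ?_
  refine Runs.fold (F := fun v => 4 ^ countBelow (B i) v) hb (by simpa using hm.r1)
    (show n ≤ Λ by omega) rfl (by simp [countBelow_zero]) (fun v hv => ⟨?_, ?_⟩)
    (fun s' _ _ h => by rw [h, countBelow_self])
  · simp only [Expr.eval_mul, Expr.eval_load, Expr.eval_add, Expr.eval_reg, Expr.eval_one,
      Expr.eval_three, State.setReg_reg, State.setReg_arr, if_true, hi, hm.r1]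
    norm_num only [if_false]
    rw [hm.bag i him v hv, countBelow_succ _ hv]
    split <;> simp [pow_succ]
  · have : countBelow (B i) (v + 1) ≤ n :=
      (Finset.card_filter_le _ _).trans (card_finset_fin_le _)
    calc 4 ^ countBelow (B i) (v + 1) ≤ 4 ^ n := Nat.pow_le_pow_right (by norm_num) this
      _ = 2 ^ (2 * n) := by rw [pow_mul]; norm_num
      _ < 2 ^ Λ := Nat.pow_lt_pow_right (by norm_num) hn

/-- Clear the table entries of the bag in register `30`. -/
def clearProg : LP :=
  .loop true 31 37 <| .seq digitsProg <| .seq (codeProg 30) <|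
    .sto 12 (.reg 34 * .reg 15 + .reg 30) 0

/-- Table entries may be left over from an earlier tree decomposition. The codes range up to `4 ^
n`, so only those entries are cleared that the summation will use, by the same enumeration of
assignments. -/
theorem clearProg_spec (hs : s.Bdd Λ) (hm : TreeMem G z E B par m Bd s) {i : ℕ}
    (hi : s.reg 30 = i) (him : i ≤ m) (hpi : par i ≤ m) (hn : 2 * n ≤ Λ) (hΛ : 2 ≤ Λ)
    (hq : s.reg 37 = 4 ^ (B i).card) (hK : 4 ^ (B i).card ≤ K)
    (hQ : ∀ s', s'.Bdd Λ → Frame clearProg s s' →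
      (∀ k < 4 ^ (B i).card, tableEntry m s' i (mask (sep B par i) (digits (B i) k)) = 0) →
      (∀ x, x % (m + 1) ≠ i → s'.arr 12 x = s.arr 12 x) → Q s') :
    Runs Λ K ω clearProg s Q := by
  refine Runs.loop (I := fun k s' =>
    (∀ k' < k, tableEntry m s' i (mask (sep B par i) (digits (B i) k')) = 0) ∧
      ∀ x, x % (m + 1) ≠ i → s'.arr 12 x = s.arr 12 x) hs hq hK rfl
    (fun k s' a h => by simpa [tableEntry] using h) ⟨by simp, fun _ _ => rfl⟩ ?_
    (fun s' hb hf h => hQ s' hb hf h.1 h.2)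
  intro k hk s' hb hf hr hI
  have hm' := hm.of_frame hf rfl
  refine Runs.seq (digitsProg_spec hb hm' (by rw [hf.reg 30 rfl, hi]) him hr (by omega) hΛ
    (fun s₁ _ _ h => show ∀ v (hv : v < n), s₁.arr 11 v = digits (B i) k ⟨v, hv⟩ from h))
    fun s₁ hb₁ hf₁ h₁ => ?_
  have hm₁ := hm'.of_frame hf₁ rfl
  refine Runs.seq (codeProg_spec hb₁ hm₁ rfl (by rw [hf₁.reg 30 rfl, hf.reg 30 rfl, hi]) him hpi h₁
    hn (fun s₂ _ _ h => show s₂.reg 34 = _ from h)) fun s₂ hb₂ hf₂ h₂ => ?_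
  have hm₂ := hm₁.of_frame hf₂ rfl
  have e12 : s₂.arr 12 = s'.arr 12 := by rw [hf₂.arr 12 rfl, hf₁.arr 12 rfl]
  have e30 : s₂.reg 30 = i := by rw [hf₂.reg 30 rfl, hf₁.reg 30 rfl, hf.reg 30 rfl, hi]
  refine Runs.sto hb₂ (by simp) ?_
  simp only [tableEntry, Expr.eval_add, Expr.eval_mul, Expr.eval_reg, h₂, hm₂.r15, e30,
    State.setArr_arr, if_true, Function.update_apply, e12, Expr.eval_zero]
  refine ⟨fun k' hk' => ?_, fun x hx => ?_⟩
  · split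
    · rfl
    · next h =>
      rcases Nat.lt_succ_iff_lt_or_eq.1 hk' with h' | h'
      · exact hI.1 k' h'
      · exact absurd (by rw [h']) h
  · rw [if_neg]
    · exact hI.2 x hx
    · rintro rfl
      exact hx (mod_of_table_index him)

/-- Fill the table for the bag in register `30`. -/
def sumProg : LP :=
  .loop true 31 37 <| .seq digitsProg <| .seq (codeProg 30) <| .seq (.asg 38 (.reg 34)) <|
    .seq termProg <| .sto 12 (.reg 38 * .reg 15 + .reg 30)
      ((.load 12 (.reg 38 * .reg 15 + .reg 30) + .reg 35) % .reg 8)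

/-- Children have larger numbers than their parent, and the tables of different bags occupy
different residue classes of addresses modulo `m + 1`; writing the table of bag `i` does not disturb
what its terms read. -/
theorem termValue_congr {s' : State} {i : ℕ} (h : BagTree m B par)
    (hs : ∀ x, x % (m + 1) ≠ i → s'.arr 12 x = s.arr 12 x) (σ : Fin n → Fin 4) :
    termValue G z E B par m s' i σ = termValue G z E B par m s i σ := by
  unfold termValue
  refine congrArg _ (Finset.prod_congr rfl fun j hj => hs _ ?_)
  obtain ⟨h1, h2⟩ := Finset.mem_filter.1 hj
  rw [Finset.mem_Icc] at h1
  have := h.par_lt j h1.1 h1.2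
  rw [mod_of_table_index h1.2]
  omega

/-- Each assignment of the bag adds its term to the entry of its restriction to the separator. A
single pass over the `4 ^ |B i|` assignments therefore fills all entries at once. -/
theorem sumProg_spec (hs : s.Bdd Λ) (hm : TreeMem G z E B par m Bd s) (hB : BagTree m B par) {i : ℕ}
    (hi : s.reg 30 = i) (him : i ≤ m) (hpi : par i ≤ m) (hn : 2 * n ≤ Λ) (hΛ : 2 ≤ Λ)
    (hnn : n * n ≤ Λ) (hmΛ : m + 1 ≤ Λ) (hBd : 1 < Bd)
    (hq : s.reg 37 = 4 ^ (B i).card) (hK : 4 ^ (B i).card ≤ K)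
    (h0 : ∀ k < 4 ^ (B i).card, tableEntry m s i (mask (sep B par i) (digits (B i) k)) = 0)
    (hQ : ∀ s', s'.Bdd Λ → Frame sumProg s s' →
      (∀ k < 4 ^ (B i).card, tableEntry m s' i (mask (sep B par i) (digits (B i) k)) =
        (∑ l ∈ Finset.range (4 ^ (B i).card) with mask (sep B par i) (digits (B i) l) =
          mask (sep B par i) (digits (B i) k),
          termValue G z E B par m s i (digits (B i) l)) % Bd) →
      (∀ x, x % (m + 1) ≠ i → s'.arr 12 x = s.arr 12 x) → Q s') :
    Runs Λ K ω sumProg s Q := by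
  have hBdΛ : Bd < 2 ^ Λ := hm.r8 ▸ hs.reg 8
  set c : ℕ → Fin n → Fin 4 := fun k => mask (sep B par i) (digits (B i) k) with hc
  refine Runs.loop (I := fun q s' =>
    (∀ k < 4 ^ (B i).card, tableEntry m s' i (c k) = (∑ l ∈ Finset.range q with c l = c k,
      termValue G z E B par m s i (digits (B i) l)) % Bd) ∧
      ∀ x, x % (m + 1) ≠ i → s'.arr 12 x = s.arr 12 x) hs hq hK rfl
    (fun k s' a h => by simpa [tableEntry] using h)
    ⟨fun k hk => by simpa using h0 k hk, fun _ _ => rfl⟩ ?_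
    (fun s' hb hf h => hQ s' hb hf h.1 h.2)
  intro q hq s' hb hf hr hI
  have hm' := hm.of_frame hf rfl
  refine Runs.seq (digitsProg_spec hb hm' (by rw [hf.reg 30 rfl, hi]) him hr (by omega) hΛ
    (fun s₁ _ _ h => show ∀ v (hv : v < n), s₁.arr 11 v = digits (B i) q ⟨v, hv⟩ from h))
    fun s₁ hb₁ hf₁ h₁ => ?_
  have hm₁ := hm'.of_frame hf₁ rfl
  refine Runs.seq (codeProg_spec hb₁ hm₁ rfl (by rw [hf₁.reg 30 rfl, hf.reg 30 rfl, hi]) him hpi h₁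
    hn (fun s₂ _ _ h => show s₂.reg 34 = _ from h)) fun s₂ hb₂ hf₂ h₂ => ?_
  have hm₂ := hm₁.of_frame hf₂ rfl
  refine Runs.seq (Runs.asg (Q := fun s₃ => s₃.reg 38 = hcode (c q) n) hb₂ (hb₂.reg 34)
    (by simpa using h₂)) fun s₃ hb₃ hf₃ h₃ => ?_
  have hm₃ := hm₂.of_frame hf₃ rfl
  refine Runs.seq (termProg_spec hb₃ hm₃
    (by rw [hf₃.reg 30 rfl, hf₂.reg 30 rfl, hf₁.reg 30 rfl, hf.reg 30 rfl, hi]) him hpi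
    (by rw [hf₃.arr 11 rfl, hf₂.arr 11 rfl]; exact h₁) hn hnn hmΛ hΛ hBd
    (fun s₄ _ _ h => show s₄.reg 35 = _ from h)) fun s₄ hb₄ hf₄ h₄ => ?_
  have hm₄ := hm₃.of_frame hf₄ rfl
  have e12 : s₃.arr 12 = s'.arr 12 := by rw [hf₃.arr 12 rfl, hf₂.arr 12 rfl, hf₁.arr 12 rfl]
  have e12' : s₄.arr 12 = s'.arr 12 := by rw [hf₄.arr 12 rfl, e12]
  have e30 : s₄.reg 30 = i := by
    rw [hf₄.reg 30 rfl, hf₃.reg 30 rfl, hf₂.reg 30 rfl, hf₁.reg 30 rfl, hf.reg 30 rfl, hi]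
  have e38 : s₄.reg 38 = hcode (c q) n := by rw [hf₄.reg 38 rfl, h₃]
  have e35 : s₄.reg 35 = termValue G z E B par m s i (digits (B i) q) % Bd := by
    rw [h₄, termValue_congr hB (s := s) (by rw [e12]; exact hI.2)]
  have haddr : (Expr.reg 38 * .reg 15 + .reg 30 : Expr).eval s₄ = hcode (c q) n * (m + 1) + i := by
    simp only [Expr.eval_add, Expr.eval_mul, Expr.eval_reg, e38, e30, hm₄.r15]
  have hval : ((.load 12 (.reg 38 * .reg 15 + .reg 30) + .reg 35) % .reg 8 : Expr).eval s₄ =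
      (tableEntry m s' i (c q) + termValue G z E B par m s i (digits (B i) q)) % Bd := by
    rw [Expr.eval_mod, Expr.eval_add, Expr.eval_load, haddr, Expr.eval_reg, Expr.eval_reg, e35,
      hm₄.r8, e12', Nat.add_mod_mod]
    rfl
  refine Runs.sto hb₄ (by rw [hval]; exact (Nat.mod_lt _ (by omega)).trans hBdΛ) ?_
  rw [haddr, hval]
  simp only [tableEntry, State.setArr_arr, if_true, Function.update_apply, e12']
  refine ⟨fun k hk => ?_, fun x hx => ?_⟩
  · rw [Finset.range_add_one, Finset.filter_insert]
    by_cases hqk : c q = c k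
    · have hIq := hI.1 q hq
      simp only [tableEntry] at hIq
      rw [if_pos hqk, if_pos (by rw [hqk]), Finset.sum_insert (by simp), hIq, hqk,
        Nat.mod_add_mod, add_comm]
    · rw [if_neg hqk, if_neg]
      · exact hI.1 k hk
      · intro h
        -- Different restrictions have different codes, so no foreign entry is increased.
        refine hqk (hcode_injective ?_)
        have : (hcode (c k) n) * (m + 1) = hcode (c q) n * (m + 1) := by omega
        exact (Nat.eq_of_mul_eq_mul_right (by omega) this).symm
  · rw [if_neg]
    · exact hI.2 x hx
    · rintro rfl
      exact hx (mod_of_table_index him)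

/-- The table as a function with values modulo `Bd`. -/
def tableFun (m Bd : ℕ) (s : State) (j : ℕ) (c : Fin n → Fin 4) : ZMod Bd := (tableEntry m s j c : ZMod Bd)

theorem natCast_localFactor (S : Finset (Fin n)) (σ : Fin n → Fin 4) :
    ((localFactor G S σ : ℕ) : ZMod Bd) = localFactor G S σ := by
  unfold localFactor
  by_cases h : ∀ u ∈ S, ∀ v ∈ S, G.Adj u v → σ u ≠ 0 → σ v ≠ 0 → σ u = σ v
  · rw [if_pos h, if_pos h, Nat.cast_one]
  · rw [if_neg h, if_neg h, Nat.cast_zero]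

/-- The program for one bag. -/
def nodeProg : LP := .seq countProg <| .seq clearProg sumProg

/-- The recurrence modulo `Bd`. -/
def ModRecurrence (G : SimpleGraph (Fin n)) (z : ℕ) (E : Fin n → ℕ) (B : ℕ → Finset (Fin n))
    (par : ℕ → ℕ) (m Bd : ℕ) (s : State) (i : ℕ) : Prop :=
  TreeRecurrence m B par (fun v a => (stateWeight z E v a : ZMod Bd))
    (fun i => localFactor G (B i)) (tableFun m Bd s) i

/-- Assignments on the separator also occur among the digits of the whole bag, extended by zero, so
the entries for all arguments of the recurrence have been filled. -/
theorem nodeProg_spec (hs : s.Bdd Λ) (hm : TreeMem G z E B par m Bd s) (hB : BagTree m B par) {i : ℕ}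
    (hi : s.reg 30 = i) (him : i ≤ m) (hpi : par i ≤ m) (hn : 2 * n < Λ) (hΛ : 2 ≤ Λ)
    (hnn : n * n ≤ Λ) (hmΛ : m + 1 ≤ Λ) (hBd : 1 < Bd) (hK : 4 ^ (B i).card ≤ K)
    (hQ : ∀ s', s'.Bdd Λ → Frame nodeProg s s' → ModRecurrence G z E B par m Bd s' i →
      (∀ x, x % (m + 1) ≠ i → s'.arr 12 x = s.arr 12 x) → Q s') :
    Runs Λ K ω nodeProg s Q := by
  suffices h : Runs Λ K ω nodeProg s (fun s' => ModRecurrence G z E B par m Bd s' i ∧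
      (∀ x, x % (m + 1) ≠ i → s'.arr 12 x = s.arr 12 x)) from
    h.mono fun s' hb hf h => hQ s' hb hf h.1 h.2
  refine Runs.seq (countProg_spec hs hm hi him hn
    (fun s₁ _ _ h => show s₁.reg 37 = _ from h)) fun s₁ hb₁ hf₁ h₁ => ?_
  have hm₁ := hm.of_frame hf₁ rfl
  have hi₁ : s₁.reg 30 = i := by rw [hf₁.reg 30 rfl, hi]
  refine Runs.seq (clearProg_spec hb₁ hm₁ hi₁ him hpi hn.le hΛ h₁ hK
    (fun s₂ _ _ h h' => show _ ∧ _ from ⟨h, h'⟩)) fun s₂ hb₂ hf₂ h₂ => ?_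
  have hm₂ := hm₁.of_frame hf₂ rfl
  refine sumProg_spec hb₂ hm₂ hB (by rw [hf₂.reg 30 rfl, hi₁]) him hpi hn.le hΛ hnn hmΛ hBd
    (by rw [hf₂.reg 37 rfl, h₁]) hK h₂.1 fun s₃ hb₃ hf₃ h₃ h₃' => ⟨?_, fun x hx => ?_⟩
  · intro c hc
    have hcB : c ∈ assignments (B i) := mem_assignments.2 fun v hv =>
      mem_assignments.1 hc v fun h => hv (Finset.mem_inter.1 h).1
    rw [← image_digits] at hcB
    obtain ⟨k, hk, rfl⟩ := Finset.mem_image.1 hcB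
    have := h₃ k (Finset.mem_range.1 hk)
    rw [mask_eq_self hc] at this
    rw [tableFun, this, ZMod.natCast_mod, Nat.cast_sum, ← image_digits, Finset.filter_image,
      Finset.sum_image]
    · refine Finset.sum_congr rfl fun l _ => ?_
      rw [← termValue_congr hB h₃', termValue, Nat.cast_mul, Nat.cast_mul, Nat.cast_prod,
        Nat.cast_prod]
      congr 2
      exact natCast_localFactor _ _
    · intro a ha b hb hab
      exact digits_injOn (B i) (Finset.filter_subset _ _ ha) (Finset.filter_subset _ _ hb) hab
  · rw [h₃' x hx, h₂.2 x hx, hf₁.arr 12 rfl]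

/-- The dynamic program. -/
def treeProg : LP :=
  .loop false 39 12 <| .seq (.asg 30 (.reg 12 - .reg 39)) nodeProg

/-- The recurrence at `i` involves the tables of `i` and of its children only, all with numbers
above `j`. -/
theorem ModRecurrence.congr (hB : BagTree m B par) {i j : ℕ} {s' : State} (him : i ≤ m) (hj : j < i)
    (h : ModRecurrence G z E B par m Bd s i) (hs : ∀ x, x % (m + 1) ≠ j → s'.arr 12 x = s.arr 12 x) :
    ModRecurrence G z E B par m Bd s' i := by
  have hfun : ∀ k, j < k → k ≤ m → tableFun m Bd s' k = (tableFun m Bd s k : (Fin n → Fin 4) → _) := by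
    intro k hk hkm
    funext c
    unfold tableFun tableEntry
    rw [hs]
    rw [mod_of_table_index hkm]
    omega
  intro c hc
  rw [hfun i hj him, h c hc]
  refine Finset.sum_congr rfl fun b _ => congrArg _ (Finset.prod_congr rfl fun k hk => ?_)
  obtain ⟨h1, h2⟩ := Finset.mem_filter.1 hk
  rw [Finset.mem_Icc] at h1
  have := hB.par_lt k h1.1 h1.2
  rw [hfun k (by omega) h1.2]

/-- Bags are processed from the last to the first, so the tables of the children are complete when
they are read. At the end the root entry is the partition function modulo `Bd`, hence the partition
function itself. -/
theorem treeProg_spec (hs : s.Bdd Λ) (hm : TreeMem G z E B par m Bd s) (hB : BagTree m B par)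
    (hn : 2 * n < Λ) (hΛ : 2 ≤ Λ) (hnn : n * n ≤ Λ) (hmΛ : m + 1 ≤ Λ) (hBd : 1 < Bd)
    (hK : ∀ i ≤ m, 4 ^ (B i).card ≤ K) {R : Finset (Fin n)}
    (hR : (Finset.range (m + 1)).biUnion B = R)
    (hG : ∀ u ∈ R, ∀ v ∈ R, G.Adj u v → ∃ i ∈ Finset.Icc 1 m, u ∈ B i ∧ v ∈ B i)
    (hZ : partitionFunction G R z E < Bd)
    (hQ : ∀ s', s'.Bdd Λ → Frame treeProg s s' →
      s'.arr 12 1 % Bd = partitionFunction G R z E → Q s') :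
    Runs Λ K ω treeProg s Q := by
  refine Runs.loop (I := fun t s' => ∀ i, m - t < i → i ≤ m → ModRecurrence G z E B par m Bd s' i)
    hs hm.r12 (show m ≤ Λ by omega) rfl (fun t s' a h => h) (fun i h1 h2 => by omega) ?_
    (fun s' hb hf h => hQ s' hb hf ?_)
  · intro t ht s' hb hf hr hI
    have hm' := hm.of_frame hf rfl
    have ev : (Expr.reg 12 - .reg 39 : Expr).eval s' = m - t := by
      simp only [Expr.eval_sub, Expr.eval_reg, hr, hm'.r12]
    have hmlt : m < 2 ^ Λ := hm.r12 ▸ hs.reg 12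
    refine Runs.seq (Runs.asg (Q := fun s₁ => s₁.reg 30 = m - t) hb (by rw [ev]; omega)
      (by simp [ev])) fun s₁ hb₁ hf₁ h₁ => ?_
    have hm₁ := hm'.of_frame hf₁ rfl
    have hpar := hB.par_lt (m - t) (by omega) (by omega)
    refine nodeProg_spec hb₁ hm₁ hB h₁ (by omega) (by omega) hn hΛ hnn hmΛ hBd
      (hK _ (by omega)) fun s₂ hb₂ hf₂ h₂ h₂' => ?_
    intro i hi him
    by_cases h : i = m - t
    · subst h; exact h₂
    · refine (hI i (by omega) him).congr hB him (j := m - t) (by omega) fun x hx => ?_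
      rw [h₂' x hx, hf₁.arr 12 rfl]
  · have h1 := hB.eq_partitionFunction (z := z) (E := E) (g := tableFun m Bd s') hR hG
      (fun i h1 h2 => h i (by omega) h2)
    -- The root has an empty separator, so its only argument is the zero assignment, with code 0;
    -- its entry is at address 1.
    rw [tableFun, tableEntry, hcode_zero, zero_mul, zero_add,
      ZMod.natCast_eq_natCast_iff'] at h1
    rw [h1, Nat.mod_eq_of_lt hZ]

end Tree

/-! ### Parts and cheapest representatives at a prime node -/

section Representatives

set_option linter.unusedSectionVars false

variable {n : ℕ} {G : SimpleGraph (Fin n)} {M : Set (Fin n)}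

/-- Two vertices of `M` lie in the same part of the canonical partition of `G[M]`. -/
def SamePart (G : SimpleGraph (Fin n)) (M : Set (Fin n)) (u v : Fin n) : Prop :=
  ∃ (hu : u ∈ M) (hv : v ∈ M) (P : canonicalPartition (G.induce M)),
    (⟨u, hu⟩ : M) ∈ P.1 ∧ (⟨v, hv⟩ : M) ∈ P.1

/-- The proper modules of a graph with a prime quotient graph do not meet different parts. -/
theorem mem_of_isModule_of_prime {V : Type*} [Finite V] {G : SimpleGraph V}
    (hG : IsPrimeGraph (modularQuotient G)) {N : Set V} (hN : IsModule G N) (hN' : N ≠ Set.univ)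
    {u v : V} (hu : u ∈ N) (hv : v ∈ N) (P : canonicalPartition G) (huP : u ∈ P.1) : v ∈ P.1 := by
  have := nontrivial_of_prime hG
  by_contra hvP
  set Q := partOf G v with hQ
  have hvQ : v ∈ Q.1 := mem_partOf v
  have hPQ : P ≠ Q := fun h => hvP (h ▸ hvQ)
  -- Parts are strong, and `N` meets the two parts `P` and `Q`; so `N` is not contained in a part
  -- and contains every part that it meets.
  have hsub : ∀ A : canonicalPartition G, (A.1 ∩ N).Nonempty → A.1 ⊆ N := by
    intro A hA
    rcases A.2.1.1.2 N hN with h | h | h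
    · exact absurd h (Set.not_disjoint_iff_nonempty_inter.2 hA)
    · exact h
    · exact absurd ((canonicalPartition_eq_of_mem (h hu) huP).symm.trans
        (canonicalPartition_eq_of_mem (h hv) hvQ)) hPQ
  -- The parts inside `N` form a module of the prime quotient with at least two elements, hence all
  -- of it, and `N` would be everything.
  have hmod : IsModule (modularQuotient G) {A | A.1 ⊆ N} := by
    refine isModule_iff.2 fun A hA B hB C hC hAC => ?_
    obtain ⟨a, ha⟩ := canonicalPartition_nonempty A
    obtain ⟨b, hb⟩ := canonicalPartition_nonempty B
    obtain ⟨x, hx⟩ := canonicalPartition_nonempty C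
    have hxN : x ∉ N := fun h => hC (hsub C ⟨x, hx, h⟩)
    have hBC : B ≠ C := fun h => hC (h ▸ hB)
    rw [modularQuotient_adj_iff hAC.ne ha hx] at hAC
    rw [modularQuotient_adj_iff hBC hb hx]
    exact (hN.adj_iff (hA ha) (hB hb) hxN).1 hAC
  have hP : P ∈ {A : canonicalPartition G | A.1 ⊆ N} := hsub P ⟨u, huP, hu⟩
  have hQ' : Q ∈ {A : canonicalPartition G | A.1 ⊆ N} := hsub Q ⟨v, hvQ, hv⟩
  rcases hG.2 _ hmod with h | h | ⟨A, h⟩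
  · rw [h] at hP; exact hP
  · refine hN' (Set.eq_univ_of_forall fun x => ?_)
    have : partOf G x ∈ {A : canonicalPartition G | A.1 ⊆ N} := h ▸ Set.mem_univ _
    exact this (mem_partOf x)
  · rw [h] at hP hQ'
    exact hPQ (hP.trans hQ'.symm)

/-- If `S` is the closure of `v` under passing to vertices that distinguish a vertex from `u`, then
`S` together with `u` is the smallest module of `G[M]` that contains `u` and `v`. -/
theorem samePart_iff_exists (hM : IsPrimeGraph (modularQuotient (G.induce M))) {u v : Fin n}
    (hu : u ∈ M) (hv : v ∈ M) {S : Set (Fin n)} (hvS : v ∈ S)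
    (hclosed : ∀ y ∈ S, ∀ x ∈ M, ¬ (G.Adj y x ↔ G.Adj u x) → x ∈ S)
    (hmin : ∀ T : Set (Fin n), v ∈ T → (∀ y ∈ T, ∀ x ∈ M, ¬ (G.Adj y x ↔ G.Adj u x) → x ∈ T) → S ⊆ T) :
    SamePart G M u v ↔ ∃ x ∈ M, x ≠ u ∧ x ∉ S := by
  have := nontrivial_of_prime hM
  constructor
  · rintro ⟨_, _, P, huP, hvP⟩
    obtain ⟨x, hx⟩ := (Set.ne_univ_iff_exists_notMem _).1 (canonicalPartition_ne_univ P)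
    refine ⟨x, x.2, fun h => hx ?_, fun h => hx ?_⟩
    · convert huP
    -- A vertex outside `P` cannot distinguish two vertices of `P`, so the closure of `v` stays
    -- within `P`, and a vertex outside `P` is missed.
    · have := hmin (Subtype.val '' P.1) ⟨_, hvP, rfl⟩ (by
        rintro _ ⟨y, hy, rfl⟩ x hxM hne
        by_contra hxP
        refine hne ?_
        exact (canonicalPartition_isModule P).adj_iff (x := ⟨x, hxM⟩) hy huP
          fun h => hxP ⟨_, h, rfl⟩) h
      obtain ⟨y, hy, hyx⟩ := this
      rwa [Subtype.ext hyx] at hy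
  · rintro ⟨x, hx, hxu, hxS⟩
    refine ⟨hu, hv, partOf _ ⟨u, hu⟩, mem_partOf _, ?_⟩
    -- Every member agrees with `u` on the vertices outside, because a vertex on which it differs
    -- would have been added. A proper module of this kind forces `u` and `v` into one part.
    have hmod : IsModule (G.induce M) {y | y.1 = u ∨ y.1 ∈ S} := by
      have key : ∀ a : M, a.1 = u ∨ a.1 ∈ S → ∀ z : M, ¬ (z.1 = u ∨ z.1 ∈ S) →
          (G.Adj a z ↔ G.Adj u z) := by
        rintro a (ha | ha) z hz
        · rw [ha]
        · by_contra h
          exact hz (Or.inr (hclosed a ha z z.2 h))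
      exact isModule_iff.2 fun a ha b hb z hz h => (key b hb z hz).2 ((key a ha z hz).1 h)
    refine mem_of_isModule_of_prime hM hmod ?_ (Or.inl rfl) (Or.inr hvS) _ (mem_partOf _)
    intro h
    have : (⟨x, hx⟩ : M) ∈ {y : M | y.1 = u ∨ y.1 ∈ S} := h ▸ Set.mem_univ _
    exact this.elim hxu hxS

theorem exists_representative (c : Fin n → ℕ) (P : canonicalPartition (G.induce M)) :
    ∃ u : M, u ∈ P.1 ∧ ∀ v ∈ P.1, toLex (c u, u.1.1) ≤ toLex (c v, v.1.1) := by
  obtain ⟨u, hu, hmin⟩ := Set.exists_min_image P.1 (fun u : M => toLex (c u, u.1.1)) (Set.toFinite _)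
    (canonicalPartition_nonempty P)
  exact ⟨u, hu, hmin⟩

/-- The representative of a part: a cheapest vertex, the first one of these. -/
noncomputable def representative (c : Fin n → ℕ) (P : canonicalPartition (G.induce M)) : M :=
  (exists_representative c P).choose

theorem representative_spec (c : Fin n → ℕ) (P : canonicalPartition (G.induce M)) :
    representative c P ∈ P.1 ∧
      ∀ v ∈ P.1, toLex (c (representative c P), (representative c P).1.1) ≤ toLex (c v, v.1.1) :=
  (exists_representative c P).choose_spec

/-- The quotient graph as an induced subgraph. -/
noncomputable def representativeEmbedding (G : SimpleGraph (Fin n)) (M : Set (Fin n))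
    (c : Fin n → ℕ) : modularQuotient (G.induce M) ↪g G :=
  (quotientEmbedding (representative c) fun P => (representative_spec c P).1).trans
    (SimpleGraph.Embedding.induce M)

/-- The set of representatives. -/
noncomputable def representatives (G : SimpleGraph (Fin n)) (M : Set (Fin n)) (c : Fin n → ℕ) :
    Finset (Fin n) :=
  (Set.toFinite (Set.range (representativeEmbedding G M c))).toFinset

theorem mem_representatives {c : Fin n → ℕ} {v : Fin n} :
    v ∈ representatives G M c ↔ ∃ P, representativeEmbedding G M c P = v := by
  simp [representatives]

/-- Ties in cost are broken by the index of the vertex, which makes the choice computable by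
comparing pairs. The random weights need not enter: isolation is applied to solutions made of
representatives only. -/
theorem mem_representatives_iff (hM : IsPrimeGraph (modularQuotient (G.induce M)))
    {c : Fin n → ℕ} {u : Fin n} : u ∈ representatives G M c ↔
      u ∈ M ∧ ∀ v ∈ M, u ≠ v → (c v < c u ∨ c v = c u ∧ v < u) → ¬ SamePart G M u v := by
  have := nontrivial_of_prime hM
  rw [mem_representatives]
  constructor
  · rintro ⟨P, rfl⟩
    refine ⟨(representative c P).2, fun v hv hne hlt hsame => ?_⟩
    obtain ⟨h1, h2, Q, hQ1, hQ2⟩ := hsame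
    obtain rfl := canonicalPartition_eq_of_mem (representative_spec c P).1 hQ1
    have := (representative_spec c P).2 _ hQ2
    rw [Prod.Lex.toLex_le_toLex] at this
    change c v < c (representative c P) ∨ c v = c (representative c P) ∧
      v < (representative c P).1 at hlt
    rw [Fin.lt_def] at hlt
    simp only at this
    omega
  · rintro ⟨hu, h⟩
    refine ⟨partOf _ ⟨u, hu⟩, ?_⟩
    set P := partOf (G.induce M) ⟨u, hu⟩ with hP
    by_contra hne
    have h1 := (representative_spec c P).2 _ (mem_partOf (G := G.induce M) ⟨u, hu⟩)
    refine h (representative c P) (representative c P).2 (fun h => hne h.symm) ?_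
      ⟨hu, (representative c P).2, P, mem_partOf _, (representative_spec c P).1⟩
    rw [Prod.Lex.toLex_le_toLex] at h1
    have h2 : (representative c P).1.1 ≠ u.1 := fun h => hne (Fin.ext h)
    rw [Fin.lt_def]
    simp only at h1
    omega

theorem representatives_nonempty (hM : IsPrimeGraph (modularQuotient (G.induce M)))
    (c : Fin n → ℕ) : (representatives G M c).Nonempty := by
  obtain ⟨u, -⟩ := (nontrivial_of_prime hM).exists_pair_ne
  have := nontrivial_of_prime hM
  exact ⟨_, mem_representatives.2 ⟨partOf _ u, rfl⟩⟩

/-- The representatives of the parts in a bag of a tree decomposition. -/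
noncomputable def representativeBag (c : Fin n → ℕ)
    (D : TreeDecomposition (modularQuotient (G.induce M))) (t : ℕ) : Finset (Fin n) :=
  if h : t < D.size then (D.bag ⟨t, h⟩).map (representativeEmbedding G M c).toEmbedding else ∅

/-- The input lists for each bag the union of its parts. Intersecting with the representatives
recovers one vertex per part, hence a bag of the original size. -/
theorem mem_representativeBag {c : Fin n → ℕ} {D : TreeDecomposition (modularQuotient (G.induce M))}
    {t : ℕ} (ht : t < D.size) {v : Fin n} : v ∈ representativeBag c D t ↔
      v ∈ representatives G M c ∧ ∃ h : v ∈ M, ∃ P ∈ D.bag ⟨t, ht⟩, (⟨v, h⟩ : M) ∈ P.1 := by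
  rw [representativeBag, dif_pos ht, mem_representatives]
  simp only [Finset.mem_map]
  constructor
  · rintro ⟨P, hP, rfl⟩
    exact ⟨⟨P, rfl⟩, (representative c P).2, P, hP, (representative_spec c P).1⟩
  · rintro ⟨⟨P, rfl⟩, h, Q, hQ, hPQ⟩
    obtain rfl := canonicalPartition_eq_of_mem (representative_spec c P).1 hPQ
    exact ⟨P, hQ, rfl⟩

end Representatives

/-! ### From a tree decomposition and a search of its tree to a sequence of bags -/

section Positions

variable {n : ℕ} {G : SimpleGraph (Fin n)} {M : Set (Fin n)} {c : Fin n → ℕ}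
  {D : TreeDecomposition (modularQuotient (G.induce M))}
  {E : ℕ → ℕ} {S ord pos par : ℕ → ℕ} {cnt : ℕ}

/-- The bags in the order of discovery, preceded by an empty bag. -/
noncomputable def orderedBag (c : Fin n → ℕ) (D : TreeDecomposition (modularQuotient (G.induce M)))
    (ord : ℕ → ℕ) (i : ℕ) : Finset (Fin n) :=
  if i = 0 then ∅ else representativeBag c D (ord i)

/-- `E` is the adjacency matrix of the graph `T`. -/
def IsMatrixOf {N : ℕ} (T : SimpleGraph (Fin N)) (E : ℕ → ℕ) : Prop :=
  ∀ a (ha : a < N) b (hb : b < N), E (a * N + b) ≠ 0 ↔ T.Adj ⟨a, ha⟩ ⟨b, hb⟩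

theorem card_orderedBag_le {k : ℕ} (hD : D.WidthAtMost k) (i : ℕ) :
    (orderedBag c D ord i).card ≤ k + 1 := by
  unfold orderedBag representativeBag
  split
  · simp
  · split
    · rw [Finset.card_map]; exact hD _
    · simp

namespace SearchInv

/-- A closed set that contains the start vertex has no edge leaving it. -/
theorem eq_one_of_connected {N x : ℕ} {T : SimpleGraph (Fin N)} (hT : T.Connected) (hx : x < N)
    (hE : IsMatrixOf T E) (h : SearchInv N E x S ord pos par cnt) (hc : SearchClosed N E S)
    (b : ℕ) (hb : b < N) : S b = 1 := by
  by_contra hne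
  have hSx : S x = 1 := by
    have := h.of_ord 1 le_rfl h.cnt_pos
    rw [h.ord_one] at this
    exact this.2.1
  obtain ⟨a, ha, d, hd, had⟩ := exists_adj_of_connected hT (S := {a | S a = 1}) (u := ⟨x, hx⟩)
    (v := ⟨b, hb⟩) hSx hne
  exact hd (hc a a.2 d d.2 ha ((hE a a.2 d d.2).2 had))

theorem cnt_eq {N x : ℕ} {T : SimpleGraph (Fin N)} (hT : T.Connected) (hx : x < N)
    (hE : IsMatrixOf T E) (h : SearchInv N E x S ord pos par cnt) (hc : SearchClosed N E S) :
    cnt = N := by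
  refine le_antisymm h.cnt_le ?_
  have hS := h.eq_one_of_connected hT hx hE hc
  have := Finset.card_le_card_of_injOn (s := Finset.range N) (t := Finset.Icc 1 cnt) pos
    (fun b hb => by
      have := h.of_pos b (Finset.mem_range.1 hb) (hS b (Finset.mem_range.1 hb))
      simp [this])
    (fun a ha b hb hab => by
      have ha := Finset.mem_range.1 ha
      have hb := Finset.mem_range.1 hb
      rw [← (h.of_pos a ha (hS a ha)).2.2, hab, (h.of_pos b hb (hS b hb)).2.2])
  simpa using this

/-- The search of a tree passes through all its edges. -/
theorem eq_par_of_adj {N x : ℕ} {T : SimpleGraph (Fin N)} (hT : T.IsTree) (hx : x < N)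
    (hE : IsMatrixOf T E) (h : SearchInv N E x S ord pos par cnt) (hc : SearchClosed N E S)
    {a b : Fin N} (hab : T.Adj a b) :
    2 ≤ pos a ∧ pos b = par (pos a) ∨ 2 ≤ pos b ∧ pos a = par (pos b) := by
  classical
  have hN := h.cnt_eq hT.connected hx hE hc
  subst hN
  have hpar : ∀ i, 2 ≤ i → i ≤ cnt → 1 ≤ par i ∧ par i ≤ cnt := fun i h1 h2 => by
    have := h.of_par i h1 h2
    omega
  let V : ℕ → Fin cnt := fun i => if hi : ord i < cnt then ⟨ord i, hi⟩ else ⟨x, hx⟩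
  have hV : ∀ i, 1 ≤ i → i ≤ cnt → (V i : ℕ) = ord i := fun i h1 h2 => by
    simp [V, (h.of_ord i h1 h2).1]
  have hVpos : ∀ i, 1 ≤ i → i ≤ cnt → pos (V i) = i := fun i h1 h2 => by
    rw [hV i h1 h2, (h.of_ord i h1 h2).2.2]
  let f : ℕ → Sym2 (Fin cnt) := fun i => s(V i, V (par i))
  -- The search gives one edge for every vertex except the first, and these are distinct because
  -- parents precede children. A tree has no further edges.
  have hf : (Finset.Icc 2 cnt).image f = T.edgeFinset := by
    refine Finset.eq_of_subset_of_card_le ?_ ?_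
    · intro e he
      obtain ⟨i, hi, rfl⟩ := Finset.mem_image.1 he
      rw [Finset.mem_Icc] at hi
      have h1 := h.of_par i hi.1 hi.2
      have h2 := hpar i hi.1 hi.2
      rw [SimpleGraph.mem_edgeFinset, SimpleGraph.mem_edgeSet]
      refine ((hE _ (V (par i)).2 _ (V i).2).1 ?_).symm
      rw [hV i (by omega) hi.2, hV (par i) h2.1 h2.2]
      exact h1.2.2
    · rw [Finset.card_image_of_injOn]
      · have := hT.card_edgeFinset
        rw [Fintype.card_fin] at this
        simp only [Nat.card_Icc]
        omega
      · intro i hi j hj hij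
        simp only [Finset.coe_Icc, Set.mem_Icc] at hi hj
        have h1 := h.of_par i hi.1 hi.2
        have h2 := h.of_par j hj.1 hj.2
        rcases Sym2.eq_iff.1 hij with ⟨e, -⟩ | ⟨e1, e2⟩
        · rw [← hVpos i (by omega) hi.2, e, hVpos j (by omega) hj.2]
        · have e1 := congrArg (fun t : Fin cnt => pos t) e1
          have e2 := congrArg (fun t : Fin cnt => pos t) e2
          rw [hVpos i (by omega) hi.2, hVpos (par j) (by omega) (by omega)] at e1
          rw [hVpos j (by omega) hj.2, hVpos (par i) (by omega) (by omega)] at e2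
          omega
  have : s(a, b) ∈ (Finset.Icc 2 cnt).image f := by
    rw [hf]; simpa using hab
  obtain ⟨i, hi, hi'⟩ := Finset.mem_image.1 this
  rw [Finset.mem_Icc] at hi
  have h2 := hpar i hi.1 hi.2
  rcases Sym2.eq_iff.1 hi' with ⟨e1, e2⟩ | ⟨e1, e2⟩
  · rw [← e1, ← e2, hVpos i (by omega) hi.2, hVpos _ h2.1 h2.2]
    exact Or.inl ⟨hi.1, rfl⟩
  · rw [← e1, ← e2, hVpos i (by omega) hi.2, hVpos _ h2.1 h2.2]
    exact Or.inr ⟨hi.1, rfl⟩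

/-- The crucial condition is `mem_par`. If a part occurs in bag `i` and in an earlier bag, then,
since the bags containing it form a subtree, the edge from `i` to its parent must belong to that
subtree. -/
theorem bagTree (h0 : 0 < D.size) (hE : IsMatrixOf D.tree E)
    (h : SearchInv D.size E 0 S ord pos par cnt) (hc : SearchClosed D.size E S) :
    BagTree D.size (orderedBag c D ord) par where
  pos := h0
  bag_zero := by simp [orderedBag]
  par_one := h.par_one
  par_pos i h1 h2 := (h.of_par i h1 (by rwa [h.cnt_eq D.isTree.connected h0 hE hc])).1
  par_lt i h1 h2 := by
    rcases Nat.lt_or_ge i 2 with h3 | h3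
    · obtain rfl : i = 1 := by omega
      rw [h.par_one]; omega
    · exact (h.of_par i h3 (by rwa [h.cnt_eq D.isTree.connected h0 hE hc])).2.1
  mem_par i h1 h2 j hj v hvi hvj := by
    have hN := h.cnt_eq D.isTree.connected h0 hE hc
    have hj0 : j ≠ 0 := by
      rintro rfl
      simp [orderedBag] at hvj
    have hi := h.of_ord i h1 (by omega)
    have hj' := h.of_ord j (by omega) (by omega)
    have hp := h.of_par i (by omega) (by omega)
    have hpo := h.of_ord (par i) hp.1 (by omega)
    rw [orderedBag, if_neg (by omega), representativeBag, dif_pos hi.1] at hvi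
    rw [orderedBag, if_neg (by omega), representativeBag, dif_pos hj'.1] at hvj
    rw [orderedBag, if_neg (by omega), representativeBag, dif_pos hpo.1]
    obtain ⟨P, hP, rfl⟩ := Finset.mem_map.1 hvi
    rw [Finset.mem_map' ] at hvj ⊢
    -- The bags containing `P` that are descendants of position `i`. The earlier bag `j` is not
    -- among them, so some tree edge leaves `W` within the subtree of `P`, and the only edge leaving
    -- the descendants of `i` goes to its parent.
    let W : Set {t | P ∈ D.bag t} := {t | Relation.ReflTransGen
      (fun a b => a = par b ∧ 2 ≤ b ∧ b ≤ D.size) i (pos t.1)}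
    have hge : ∀ k, Relation.ReflTransGen
        (fun a b => a = par b ∧ 2 ≤ b ∧ b ≤ D.size) i k → i ≤ k := by
      intro k hk
      induction hk with
      | refl => rfl
      | tail _ hbc ih =>
        have := h.of_par _ hbc.2.1 (by omega)
        omega
    obtain ⟨a, ha, b, hb, hab⟩ := exists_adj_of_connected (D.connected P) (S := W)
      (u := ⟨⟨ord i, hi.1⟩, hP⟩) (v := ⟨⟨ord j, hj'.1⟩, hvj⟩)
      (by
        change Relation.ReflTransGen _ i (pos (ord i))
        rw [hi.2.2])
      (fun hmem => by
        have := hge _ hmem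
        simp only [hj'.2.2] at this
        omega)
    have hS := h.eq_one_of_connected D.isTree.connected h0 hE hc
    have hpa := h.of_pos a.1 a.1.2 (hS _ a.1.2)
    have hpb := h.of_pos b.1 b.1.2 (hS _ b.1.2)
    rcases h.eq_par_of_adj D.isTree h0 hE hc (show D.tree.Adj a.1 b.1 from hab) with
      ⟨h2a, hba⟩ | ⟨h2b, hba⟩
    · rcases Relation.ReflTransGen.cases_tail ha with he | ⟨k, hk, hka⟩
      · have hbP : P ∈ D.bag b.1 := b.2
        have : b.1 = ⟨ord (par i), hpo.1⟩ := Fin.ext (by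
          change (b.1 : ℕ) = ord (par i)
          rw [← hpb.2.2, hba, he])
        rwa [this] at hbP
      · refine absurd ?_ hb
        change Relation.ReflTransGen _ i (pos b.1)
        rw [hba, ← hka.1]
        exact hk
    · refine absurd ?_ hb
      exact Relation.ReflTransGen.tail ha ⟨hba, h2b, by omega⟩

theorem biUnion_orderedBag (h0 : 0 < D.size) (hE : IsMatrixOf D.tree E)
    (h : SearchInv D.size E 0 S ord pos par cnt) (hc : SearchClosed D.size E S) :
    (Finset.range (D.size + 1)).biUnion (orderedBag c D ord) = representatives G M c := by
  have hN := h.cnt_eq D.isTree.connected h0 hE hc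
  have hS := h.eq_one_of_connected D.isTree.connected h0 hE hc
  ext v
  rw [Finset.mem_biUnion]
  constructor
  · rintro ⟨i, hi, hv⟩
    unfold orderedBag at hv
    split at hv
    · simp at hv
    · have := Finset.mem_range.1 hi
      exact ((mem_representativeBag (h.of_ord i (by omega) (by omega)).1).1 hv).1
  · intro hv
    obtain ⟨P, rfl⟩ := mem_representatives.1 hv
    obtain ⟨t, ht⟩ := D.vertex_mem P
    have hp := h.of_pos t t.2 (hS t t.2)
    refine ⟨pos t, Finset.mem_range.2 (by omega), ?_⟩
    rw [orderedBag, if_neg (by omega), hp.2.2, representativeBag, dif_pos t.2]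
    exact Finset.mem_map_of_mem _ ht

theorem exists_orderedBag (h0 : 0 < D.size) (hE : IsMatrixOf D.tree E)
    (h : SearchInv D.size E 0 S ord pos par cnt) (hc : SearchClosed D.size E S) {u v : Fin n}
    (hu : u ∈ representatives G M c) (hv : v ∈ representatives G M c) (huv : G.Adj u v) :
    ∃ i ∈ Finset.Icc 1 D.size, u ∈ orderedBag c D ord i ∧ v ∈ orderedBag c D ord i := by
  have hN := h.cnt_eq D.isTree.connected h0 hE hc
  have hS := h.eq_one_of_connected D.isTree.connected h0 hE hc
  obtain ⟨P, rfl⟩ := mem_representatives.1 hu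
  obtain ⟨P', rfl⟩ := mem_representatives.1 hv
  obtain ⟨t, ht, ht'⟩ := D.edge_mem P P' ((representativeEmbedding G M c).map_adj_iff.1 huv)
  have hp := h.of_pos t t.2 (hS t t.2)
  refine ⟨pos t, Finset.mem_Icc.2 (by omega), ?_⟩
  rw [orderedBag, if_neg (by omega), hp.2.2, representativeBag, dif_pos t.2]
  exact ⟨Finset.mem_map_of_mem _ ht, Finset.mem_map_of_mem _ ht'⟩

end SearchInv

end Positions

/-! ### What the computed numbers say about solutions -/

section Acceptance

variable {n : ℕ} {G : SimpleGraph (Fin n)} {M : Set (Fin n)} {c w : Fin n → ℕ} {l : ℕ} {b : ℤ}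

/-- The base in which cost and weight are combined to one number. -/
def weightBase (n l : ℕ) : ℕ := n * 2 ^ l + 1

/-- Cost and weight of a vertex as one number. -/
def combinedWeight (c w : Fin n → ℕ) (l : ℕ) (v : Fin n) : ℕ := c v * weightBase n l + w v

/-- The answer of the algorithm for the node `M` and the weights `w`. -/
def NodeAccepts (G : SimpleGraph (Fin n)) (c : Fin n → ℕ) (b : ℤ) (w : Fin n → ℕ) (l : ℕ)
    (M : Set (Fin n)) : Prop :=
  (∀ u ∈ M, ∀ v ∉ M, G.Adj u v) ∧
    ∃ i < ∑ v, combinedWeight c w l v + 1,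
      partitionFunction G (representatives G M c) (16 ^ n) (combinedWeight c w l) / (16 ^ n) ^ i % 4
        = 2 ∧ ((i / weightBase n l : ℕ) : ℤ) ≤ b

/-- The cheapest connected dominating sets of the graph on the representatives. -/
def optimumOnRepresentatives (G : SimpleGraph (Fin n)) (M : Set (Fin n)) (c : Fin n → ℕ) :
    Set (Finset (Fin n)) :=
  {X | IsCDSOn G (representatives G M c) X ∧
    ∀ Y, IsCDSOn G (representatives G M c) Y → ∑ v ∈ X, c v ≤ ∑ v ∈ Y, c v}

theorem sum_combinedWeight (X : Finset (Fin n)) : ∑ v ∈ X, combinedWeight c w l v =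
    (∑ v ∈ X, c v) * weightBase n l + ∑ v ∈ X, w v := by
  simp only [combinedWeight, Finset.sum_add_distrib, Finset.sum_mul]

theorem sum_weight_lt (hw : ∀ v, w v < 2 ^ l) (X : Finset (Fin n)) :
    ∑ v ∈ X, w v < weightBase n l := by
  have h1 : ∑ v ∈ X, w v ≤ X.card * 2 ^ l := by
    simpa using Finset.sum_le_card_nsmul X w (2 ^ l) fun v _ => (hw v).le
  have h2 : X.card * 2 ^ l ≤ n * 2 ^ l := Nat.mul_le_mul_right _ (card_finset_fin_le X)
  unfold weightBase
  omega

/-- The base exceeds every possible total weight, so division by it recovers the cost exactly. -/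
theorem sum_combinedWeight_div (hw : ∀ v, w v < 2 ^ l) (X : Finset (Fin n)) :
    (∑ v ∈ X, combinedWeight c w l v) / weightBase n l = ∑ v ∈ X, c v := by
  rw [sum_combinedWeight, mul_comm, Nat.mul_add_div (by unfold weightBase; omega),
    Nat.div_eq_of_lt (sum_weight_lt hw X), add_zero]

theorem twelve_pow_lt (hn : 0 < n) (R : Finset (Fin n)) : 12 ^ R.card < 16 ^ n :=
  calc 12 ^ R.card ≤ 12 ^ n := Nat.pow_le_pow_right (by norm_num) (card_finset_fin_le R)
    _ < 16 ^ n := Nat.pow_lt_pow_left (by norm_num) hn.ne'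

theorem four_dvd_pow (hn : 0 < n) : 4 ∣ 16 ^ n :=
  (show 4 ∣ 16 by norm_num).trans (dvd_pow_self 16 hn.ne')

/-- The graph on the representatives and the quotient graph. -/
theorem isCDSOn_representatives_iff {X : Finset (Fin n)} :
    IsCDSOn G (representatives G M c) X ↔ ∃ Y, IsCDS (modularQuotient (G.induce M)) Y ∧
      Y.map (representativeEmbedding G M c).toEmbedding = X := by
  classical
  constructor
  · intro h
    have : ∃ Y : Finset (canonicalPartition (G.induce M)),
        Y.map (representativeEmbedding G M c).toEmbedding = X := by
      refine ⟨X.preimage (representativeEmbedding G M c)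
        (representativeEmbedding G M c).injective.injOn, ?_⟩
      ext v
      simp only [Finset.mem_map, Finset.mem_preimage]
      refine ⟨?_, fun hv => ?_⟩
      · rintro ⟨P, hP, rfl⟩; exact hP
      · obtain ⟨P, rfl⟩ := mem_representatives.1 (h.1 hv)
        exact ⟨P, hv, rfl⟩
    obtain ⟨Y, rfl⟩ := this
    exact ⟨Y, (isCDS_iff_isCDSOn _ (fun v => mem_representatives) Y).2 h, rfl⟩
  · rintro ⟨Y, hY, rfl⟩
    exact (isCDS_iff_isCDSOn _ (fun v => mem_representatives) Y).1 hY

/-- No assumption on the coins beyond the size of the weights: a digit 2 requires at least one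
solution on the representatives, its exponent gives the cost, and it lifts first to `G[M]` and then,
as `M` is joined to the rest, to `G`. -/
theorem NodeAccepts.hasCDS (hn : 0 < n) (hM : IsPrimeGraph (modularQuotient (G.induce M)))
    (hw : ∀ v, w v < 2 ^ l) (h : NodeAccepts G c b w l M) : HasCDS G c b := by
  obtain ⟨hj, i, -, hZ, hi⟩ := h
  rw [partitionFunction_div_mod (representatives_nonempty hM c) (four_dvd_pow hn)
    (twelve_pow_lt hn _)] at hZ
  have hne : {X : Finset (Fin n) | IsCDSOn G (representatives G M c) X ∧
      ∑ v ∈ X, combinedWeight c w l v = i}.Nonempty := by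
    rw [Set.nonempty_iff_ne_empty]
    intro h
    rw [h, Set.ncard_empty] at hZ
    simp at hZ
  obtain ⟨X, hX, rfl⟩ := hne
  rw [sum_combinedWeight_div hw] at hi
  obtain ⟨Y, hY, rfl⟩ := isCDSOn_representatives_iff.1 hX
  refine HasCDS.of_induce hj ⟨_, IsCDS.map_quotient hM (representative c)
    (fun P => (representative_spec c P).1) hY, ?_⟩
  rw [Finset.sum_map] at hi
  rw [sum_map_quotientEmbedding (c := fun v : M => c v)]
  exact hi

/-- Pass to an optimum, project it to the quotient, and replace every part by its representative.
The tie-breaking index plays the role of the weight in `sum_projection`. -/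
theorem exists_isCDSOn_representatives (hM : IsPrimeGraph (modularQuotient (G.induce M)))
    (hc : ∀ v, 0 < c v) (h : HasCDS (G.induce M) (fun v => c v) b) :
    ∃ X, IsCDSOn G (representatives G M c) X ∧ ((∑ v ∈ X, c v : ℕ) : ℤ) ≤ b := by
  obtain ⟨X, hX, hb⟩ := h
  obtain ⟨X', hX', hle⟩ := exists_mem_optimumCDS (c := fun v : M => c v) hX
  have h1 := (sum_projection hM (fun v => hc v) (w := fun v : M => v.1.1)
    (representative_spec c) hX').1
  refine ⟨_, isCDSOn_representatives_iff.2 ⟨_, IsCDS.projection hM hX'.1, rfl⟩, ?_⟩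
  rw [Finset.sum_map]
  refine le_trans ?_ hb
  exact_mod_cast h1.le.trans hle

theorem optimumOnRepresentatives_nonempty {X : Finset (Fin n)}
    (hX : IsCDSOn G (representatives G M c) X) :
    ∃ Y ∈ optimumOnRepresentatives G M c, ∑ v ∈ Y, c v ≤ ∑ v ∈ X, c v := by
  obtain ⟨Y, hY, hmin⟩ := (measure fun X : Finset (Fin n) => ∑ v ∈ X, c v).wf.has_min
    {X | IsCDSOn G (representatives G M c) X} ⟨X, hX⟩
  exact ⟨Y, ⟨hY, fun Z hZ => not_lt.1 (hmin Z hZ)⟩, not_lt.1 (hmin X hX)⟩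

/-- A solution with the same combined weight as the isolated one has the same cost and the same
weight, hence is equal to it. So the coefficient counts exactly one solution. -/
theorem NodeAccepts.of_isolates (hn : 0 < n) (hM : IsPrimeGraph (modularQuotient (G.induce M)))
    (hj : ∀ u ∈ M, ∀ v ∉ M, G.Adj u v) (hw : ∀ v, w v < 2 ^ l) {X : Finset (Fin n)}
    (hX : IsCDSOn G (representatives G M c) X) (hb : ((∑ v ∈ X, c v : ℕ) : ℤ) ≤ b)
    (hiso : Isolates w (optimumOnRepresentatives G M c)) : NodeAccepts G c b w l M := by
  obtain ⟨S, ⟨hS, hSmin⟩, huniq⟩ := hiso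
  refine ⟨hj, ∑ v ∈ S, combinedWeight c w l v,
    Nat.lt_succ_of_le (Finset.sum_le_sum_of_subset (Finset.subset_univ S)), ?_, ?_⟩
  · rw [partitionFunction_div_mod (representatives_nonempty hM c) (four_dvd_pow hn)
      (twelve_pow_lt hn _)]
    have : {X : Finset (Fin n) | IsCDSOn G (representatives G M c) X ∧
        ∑ v ∈ X, combinedWeight c w l v = ∑ v ∈ S, combinedWeight c w l v} = {S} := by
      ext T
      refine ⟨fun ⟨hT, hTE⟩ => ?_, fun h => ?_⟩
      · have hcost : ∑ v ∈ T, c v = ∑ v ∈ S, c v := by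
          rw [← sum_combinedWeight_div hw T, hTE, sum_combinedWeight_div hw S]
        have hweight : ∑ v ∈ T, w v = ∑ v ∈ S, w v := by
          rw [sum_combinedWeight, sum_combinedWeight, hcost] at hTE
          exact Nat.add_left_cancel hTE
        exact huniq T ⟨⟨hT, fun Y hY => hcost ▸ hS.2 Y hY⟩, fun Y hY => hweight ▸ hSmin Y hY⟩
      · rw [h]
        exact ⟨hS.1, rfl⟩
    rw [this, Set.ncard_singleton]
  · rw [sum_combinedWeight_div hw]
    refine le_trans ?_ hb
    exact_mod_cast hS.2 X hX

end Acceptance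

/-- The pair `u`, `v` is a connected dominating set of cost at most `b`. -/
def PairAccepts {n : ℕ} (G : SimpleGraph (Fin n)) (c : Fin n → ℕ) (b : ℤ) (u v : Fin n) : Prop :=
  (u = v ∨ G.Adj u v) ∧ (∀ x, x = u ∨ x = v ∨ G.Adj u x ∨ G.Adj v x) ∧
    ((c u + (if u = v then 0 else c v) : ℕ) : ℤ) ≤ b

theorem PairAccepts.hasCDS {n : ℕ} {G : SimpleGraph (Fin n)} {c : Fin n → ℕ} {b : ℤ} {u v : Fin n}
    (h : PairAccepts G c b u v) : HasCDS G c b := by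
  refine ⟨{u, v}, isCDS_pair h.1 h.2.1, ?_⟩
  have := h.2.2
  split at this
  · next huv => subst huv; simpa using this
  · next huv => rwa [Finset.sum_pair huv]

/-- The answer of the algorithm for the weights `w`. -/
def Input.Answer (I : Input) (w : Fin I.n → ℕ) (l : ℕ) : Prop :=
  (∃ u v, PairAccepts I.graph I.cost I.budget u v) ∨
    ∃ D ∈ I.decs, NodeAccepts I.graph I.cost I.budget w l D.1.1

theorem Input.Answer.hasCDS {I : Input} {w : Fin I.n → ℕ} {l : ℕ} (hw : ∀ v, w v < 2 ^ l)
    (h : I.Answer w l) : HasCDS I.graph I.cost I.budget := by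
  rcases h with ⟨u, v, h⟩ | ⟨D, -, h⟩
  · exact h.hasCDS
  · exact h.hasCDS I.pos D.1.2.2 hw

/-- Pairs are found without luck. Otherwise some joined prime node has a solution; it occurs in the
list of decompositions, and failure there implies failure of isolation for this one family. -/
theorem Input.coinMeasure_not_answer_le {I : Input} (h : HasCDS I.graph I.cost I.budget) {l : ℕ}
    (hl : 2 * I.n ≤ 2 ^ l) :
    coinMeasure {ω | ¬ I.Answer (coinWeight ω l) l} ≤ 1 / 2 := by
  rcases h.exists_pair_or_prime with ⟨u, v, h⟩ | ⟨M, hM, hj, h⟩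
  · have : {ω | ¬ I.Answer (coinWeight ω l) l} = ∅ :=
      Set.eq_empty_of_forall_notMem fun ω hω => hω (Or.inl ⟨u, v, h⟩)
    rw [this]
    simp
  · obtain ⟨X, hX, hb⟩ := exists_isCDSOn_representatives hM.2 I.cost_pos h
    obtain ⟨Y, hY, -⟩ := optimumOnRepresentatives_nonempty hX
    refine (MeasureTheory.measure_mono fun ω hω => ?_).trans
      (coinMeasure_not_isolates_le (F := optimumOnRepresentatives I.graph M I.cost) ⟨Y, hY⟩ hl)
    intro hiso
    obtain ⟨D, hD, hDM⟩ := I.complete ⟨M, hM⟩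
    refine hω (Or.inr ⟨D, hD, ?_⟩)
    rw [hDM]
    exact .of_isolates I.pos hM.2 hj (fun v => bitsValue_lt _ _ _) hX hb hiso

/-! ### Truth values -/

open Classical in
/-- The truth value of a proposition as a number. -/
noncomputable def ind (p : Prop) : ℕ := if p then 1 else 0

section Ind

variable {p q : Prop}

@[simp] theorem ind_ne_zero : ind p ≠ 0 ↔ p := by unfold ind; split <;> simp_all

@[simp] theorem ind_eq_zero : ind p = 0 ↔ ¬ p := by unfold ind; split <;> simp_all

@[simp] theorem ind_pos : 0 < ind p ↔ p := by unfold ind; split <;> simp_all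

@[simp] theorem ind_eq_one : ind p = 1 ↔ p := by unfold ind; split <;> simp_all

theorem ind_le_one : ind p ≤ 1 := by unfold ind; split <;> simp

theorem ind_lt {Λ : ℕ} (hΛ : 0 < Λ) : ind p < 2 ^ Λ :=
  (Nat.lt_succ_of_le ind_le_one).trans_le (by simpa using Nat.pow_le_pow_right (n := 2) (by norm_num) hΛ)

theorem ind_mul : ind p * ind q = ind (p ∧ q) := by
  unfold ind; split <;> split <;> simp_all

theorem one_sub_ind : 1 - ind p = ind ¬ p := by
  unfold ind; split <;> simp_all

theorem ite_eq_ind [Decidable p] : (if p then 1 else 0 : ℕ) = ind p := by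
  unfold ind; split <;> simp_all

theorem Expr.eval_lt_ind (a b : Expr) (s : State) :
    (Expr.lt a b).eval s = ind (a.eval s < b.eval s) := by
  rw [Expr.eval_lt, ite_eq_ind]

theorem Expr.eval_eq_ind (a b : Expr) (s : State) :
    (Expr.eq a b).eval s = ind (a.eval s = b.eval s) := by
  rw [Expr.eval_eq, ite_eq_ind]

theorem ind_inj : (ind p = ind q) = (p ↔ q) := by
  unfold ind; split <;> split <;> simp_all

theorem ind_true (h : p) : ind p = 1 := ind_eq_one.2 h

theorem ind_congr (h : p ↔ q) : ind p = ind q := by rw [propext h]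

end Ind

/-! ### Loops that evaluate bounded quantifiers -/

section Rules

variable {Λ K : ℕ} {ω : ℕ → Bool} {s : State} {Q : State → Prop}

/-- Loops that count how often a condition holds. -/
theorem Runs.any {r rb acc N : ℕ} {e : Expr} (p : ℕ → Prop) (hs : s.Bdd Λ)
    (hN : s.reg rb = N) (hNb : N ≤ Λ) (hwf : ((r == acc) || (rb == acc) || r == rb) = false)
    (h0 : s.reg acc = 0)
    (hstep : ∀ i < N, ∀ s', s'.arr = s.arr → s'.reg r = i → (∀ x, x ≠ r → x ≠ acc → s'.reg x = s.reg x) →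
      e.eval s' = ind (p i))
    (hQ : ∀ s', s'.Bdd Λ → Frame (.loop false r rb (.asg acc (.reg acc + e))) s s' →
      (s'.reg acc ≠ 0 ↔ ∃ i < N, p i) → Q s') :
    Runs Λ K ω (.loop false r rb (.asg acc (.reg acc + e))) s Q := by
  have hle : ∀ i, ∑ j ∈ Finset.range i, ind (p j) ≤ i := fun i => by
    simpa using Finset.sum_le_card_nsmul (Finset.range i) (fun j => ind (p j)) 1 fun j _ => ind_le_one
  have hlt : Λ < 2 ^ Λ := Nat.lt_two_pow_self
  have hne := hwf
  simp only [Bool.or_eq_false_iff, beq_eq_false_iff_ne] at hne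
  refine Runs.fold (F := fun i => ∑ j ∈ Finset.range i, ind (p j)) hs hN hNb hwf (by simpa using h0)
    (fun i hi => ⟨?_, ?_⟩) (fun s' hb hf h => hQ s' hb hf ?_)
  · rw [Expr.eval_add, hstep i hi ((s.setReg acc _).setReg r i) rfl (by simp) (fun x h1 h2 => by simp [h1, h2]),
      Finset.sum_range_succ]
    simp [Ne.symm hne.1.1]
  · have := hle (i + 1)
    omega
  · rw [h, Ne, Finset.sum_eq_zero_iff]
    simp

/-- Loops that test whether a condition always holds. -/
theorem Runs.all {r rb acc N : ℕ} {e : Expr} {p₀ : Prop} (p : ℕ → Prop) (hs : s.Bdd Λ)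
    (hN : s.reg rb = N) (hNb : N ≤ Λ) (hΛ : 0 < Λ)
    (hwf : ((r == acc) || (rb == acc) || r == rb) = false) (h0 : s.reg acc = ind p₀)
    (hstep : ∀ i < N, ∀ s', s'.arr = s.arr → s'.reg r = i → (∀ x, x ≠ r → x ≠ acc → s'.reg x = s.reg x) →
      e.eval s' = ind (p i))
    (hQ : ∀ s', s'.Bdd Λ → Frame (.loop false r rb (.asg acc (.reg acc * e))) s s' →
      s'.reg acc = ind (p₀ ∧ ∀ i < N, p i) → Q s') :
    Runs Λ K ω (.loop false r rb (.asg acc (.reg acc * e))) s Q := by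
  have hne := hwf
  simp only [Bool.or_eq_false_iff, beq_eq_false_iff_ne] at hne
  refine Runs.fold (F := fun i => ind (p₀ ∧ ∀ j < i, p j)) hs hN hNb hwf (by simpa using h0)
    (fun i hi => ⟨?_, ind_lt hΛ⟩) hQ
  rw [Expr.eval_mul, hstep i hi ((s.setReg acc _).setReg r i) rfl (by simp) (fun x h1 h2 => by simp [h1, h2]), Expr.eval_reg,
    State.setReg_reg, if_neg (Ne.symm hne.1.1), State.setReg_reg, if_pos rfl, ind_mul]
  refine ind_congr ?_
  constructor
  · rintro ⟨⟨h0, h⟩, hi⟩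
    refine ⟨h0, fun j hj => ?_⟩
    rcases Nat.lt_succ_iff_lt_or_eq.1 hj with h' | rfl
    exacts [h j h', hi]
  · rintro ⟨h0, h⟩
    exact ⟨⟨h0, fun j hj => h j (by omega)⟩, h i (by omega)⟩

end Rules

/-! ### The input -/

/-- The part of the input word that describes the graph, the costs and the budget. -/
structure GraphData {n : ℕ} (G : SimpleGraph (Fin n)) (c : Fin n → ℕ) (b : ℤ) (x : ℕ → ℕ) : Prop where
  card : x 0 = n
  adj : ∀ u v : Fin n, x (1 + (u * n + v)) = ind (G.Adj u v)
  cost : ∀ v : Fin n, x (1 + n * n + v) = c v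
  budget : x (1 + n * n + n) = b.toNat
  neg_budget : x (1 + n * n + n + 1) = (-b).toNat

/-- The part of the input word that describes a tree decomposition. -/
structure DecData {n : ℕ} {G : SimpleGraph (Fin n)} (M : Set (Fin n))
    (D : TreeDecomposition (modularQuotient (G.induce M))) (a : ℕ) (x : ℕ → ℕ) : Prop where
  mem : ∀ v : Fin n, x (a + v) = ind (v ∈ M)
  size : x (a + n) = D.size
  tree : ∀ t t' : Fin D.size, x (a + n + 1 + (t * D.size + t')) = ind (D.tree.Adj t t')
  bag : ∀ (t : Fin D.size) (v : Fin n), x (a + n + 1 + D.size * D.size + (t * n + v)) =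
    ind (∃ h : v ∈ M, ∃ P ∈ D.bag t, (⟨v, h⟩ : M) ∈ P.1)

/-- The number of random bits for every vertex. -/
def bitCount (n : ℕ) : ℕ := Nat.clog 2 (2 * n)

theorem two_mul_le_pow_bitCount (n : ℕ) : 2 * n ≤ 2 ^ bitCount n :=
  Nat.le_pow_clog (by norm_num) _

theorem pow_bitCount_le {n : ℕ} (hn : 0 < n) : 2 ^ bitCount n ≤ 4 * n := by
  have h := Nat.pow_pred_clog_lt_self (b := 2) (by norm_num) (x := 2 * n) (by omega)
  have h1 : 0 < Nat.clog 2 (2 * n) := Nat.clog_pos (by norm_num) (by omega)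
  unfold bitCount
  obtain ⟨k, hk⟩ := Nat.exists_eq_succ_of_ne_zero h1.ne'
  rw [hk] at h ⊢
  simp only [Nat.succ_eq_add_one, Nat.pred_eq_sub_one, Nat.add_sub_cancel, pow_succ] at h ⊢
  omega

/-- So the program finds the number of bits by at most `n` doublings. -/
theorem bitCount_le (n : ℕ) : bitCount n ≤ n := by
  refine (Nat.clog_le_iff_le_pow (by norm_num)).2 ?_
  induction n with
  | zero => simp
  | succ n ih =>
    rcases n with _ | n
    · simp
    · rw [pow_succ]; have := Nat.lt_two_pow_self (n := n); rw [pow_succ] at ih ⊢; omega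

/-! ### Coin tosses and numbers computed in advance -/

section Prelude

variable {Λ K : ℕ} {ω : ℕ → Bool} {s : State} {Q : State → Prop} {n : ℕ}

/-- Compute in register `3` the number of random bits for every vertex. -/
def bitCountProg : LP :=
  .seq (.asg 3 0) <| .seq (.asg 4 1) <| .loop false 40 1 <|
    .ite (.lt (.reg 4) (2 * .reg 1)) (.seq (.asg 3 (.reg 3 + 1)) (.asg 4 (2 * .reg 4))) (.asg 27 0)

theorem bitCountProg_spec (hs : s.Bdd Λ) (h1 : s.reg 1 = n) (hn : 0 < n) (hΛ : 4 * n < Λ)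
    (hQ : ∀ s', s'.Bdd Λ → Frame bitCountProg s s' → s'.reg 3 = bitCount n →
      s'.reg 4 = 2 ^ bitCount n → Q s') :
    Runs Λ K ω bitCountProg s Q := by
  suffices h : Runs Λ K ω bitCountProg s (fun s' => s'.reg 3 = bitCount n ∧
      s'.reg 4 = 2 ^ bitCount n) from h.mono fun s' hb hf h => hQ s' hb hf h.1 h.2
  have hlt : Λ < 2 ^ Λ := Nat.lt_two_pow_self
  have hpow := pow_bitCount_le hn
  have hle := bitCount_le n
  refine Runs.asg_seq hs (by simp) fun hb => ?_
  refine Runs.asg_seq hb (by simp; omega) fun hb => ?_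
  -- Doubling stops as soon as the power reaches `2 * n`; the remaining rounds do nothing.
  refine Runs.loop (I := fun k s' => s'.reg 3 = min k (bitCount n) ∧
    s'.reg 4 = 2 ^ min k (bitCount n)) hb (by simpa using h1) (show n ≤ Λ by omega) rfl
    (fun k s' a h => by simpa using h) (by simp) ?_ (fun s' _ _ h => by
      rwa [min_eq_right hle] at h)
  intro k hk s' hb hf _ hI
  have e1 : s'.reg 1 = n := by rw [hf.reg 1 rfl]; simpa using h1
  have hiff : 2 ^ min k (bitCount n) < 2 * n ↔ k < bitCount n := by
    rcases lt_or_ge k (bitCount n) with h | h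
    · rw [min_eq_left h.le]
      exact ⟨fun _ => h, fun _ => (Nat.lt_clog_iff_pow_lt (by norm_num)).1 h⟩
    · rw [min_eq_right h]
      have := two_mul_le_pow_bitCount n
      exact ⟨fun _ => by omega, fun _ => by omega⟩
  refine Runs.ite hb (fun hc => ?_) (fun hc => ?_)
  · have hk' : k < bitCount n := by
      rw [← hiff]
      by_contra h
      simp [hI.2, e1, h] at hc
    have hmin : min (k + 1) (bitCount n) = k + 1 := min_eq_left hk'
    have hmin' : min k (bitCount n) = k := min_eq_left hk'.le
    rw [hmin'] at hI hiff
    have h2 := hiff.2 hk'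
    refine Runs.asg_seq hb (by simp [hI.1]; omega) fun hb => ?_
    refine Runs.asg hb (by simp [hI.2]; omega) ?_
    rw [hmin]
    simp [hI.1, hI.2, pow_succ, mul_comm]
  · have hk' : ¬ k < bitCount n := by
      rw [← hiff]
      intro h
      simp [hI.2, e1, h] at hc
    refine Runs.asg hb (by simp) ?_
    rw [min_eq_right (by omega)] at hI
    rw [min_eq_right (by omega)]
    simpa using hI

/-- Toss the coins for the weights. -/
def coinProg : LP :=
  .loop false 40 1 <| .seq (.asg 41 0) <|
    .seq (.loop false 42 3 (.seq (.flip 43) (.asg 41 (2 * .reg 41 + .reg 43)))) <|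
    .sto 6 (.reg 40) (.reg 41)

theorem coinProg_spec {l : ℕ} (hs : s.Bdd Λ) (h1 : s.reg 1 = n) (h3 : s.reg 3 = l)
    (ht : s.tossed = 0) (hn : n ≤ Λ) (hl : l < Λ)
    (hQ : ∀ s', s'.Bdd Λ → Frame coinProg s s' →
      (∀ v : Fin n, s'.arr 6 v = coinWeight ω l v) → Q s') :
    Runs Λ K ω coinProg s Q := by
  -- The number of coins tossed is tracked so that vertex `v` receives exactly the block of coins
  -- assumed by `coinWeight`.
  refine Runs.loop (I := fun k s' => s'.tossed = k * l ∧ ∀ v < k, s'.arr 6 v = bitsValue ω (v * l) l)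
    hs h1 hn rfl (fun k s' a h => h) (by simpa using ht) ?_
    (fun s' hb hf h => hQ s' hb hf fun v => h.2 v v.2)
  intro k hk s' hb hf hr hI
  have e3 : s'.reg 3 = l := by rw [hf.reg 3 rfl, h3]
  have hlt : ∀ j ≤ l, bitsValue ω (k * l) j < 2 ^ Λ := fun j hj =>
    (bitsValue_lt _ _ _).trans_le (Nat.pow_le_pow_right (by norm_num) (by omega))
  refine Runs.asg_seq hb (by simp) fun hb => ?_
  refine Runs.seq (P := fun s₁ => s₁.tossed = k * l + l ∧ s₁.reg 41 = bitsValue ω (k * l) l) ?_ ?_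
  · refine Runs.loop (I := fun j s₁ => s₁.tossed = k * l + j ∧ s₁.reg 41 = bitsValue ω (k * l) j)
      hb (by simpa using e3) hl.le rfl (fun j s₁ a h => by simpa using h)
      (by simpa [bitsValue] using hI.1) ?_ (fun _ _ _ h => h)
    intro j hj s₁ hb₁ hf₁ _ hI₁
    refine Runs.seq (P := fun s₂ => s₂.tossed = k * l + (j + 1) ∧
      s₂.reg 41 = bitsValue ω (k * l) j ∧ s₂.reg 43 = (ω (k * l + j)).toNat)
      (Runs.flip hb₁ (by omega) ⟨by simp [hI₁.1, add_assoc], ?_, ?_⟩) ?_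
    · change (s₁.setReg 43 (ω s₁.tossed).toNat).reg 41 = _
      simpa using hI₁.2
    · change (s₁.setReg 43 (ω s₁.tossed).toNat).reg 43 = _
      simp [hI₁.1]
    · intro s₂ hb₂ _ h₂
      have : (2 * Expr.reg 41 + .reg 43).eval s₂ = bitsValue ω (k * l) (j + 1) := by
        simp [h₂.2, bitsValue]
      refine Runs.asg hb₂ (by rw [this]; exact hlt _ hj) ?_
      rw [this]
      exact ⟨h₂.1, by simp⟩
  · intro s₁ hb₁ hf₁ h₁
    have e6 : s₁.arr 6 = s'.arr 6 := by rw [hf₁.arr 6 rfl]; rfl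
    have e40 : s₁.reg 40 = k := by rw [hf₁.reg 40 rfl]; simpa using hr
    refine Runs.sto hb₁ (hb₁.reg 41) ⟨by simp [h₁.1, add_mul], fun v hv => ?_⟩
    simp only [State.setArr_arr, if_true, Function.update_apply, Expr.eval_reg, e40, e6, h₁.2]
    split
    · next h => rw [h]
    · exact hI.2 v (by omega)

/-- Compute the combined weights, their sum, the base of the generating function, and so on. -/
def weightTableProg : LP :=
  .seq (.asg 5 (.reg 1 * .reg 4 + 1)) <|
  .seq (.loop false 40 1
    (.sto 8 (.reg 40) (.load 0 (1 + .reg 2 + .reg 40) * .reg 5 + .load 6 (.reg 40)))) <|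
  .seq (.asg 6 0) <|
  .seq (.loop false 40 1 (.asg 6 (.reg 6 + .load 8 (.reg 40)))) <|
  .seq (.asg 9 (.reg 6 + 1)) <|
  .seq (.asg 7 1) <|
  .seq (.loop false 40 1 (.asg 7 (16 * .reg 7))) <|
  .seq (.asg 8 1) <|
  .seq (.loop false 40 9 (.asg 8 (.reg 8 * .reg 7))) <|
  .loop false 40 1 <| .seq (.asg 41 1) <| .seq (.asg 42 (.load 8 (.reg 40))) <|
    .seq (.loop false 43 42 (.asg 41 (.reg 41 * .reg 7))) (.sto 7 (.reg 40) (.reg 41))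

/-- The numbers computed in advance. -/
structure Tables {n : ℕ} (E : Fin n → ℕ) (l : ℕ) (s : State) : Prop where
  r1 : s.reg 1 = n
  r2 : s.reg 2 = n * n
  r5 : s.reg 5 = weightBase n l
  r7 : s.reg 7 = 16 ^ n
  r8 : s.reg 8 = (16 ^ n) ^ (∑ v, E v + 1)
  r9 : s.reg 9 = ∑ v, E v + 1
  weight : ∀ v : Fin n, s.arr 7 v = (16 ^ n) ^ E v

theorem Tables.of_frame {E : Fin n → ℕ} {l : ℕ} (h : Tables E l s) {p : LP} {s' : State}
    (hf : Frame p s s') (hp : (p.modR 1 || p.modR 2 || p.modR 5 || p.modR 7 || p.modR 8 ||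
      p.modR 9 || p.modA 7) = false) : Tables E l s' := by
  simp only [Bool.or_eq_false_iff] at hp
  obtain ⟨⟨⟨⟨⟨⟨h1, h2⟩, h5⟩, h7⟩, h8⟩, h9⟩, a7⟩ := hp
  exact ⟨by rw [hf.reg 1 h1, h.r1], by rw [hf.reg 2 h2, h.r2], by rw [hf.reg 5 h5, h.r5],
    by rw [hf.reg 7 h7, h.r7], by rw [hf.reg 8 h8, h.r8], by rw [hf.reg 9 h9, h.r9],
    fun v => by rw [hf.arr 7 a7, h.weight v]⟩

/-- Powers are computed by repeated multiplication, so the number of rounds is an exponent. This is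
one reason why costs must be polynomially bounded. -/
theorem weightTableProg_spec {c w : Fin n → ℕ} {l : ℕ} (hs : s.Bdd Λ) (h1 : s.reg 1 = n)
    (h2 : s.reg 2 = n * n) (h4 : s.reg 4 = 2 ^ l)
    (hc : ∀ v : Fin n, s.arr 0 (1 + n * n + v) = c v) (hw : ∀ v : Fin n, s.arr 6 v = w v)
    (hn : 0 < n) (hl : n * 2 ^ l < Λ) (hΛ : 4 * n * (∑ v, combinedWeight c w l v + 1) < Λ)
    (hQ : ∀ s', s'.Bdd Λ → Frame weightTableProg s s' → Tables (combinedWeight c w l) l s' → Q s') :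
    Runs Λ K ω weightTableProg s Q := by
  set E := combinedWeight c w l with hE
  set T := ∑ v, E v with hT
  have hlt : Λ < 2 ^ Λ := Nat.lt_two_pow_self
  have hTΛ : T + 1 < Λ := lt_of_le_of_lt (Nat.le_mul_of_pos_left _ (by omega)) hΛ
  have hnΛ : n ≤ Λ := by
    refine le_trans ?_ hΛ.le
    nlinarith
  -- Since `16 ^ n = 2 ^ (4 * n)`, the largest power needed has `4 * n * (T + 1) + 1` bits.
  have hz : ∀ j ≤ T + 1, (16 ^ n) ^ j < 2 ^ Λ := fun j hj => by
    calc (16 ^ n) ^ j ≤ (16 ^ n) ^ (T + 1) := Nat.pow_le_pow_right (by positivity) hj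
      _ = 2 ^ (4 * n * (T + 1)) := by
        rw [pow_mul, pow_mul]; norm_num
      _ < 2 ^ Λ := Nat.pow_lt_pow_right (by norm_num) hΛ
  have hEle : ∀ v, E v ≤ T := fun v => Finset.single_le_sum (fun _ _ => Nat.zero_le _) (Finset.mem_univ v)
  suffices h : Runs Λ K ω weightTableProg s (fun s' => Tables E l s') from
    h.mono fun s' hb hf h => hQ s' hb hf h
  refine Runs.seq (P := fun s₁ => s₁.reg 5 = weightBase n l)
    (Runs.asg hs (by simp [h1, h4]; omega) (by simp [h1, h4, weightBase])) fun s₁ hb₁ hf₁ h₁ => ?_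
  refine Runs.seq (P := fun s₂ => ∀ v : Fin n, s₂.arr 8 v = E v)
    (Runs.fill (f := fun v => if h : v < n then E ⟨v, h⟩ else 0) hb₁ (by rw [hf₁.reg 1 rfl, h1]) hnΛ
      rfl (fun v hv s' hr ha _ => ⟨?_, ?_⟩) (fun s' _ _ h v => by rw [h v v.2, dif_pos v.2]))
    fun s₂ hb₂ hf₂ h₂ => ?_
  · simp only [Expr.eval_add, Expr.eval_mul, Expr.eval_load, Expr.eval_reg, Expr.eval_one, hr,
      State.setReg_reg, ha 0 (by norm_num), ha 6 (by norm_num), hf₁.arr 0 rfl, hf₁.arr 6 rfl, h₁]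
    norm_num only [if_true, if_false]
    rw [hf₁.reg 2 rfl, h2, hc ⟨v, hv⟩, hw ⟨v, hv⟩, dif_pos hv, hE, combinedWeight]
  · rw [dif_pos hv]
    have := hEle ⟨v, hv⟩
    omega
  have e1₂ : s₂.reg 1 = n := by rw [hf₂.reg 1 rfl, hf₁.reg 1 rfl, h1]
  refine Runs.seq (P := fun s₃ => s₃.reg 6 = 0) (Runs.asg hb₂ (by simp) (by simp))
    fun s₃ hb₃ hf₃ h₃ => ?_
  refine Runs.seq (P := fun s₄ => s₄.reg 6 = T)
    (Runs.fold (F := fun v => ∑ u ∈ Finset.range v, if h : u < n then E ⟨u, h⟩ else 0) hb₃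
      (by rw [hf₃.reg 1 rfl, e1₂]) hnΛ rfl (by simpa using h₃) (fun v hv => ⟨?_, ?_⟩)
      (fun s' _ _ h => by rw [h, Finset.sum_range, hT]; simp))
    fun s₄ hb₄ hf₄ h₄ => ?_
  · rw [Finset.sum_range_succ, dif_pos hv, ← h₂ ⟨v, hv⟩]
    simp [hf₃.arr 8 rfl]
  · refine lt_of_le_of_lt ?_ (show T < 2 ^ Λ by omega)
    calc ∑ u ∈ Finset.range (v + 1), (if h : u < n then E ⟨u, h⟩ else 0)
        ≤ ∑ u ∈ Finset.range n, (if h : u < n then E ⟨u, h⟩ else 0) :=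
          Finset.sum_le_sum_of_subset (Finset.range_subset_range.2 hv)
      _ = T := by rw [Finset.sum_range, hT]; simp
  refine Runs.seq (P := fun s₅ => s₅.reg 9 = T + 1) (Runs.asg hb₄ (by simp [h₄]; omega) (by simp [h₄]))
    fun s₅ hb₅ hf₅ h₅ => ?_
  refine Runs.seq (P := fun s₆ => s₆.reg 7 = 1) (Runs.asg hb₅ (by simp; omega) (by simp))
    fun s₆ hb₆ hf₆ h₆ => ?_
  refine Runs.seq (P := fun s₇ => s₇.reg 7 = 16 ^ n)
    (Runs.fold (F := fun v => 16 ^ v) hb₆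
      (by rw [hf₆.reg 1 rfl, hf₅.reg 1 rfl, hf₄.reg 1 rfl, hf₃.reg 1 rfl, e1₂]) hnΛ rfl
      (by simpa using h₆) (fun v hv => ⟨by simp [pow_succ, mul_comm], ?_⟩)
      (fun s' _ _ h => h))
    fun s₇ hb₇ hf₇ h₇ => ?_
  · refine lt_of_le_of_lt (Nat.pow_le_pow_right (by norm_num) hv) ?_
    simpa using hz 1 (by omega)
  have e9₇ : s₇.reg 9 = T + 1 := by rw [hf₇.reg 9 rfl, hf₆.reg 9 rfl, h₅]
  refine Runs.seq (P := fun s₈ => s₈.reg 8 = 1) (Runs.asg hb₇ (by simp; omega) (by simp))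
    fun s₈ hb₈ hf₈ h₈ => ?_
  have e7₈ : s₈.reg 7 = 16 ^ n := by rw [hf₈.reg 7 rfl, h₇]
  refine Runs.seq (P := fun s₉ => s₉.reg 8 = (16 ^ n) ^ (T + 1))
    (Runs.fold (F := fun v => (16 ^ n) ^ v) hb₈ (by rw [hf₈.reg 9 rfl, e9₇]) hTΛ.le rfl
      (by simpa using h₈) (fun v hv => ⟨by simp [pow_succ, e7₈], hz _ hv⟩)
      (fun s' _ _ h => h))
    fun s₉ hb₉ hf₉ h₉ => ?_
  have e1₉ : s₉.reg 1 = n := by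
    rw [hf₉.reg 1 rfl, hf₈.reg 1 rfl, hf₇.reg 1 rfl, hf₆.reg 1 rfl, hf₅.reg 1 rfl, hf₄.reg 1 rfl,
      hf₃.reg 1 rfl, e1₂]
  have e2₉ : s₉.reg 2 = n * n := by
    rw [hf₉.reg 2 rfl, hf₈.reg 2 rfl, hf₇.reg 2 rfl, hf₆.reg 2 rfl, hf₅.reg 2 rfl, hf₄.reg 2 rfl,
      hf₃.reg 2 rfl, hf₂.reg 2 rfl, hf₁.reg 2 rfl, h2]
  have e5₉ : s₉.reg 5 = weightBase n l := by
    rw [hf₉.reg 5 rfl, hf₈.reg 5 rfl, hf₇.reg 5 rfl, hf₆.reg 5 rfl, hf₅.reg 5 rfl, hf₄.reg 5 rfl,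
      hf₃.reg 5 rfl, hf₂.reg 5 rfl, h₁]
  have e7₉ : s₉.reg 7 = 16 ^ n := by rw [hf₉.reg 7 rfl, e7₈]
  have e9₉ : s₉.reg 9 = T + 1 := by rw [hf₉.reg 9 rfl, hf₈.reg 9 rfl, e9₇]
  have a8₉ : ∀ v : Fin n, s₉.arr 8 v = E v := fun v => by
    rw [hf₉.arr 8 rfl, hf₈.arr 8 rfl, hf₇.arr 8 rfl, hf₆.arr 8 rfl, hf₅.arr 8 rfl, hf₄.arr 8 rfl,
      hf₃.arr 8 rfl, h₂]
  refine Runs.loop (I := fun k s' => ∀ v : Fin n, v.1 < k → s'.arr 7 v = (16 ^ n) ^ E v) hb₉ e1₉ hnΛ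
    rfl (fun k s' a h => h) (by simp) ?_ (fun s' _ hf h => ⟨by rw [hf.reg 1 rfl, e1₉],
      by rw [hf.reg 2 rfl, e2₉], by rw [hf.reg 5 rfl, e5₉], by rw [hf.reg 7 rfl, e7₉],
      by rw [hf.reg 8 rfl, h₉], by rw [hf.reg 9 rfl, e9₉], fun v => h v v.2⟩)
  intro k hk s' hb hf hr hI
  refine Runs.asg_seq hb (by simp; omega) fun hb => ?_
  refine Runs.asg_seq hb (hb.arr _ _) fun hb => ?_
  have hEk := hEle ⟨k, hk⟩
  refine Runs.seq (P := fun s₁ => s₁.reg 41 = (16 ^ n) ^ E ⟨k, hk⟩)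
    (Runs.fold (N := E ⟨k, hk⟩) (F := fun v => (16 ^ n) ^ v) hb ?_ (show _ ≤ Λ by omega) rfl (by simp)
      (fun v hv => ⟨?_, hz _ (by omega)⟩) (fun s' _ _ h => h)) fun s₁ hb₁ hf₁ h₁ => ?_
  · have := a8₉ ⟨k, hk⟩
    simp only [State.setReg_reg, State.setReg_arr, if_true, Expr.eval_load, Expr.eval_reg, hr,
      hf.arr 8 rfl]
    norm_num only [if_false]
    exact this
  · simp [pow_succ, hf.reg 7 rfl, e7₉]
  · refine Runs.sto hb₁ (hb₁.reg 41) fun v hv => ?_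
    have e40 : s₁.reg 40 = k := by rw [hf₁.reg 40 rfl]; simpa using hr
    have e7 : s₁.arr 7 = s'.arr 7 := by rw [hf₁.arr 7 rfl]; rfl
    simp only [State.setArr_arr, if_true, Function.update_apply, Expr.eval_reg, e40, h₁, e7]
    split
    · next h =>
      have : v = ⟨k, hk⟩ := Fin.ext h
      rw [this]
    · exact hI v (by omega)

end Prelude

section Ind

variable {p q : Prop}

theorem ind_add (h : ¬ (p ∧ q)) : ind p + ind q = ind (p ∨ q) := by
  unfold ind; split <;> split <;> simp_all

end Ind

/-! ### Programs for pairs, joined nodes, equality of parts and representatives -/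

section Parts

variable {Λ K : ℕ} {ω : ℕ → Bool} {s : State} {Q : State → Prop} {n : ℕ} {G : SimpleGraph (Fin n)}
  {c : Fin n → ℕ} {b : ℤ} {x : ℕ → ℕ} {M : Set (Fin n)}
  {D : TreeDecomposition (modularQuotient (G.induce M))}

theorem div_lt_of_lt_mul_self {e : ℕ} (he : e < n * n) : e / n < n := Nat.div_lt_of_lt_mul he

theorem mod_lt_of_lt_mul_self {e : ℕ} (he : e < n * n) : e % n < n :=
  Nat.mod_lt _ (Nat.pos_of_ne_zero fun h => by simp [h] at he)

theorem exists_lt_mul_self_iff {P : Fin n → Fin n → Prop} :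
    (∃ e < n * n, ∃ (hu : e / n < n) (hv : e % n < n), P ⟨e / n, hu⟩ ⟨e % n, hv⟩) ↔
      ∃ u v, P u v := by
  constructor
  · rintro ⟨e, -, hu, hv, h⟩
    exact ⟨_, _, h⟩
  · rintro ⟨u, v, h⟩
    have e1 : (u.1 * n + v.1) / n = u := mul_add_div_of_lt v.2
    have e2 : (u.1 * n + v.1) % n = v := mul_add_mod_of_lt' v.2
    refine ⟨u * n + v, mul_add_lt u.2 v.2, by rw [e1]; exact u.2, by rw [e2]; exact v.2, ?_⟩
    convert h

theorem GraphData.adj_apply (hx : GraphData G c b x) {u v : ℕ} (hu : u < n) (hv : v < n) :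
    x (1 + (u * n + v)) = ind (G.Adj ⟨u, hu⟩ ⟨v, hv⟩) := hx.adj ⟨u, hu⟩ ⟨v, hv⟩

theorem GraphData.cost_apply (hx : GraphData G c b x) {v : ℕ} (hv : v < n) :
    x (1 + n * n + v) = c ⟨v, hv⟩ := hx.cost ⟨v, hv⟩

theorem GraphData.adj_div_mod (hx : GraphData G c b x) {e : ℕ} (he : e < n * n) :
    x (1 + e) = ind (G.Adj ⟨e / n, div_lt_of_lt_mul_self he⟩ ⟨e % n, mod_lt_of_lt_mul_self he⟩) := by
  rw [← hx.adj_apply, Nat.div_add_mod']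

theorem DecData.mem_apply {a v : ℕ} (hD : DecData M D a x) (hv : v < n) :
    x (a + v) = ind (⟨v, hv⟩ ∈ M) := hD.mem ⟨v, hv⟩

/-- Look for a solution with at most two vertices. -/
def pairProg : LP :=
  .loop false 40 2 <| .seq (.asg 42 (.eq (.reg 40 / .reg 1) (.reg 40 % .reg 1) + .load 0 (1 + .reg 40))) <|
    .seq (.loop false 43 1 (.asg 42 (.reg 42 * .lt 0 (
      .eq (.reg 43) (.reg 40 / .reg 1) + .eq (.reg 43) (.reg 40 % .reg 1) +
      .load 0 (1 + (.reg 40 / .reg 1 * .reg 1 + .reg 43)) +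
      .load 0 (1 + (.reg 40 % .reg 1 * .reg 1 + .reg 43)))))) <|
    .ite (.reg 42 * (1 - .lt (.load 0 (1 + .reg 2 + .reg 1)) (.load 0 (1 + .reg 2 + .reg 40 / .reg 1) +
      (1 - .eq (.reg 40 / .reg 1) (.reg 40 % .reg 1)) * .load 0 (1 + .reg 2 + .reg 40 % .reg 1) +
      .load 0 (1 + .reg 2 + .reg 1 + 1)))) (.asg 0 1) (.asg 27 0)

theorem pairProg_spec (hs : s.Bdd Λ) (h1 : s.reg 1 = n) (h2 : s.reg 2 = n * n) (h0 : s.arr 0 = x)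
    (hx : GraphData G c b x) (hr0 : s.reg 0 = 0) (hΛ : n * n < Λ)
    (hQ : ∀ s', s'.Bdd Λ → Frame pairProg s s' → (s'.reg 0 ≠ 0 ↔ ∃ u v, PairAccepts G c b u v) →
      Q s') :
    Runs Λ K ω pairProg s Q := by
  have hone : 1 < 2 ^ Λ := Nat.one_lt_two_pow (by omega)
  have hnΛ : n ≤ Λ := (Nat.le_mul_self n).trans hΛ.le
  refine Runs.loop (I := fun e s' => s'.reg 0 ≠ 0 ↔ ∃ e' < e, ∃ (hu : e' / n < n) (hv : e' % n < n),
    PairAccepts G c b ⟨e' / n, hu⟩ ⟨e' % n, hv⟩) hs h2 hΛ.le rfl (fun k s' a h => by simpa using h)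
    (by simpa using hr0) ?_ (fun s' hb hf h => hQ s' hb hf (h.trans exists_lt_mul_self_iff))
  intro e he s' hb hf hr hI
  have hu := div_lt_of_lt_mul_self he
  have hv := mod_lt_of_lt_mul_self he
  have e1 : s'.reg 1 = n := by rw [hf.reg 1 rfl, h1]
  have e2 : s'.reg 2 = n * n := by rw [hf.reg 2 rfl, h2]
  have e0 : s'.arr 0 = x := by rw [hf.arr 0 rfl, h0]
  set u : Fin n := ⟨e / n, hu⟩ with hudef
  set v : Fin n := ⟨e % n, hv⟩ with hvdef
  have huv : e / n = e % n ↔ u = v := by rw [hudef, hvdef, Fin.mk.injEq]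
  have hval : (Expr.eq (.reg 40 / .reg 1) (.reg 40 % .reg 1) + .load 0 (1 + .reg 40)).eval s' =
      ind (u = v ∨ G.Adj u v) := by
    simp only [Expr.eval_add, Expr.eval_eq_ind, Expr.eval_div, Expr.eval_mod, Expr.eval_reg,
      Expr.eval_load, Expr.eval_one, hr, e1, e0, hx.adj_div_mod he, huv]
    -- Equality and adjacency exclude each other, so their sum is again a truth value.
    exact ind_add fun h => h.2.ne h.1
  refine Runs.seq (P := fun s₁ => s₁.reg 42 = ind (u = v ∨ G.Adj u v))
    (Runs.asg hb (by rw [hval]; exact ind_lt (by omega)) (by rw [hval]; simp)) fun s₁ hb₁ hf₁ h₁ => ?_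
  refine Runs.seq (P := fun s₂ => s₂.reg 42 = ind ((u = v ∨ G.Adj u v) ∧ ∀ y < n, ∀ hy : y < n,
      ⟨y, hy⟩ = u ∨ ⟨y, hy⟩ = v ∨ G.Adj u ⟨y, hy⟩ ∨ G.Adj v ⟨y, hy⟩))
    (Runs.all _ hb₁ (by rw [hf₁.reg 1 rfl, e1]) hnΛ (by omega) rfl h₁ (fun y hy t ht hty hreg => ?_)
      (fun _ _ _ h => h)) fun s₂ hb₂ hf₂ h₂ => ?_
  · have f1 : t.reg 1 = n := by rw [hreg 1 (by norm_num) (by norm_num), hf₁.reg 1 rfl, e1]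
    have f40 : t.reg 40 = e := by rw [hreg 40 (by norm_num) (by norm_num), hf₁.reg 40 rfl, hr]
    have f0 : t.arr 0 = x := by rw [ht, hf₁.arr 0 rfl, e0]
    simp only [Expr.eval_lt_ind, Expr.eval_add, Expr.eval_eq_ind, Expr.eval_div, Expr.eval_mod,
      Expr.eval_mul, Expr.eval_reg, Expr.eval_load, Expr.eval_one, Expr.eval_zero, f1, f40, f0, hty,
      hx.adj_apply hu hy, hx.adj_apply hv hy, Nat.add_pos_iff_pos_or_pos, ind_pos]
    refine ind_congr ?_
    rw [or_assoc, or_assoc, hudef, hvdef]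
    simp only [Fin.mk.injEq]
    exact ⟨fun h _ => h, fun h => h hy⟩
  · have f1 : s₂.reg 1 = n := by rw [hf₂.reg 1 rfl, hf₁.reg 1 rfl, e1]
    have f2 : s₂.reg 2 = n * n := by rw [hf₂.reg 2 rfl, hf₁.reg 2 rfl, e2]
    have f40 : s₂.reg 40 = e := by rw [hf₂.reg 40 rfl, hf₁.reg 40 rfl, hr]
    have f0 : s₂.arr 0 = x := by rw [hf₂.arr 0 rfl, hf₁.arr 0 rfl, e0]
    -- The budget may be negative, so it is stored as a difference of two natural numbers and its
    -- negative part is moved to the side of the cost.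
    have hcost : (∃ (hu : e / n < n) (hv : e % n < n), PairAccepts G c b ⟨e / n, hu⟩ ⟨e % n, hv⟩) ↔
        ((u = v ∨ G.Adj u v) ∧ ∀ y < n, ∀ hy : y < n,
          ⟨y, hy⟩ = u ∨ ⟨y, hy⟩ = v ∨ G.Adj u ⟨y, hy⟩ ∨ G.Adj v ⟨y, hy⟩) ∧
        ¬ b.toNat < c u + (1 - ind (u = v)) * c v + (-b).toNat := by
      have : (1 - ind (u = v)) * c v = if u = v then 0 else c v := by
        unfold ind; split <;> simp
      rw [this]
      constructor
      · rintro ⟨_, _, h1, h2, h3⟩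
        have h3' : ((c u + (if u = v then 0 else c v) : ℕ) : ℤ) ≤ b := h3
        exact ⟨⟨h1, fun y hy _ => h2 _⟩, by omega⟩
      · rintro ⟨⟨h1, h2⟩, h3⟩
        exact ⟨hu, hv, h1, fun y => h2 y y.2 y.2, by
          change ((c u + (if u = v then 0 else c v) : ℕ) : ℤ) ≤ b
          omega⟩
    have hstep : (∃ e' < e + 1, ∃ (hu : e' / n < n) (hv : e' % n < n),
        PairAccepts G c b ⟨e' / n, hu⟩ ⟨e' % n, hv⟩) ↔ s₂.reg 0 ≠ 0 ∨
        ∃ (hu : e / n < n) (hv : e % n < n), PairAccepts G c b ⟨e / n, hu⟩ ⟨e % n, hv⟩ := by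
      rw [hf₂.reg 0 rfl, hf₁.reg 0 rfl, hI]
      constructor
      · rintro ⟨e', he', h⟩
        rcases Nat.lt_succ_iff_lt_or_eq.1 he' with h' | rfl
        exacts [Or.inl ⟨e', h', h⟩, Or.inr h]
      · rintro (⟨e', he', h⟩ | h)
        exacts [⟨e', by omega, h⟩, ⟨e, by omega, h⟩]
    have hval₂ : (Expr.reg 42 * (1 - .lt (.load 0 (1 + .reg 2 + .reg 1))
        (.load 0 (1 + .reg 2 + .reg 40 / .reg 1) +
          (1 - .eq (.reg 40 / .reg 1) (.reg 40 % .reg 1)) * .load 0 (1 + .reg 2 + .reg 40 % .reg 1) +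
          .load 0 (1 + .reg 2 + .reg 1 + 1)))).eval s₂ =
        ind (∃ (hu : e / n < n) (hv : e % n < n), PairAccepts G c b ⟨e / n, hu⟩ ⟨e % n, hv⟩) := by
      simp only [Expr.eval_lt_ind, Expr.eval_add, Expr.eval_eq_ind, Expr.eval_div, Expr.eval_mod,
        Expr.eval_mul, Expr.eval_reg, Expr.eval_load, Expr.eval_one, Expr.eval_sub, f1, f2, f40, f0,
        hx.budget, hx.neg_budget, hx.cost_apply hu, hx.cost_apply hv, h₂, huv,
        one_sub_ind, ind_mul]
      rw [hcost, one_sub_ind]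
    refine Runs.ite hb₂ (fun hc => Runs.asg hb₂ (by simpa using hone) ?_)
      (fun hc => Runs.asg hb₂ (by simp) ?_)
    · rw [hval₂, ind_ne_zero] at hc
      rw [hstep]
      simp [hc]
    · rw [hval₂, ind_eq_zero] at hc
      rw [hstep]
      simp [hc]

/-- Compute in register `14` whether some vertex of `M` is not adjacent to some other vertex outside
`M`. -/
def joinedProg : LP :=
  .seq (.asg 14 0) <| .loop false 40 2 <| .asg 14 (.reg 14 + .load 0 (.reg 10 + .reg 40 / .reg 1) *
    (1 - .load 0 (.reg 10 + .reg 40 % .reg 1)) * (1 - .load 0 (1 + .reg 40)))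

theorem joinedProg_spec {a : ℕ} (hs : s.Bdd Λ) (h1 : s.reg 1 = n) (h2 : s.reg 2 = n * n)
    (h10 : s.reg 10 = a) (h0 : s.arr 0 = x) (hx : GraphData G c b x) (hD : DecData M D a x)
    (hΛ : n * n < Λ)
    (hQ : ∀ s', s'.Bdd Λ → Frame joinedProg s s' →
      (s'.reg 14 ≠ 0 ↔ ¬ ∀ u ∈ M, ∀ v ∉ M, G.Adj u v) → Q s') :
    Runs Λ K ω joinedProg s Q := by
  suffices h : Runs Λ K ω joinedProg s
      (fun s' => s'.reg 14 ≠ 0 ↔ ¬ ∀ u ∈ M, ∀ v ∉ M, G.Adj u v) from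
    h.mono fun s' hb hf h => hQ s' hb hf h
  refine Runs.asg_seq hs (by simp) fun hb => ?_
  refine Runs.any (fun e => ∃ (hu : e / n < n) (hv : e % n < n), ⟨e / n, hu⟩ ∈ M ∧ ⟨e % n, hv⟩ ∉ M ∧
    ¬ G.Adj ⟨e / n, hu⟩ ⟨e % n, hv⟩) hb (by simpa using h2) hΛ.le rfl (by simp) ?_
    (fun s' _ _ h => h.trans ?_)
  · intro e he t ht hr hreg
    have hu := div_lt_of_lt_mul_self he
    have hv := mod_lt_of_lt_mul_self he
    have f1 : t.reg 1 = n := by rw [hreg 1 (by norm_num) (by norm_num)]; simpa using h1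
    have f10 : t.reg 10 = a := by rw [hreg 10 (by norm_num) (by norm_num)]; simpa using h10
    have f0 : t.arr 0 = x := by rw [ht]; exact h0
    simp only [Expr.eval_add, Expr.eval_div, Expr.eval_mod, Expr.eval_mul, Expr.eval_reg,
      Expr.eval_load, Expr.eval_one, Expr.eval_sub, f1, f10, f0, hr, hx.adj_div_mod he,
      hD.mem_apply hu, hD.mem_apply hv, one_sub_ind, ind_mul]
    exact ind_congr ⟨fun h => ⟨hu, hv, h.1.1, h.1.2, h.2⟩, fun ⟨_, _, h1, h2, h3⟩ => ⟨⟨h1, h2⟩, h3⟩⟩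
  · rw [exists_lt_mul_self_iff (P := fun u v => u ∈ M ∧ v ∉ M ∧ ¬ G.Adj u v)]
    push Not
    exact ⟨fun ⟨u, v, h1, h2, h3⟩ => ⟨u, h1, v, h2, h3⟩, fun ⟨u, h1, v, h2, h3⟩ => ⟨u, v, h1, h2, h3⟩⟩

/-- Compute in register `54` whether the vertices of `M` in the registers `50` and `52` lie in the
same part of the canonical partition of `G[M]`. -/
def samePartProg : LP :=
  .seq (.asg 20 (.reg 1)) <| .seq (.asg 21 (.reg 2)) <| .seq (.asg 22 (.reg 52)) <|
  .seq (.loop false 53 2 (.sto 2 (.reg 53) (.load 0 (.reg 10 + .reg 53 % .reg 1) *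
    (1 - .eq (.load 0 (1 + .reg 53)) (.load 0 (1 + (.reg 50 * .reg 1 + .reg 53 % .reg 1))))))) <|
  .seq searchProg <| .seq (.asg 54 0) <|
  .loop false 53 1 (.asg 54 (.reg 54 + .load 0 (.reg 10 + .reg 53) * (1 - .eq (.reg 53) (.reg 50)) *
    (1 - .load 1 (.reg 53))))

/-- The search runs in the digraph with an arc from `y` to `x` whenever `x` in `M` distinguishes `y`
from `u`. It finds the closure of `v` required in `samePart_iff_exists`, and the final loop looks
for a vertex of `M` that is missed. -/
theorem samePartProg_spec {a : ℕ} (hs : s.Bdd Λ) (h1 : s.reg 1 = n) (h2 : s.reg 2 = n * n)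
    (h10 : s.reg 10 = a) (h0 : s.arr 0 = x) (hx : GraphData G c b x) (hD : DecData M D a x)
    (hM : IsPrimeGraph (modularQuotient (G.induce M))) (hΛ : n * n < Λ) {u v : Fin n}
    (h50 : s.reg 50 = u) (h52 : s.reg 52 = v) (hu : u ∈ M) (hv : v ∈ M)
    (hQ : ∀ s', s'.Bdd Λ → Frame samePartProg s s' → (s'.reg 54 ≠ 0 ↔ SamePart G M u v) → Q s') :
    Runs Λ K ω samePartProg s Q := by
  have hnΛ : n ≤ Λ := (Nat.le_mul_self n).trans hΛ.le
  suffices h : Runs Λ K ω samePartProg s (fun s' => s'.reg 54 ≠ 0 ↔ SamePart G M u v) from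
    h.mono fun s' hb hf h => hQ s' hb hf h
  refine Runs.asg_seq hs (hs.reg 1) fun hb => ?_
  refine Runs.asg_seq hb (hb.reg 2) fun hb => ?_
  refine Runs.asg_seq hb (hb.reg 52) fun hb => ?_
  generalize hs₁ : State.setReg _ 22 _ = s₁ at hb ⊢
  replace hs₁ := hs₁.symm
  have e1 : s₁.reg 1 = n := by simp [hs₁, h1]
  have e2 : s₁.reg 2 = n * n := by simp [hs₁, h2]
  have e10 : s₁.reg 10 = a := by simp [hs₁, h10]
  have e20 : s₁.reg 20 = n := by simp [hs₁, h1]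
  have e21 : s₁.reg 21 = n * n := by simp [hs₁, h2]
  have e22 : s₁.reg 22 = v := by simp [hs₁, h52]
  have e50 : s₁.reg 50 = u := by simp [hs₁, h50]
  have e0 : s₁.arr 0 = x := by simp [hs₁, h0]
  clear hs₁
  have hpos : 0 < Λ := by omega
  refine Runs.seq (P := fun s₂ => ∀ e (he : e < n * n), s₂.arr 2 e =
      ind (⟨e % n, mod_lt_of_lt_mul_self he⟩ ∈ M ∧
        ¬ (G.Adj ⟨e / n, div_lt_of_lt_mul_self he⟩ ⟨e % n, mod_lt_of_lt_mul_self he⟩ ↔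
          G.Adj u ⟨e % n, mod_lt_of_lt_mul_self he⟩)))
    (Runs.fill (f := fun e => if he : e < n * n then _ else 0) hb e2 hΛ.le rfl ?_
      (fun s₂ _ _ h e he => by rw [h e he, dif_pos he])) fun s₂ hb₂ hf₂ h₂ => ?_
  · intro e he t hreg ht _
    rw [dif_pos he]
    refine ⟨?_, ind_lt hpos⟩
    have hu := div_lt_of_lt_mul_self he
    have hv := mod_lt_of_lt_mul_self he
    simp only [Expr.eval_add, Expr.eval_eq_ind, Expr.eval_mod, Expr.eval_mul, Expr.eval_reg,
      Expr.eval_load, Expr.eval_one, Expr.eval_sub, hreg, State.setReg_reg, ht 0 (by norm_num), e0]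
    norm_num only [if_true, if_false]
    rw [e10, e1, e50, hD.mem_apply hv, hx.adj_div_mod he, hx.adj_apply u.2 hv, ind_inj,
      one_sub_ind, ind_mul]
  refine Runs.seq (P := fun s₃ =>
      SearchInv n (s₂.arr 2) v (s₃.arr 1) (s₃.arr 3) (s₃.arr 4) (s₃.arr 5) (s₃.reg 23) ∧
      SearchClosed n (s₂.arr 2) (s₃.arr 1))
    (searchProg_spec hb₂ (by rw [hf₂.reg 20 rfl, e20]) (by rw [hf₂.reg 21 rfl, e21])
      (by rw [hf₂.reg 22 rfl, e22]) v.2 hΛ fun _ _ _ h h' => ⟨h, h'⟩) fun s₃ hb₃ hf₃ h₃ => ?_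
  refine Runs.asg_seq hb₃ (by simp) fun hb => ?_
  refine Runs.any (fun y => ∃ hy : y < n, ⟨y, hy⟩ ∈ M ∧ ⟨y, hy⟩ ≠ u ∧ s₃.arr 1 y ≠ 1) hb
    (by simpa [hf₃.reg 1 rfl, hf₂.reg 1 rfl] using e1) hnΛ rfl (by simp) ?_ (fun s' _ _ h => h.trans ?_)
  · intro y hy t ht hr hreg
    have f10 : t.reg 10 = a := by
      rw [hreg 10 (by norm_num) (by norm_num)]
      simpa [hf₃.reg 10 rfl, hf₂.reg 10 rfl] using e10
    have f50 : t.reg 50 = u := by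
      rw [hreg 50 (by norm_num) (by norm_num)]
      simpa [hf₃.reg 50 rfl, hf₂.reg 50 rfl] using e50
    have f0 : t.arr 0 = x := by
      rw [ht]
      simpa [hf₃.arr 0 rfl, hf₂.arr 0 rfl] using e0
    have f1 : t.arr 1 = s₃.arr 1 := by rw [ht]; rfl
    have hle := h₃.1.le_one y hy
    have h01 : 1 - s₃.arr 1 y = ind (s₃.arr 1 y ≠ 1) := by
      unfold ind; split <;> omega
    simp only [Expr.eval_add, Expr.eval_eq_ind, Expr.eval_mul, Expr.eval_reg, Expr.eval_load,
      Expr.eval_one, Expr.eval_sub, f10, f50, f0, f1, hr, hD.mem_apply hy, one_sub_ind,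
      ind_mul, h01]
    refine ind_congr ?_
    simp only [hy, exists_true_left, and_assoc, ne_eq, Fin.ext_iff]
  · have hmat : ∀ p (hp : p < n) q (hq : q < n), s₂.arr 2 (p * n + q) ≠ 0 ↔
        ⟨q, hq⟩ ∈ M ∧ ¬ (G.Adj ⟨p, hp⟩ ⟨q, hq⟩ ↔ G.Adj u ⟨q, hq⟩) := by
      intro p hp q hq
      rw [h₂ _ (mul_add_lt hp hq), ind_ne_zero]
      simp only [mul_add_div_of_lt hq, mul_add_mod_of_lt' hq]
    rw [samePart_iff_exists hM hu hv (S := {y | s₃.arr 1 y = 1})]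
    · exact ⟨fun ⟨y, _, hy, h1, h2, h3⟩ => ⟨⟨y, hy⟩, h1, h2, h3⟩,
        fun ⟨y, h1, h2, h3⟩ => ⟨y, y.2, y.2, h1, h2, h3⟩⟩
    · have := (h₃.1.of_ord 1 le_rfl h₃.1.cnt_pos).2.1
      rwa [h₃.1.ord_one] at this
    · intro y hy z hz hne
      exact h₃.2 y y.2 z z.2 hy ((hmat y y.2 z z.2).2 ⟨hz, hne⟩)
    -- Minimality of the closure: vertices are found only along arcs, and the set `T` is closed
    -- under these.
    · intro T hvT hT y hy
      obtain ⟨_, h⟩ := h₃.1.mem_of_closed (P := fun y => ∃ hy : y < n, ⟨y, hy⟩ ∈ T) ⟨v.2, hvT⟩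
        (fun p hp q hq ⟨_, hpT⟩ hE => by
          obtain ⟨h1, h2⟩ := (hmat p hp q hq).1 hE
          exact ⟨hq, hT _ hpT _ h1 h2⟩) y.2 hy
      exact h

/-- Compute the set of representatives. -/
def representativesProg : LP :=
  .loop false 50 1 <| .seq (.asg 51 (.load 0 (.reg 10 + .reg 50))) <|
    .seq (.loop false 52 1 (.ite (.load 0 (.reg 10 + .reg 50) * .load 0 (.reg 10 + .reg 52) *
        (1 - .eq (.reg 50) (.reg 52)) * .lt 0
          (.lt (.load 0 (1 + .reg 2 + .reg 52)) (.load 0 (1 + .reg 2 + .reg 50)) +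
            .eq (.load 0 (1 + .reg 2 + .reg 52)) (.load 0 (1 + .reg 2 + .reg 50)) *
              .lt (.reg 52) (.reg 50)))
      (.seq samePartProg (.ite (.reg 54) (.asg 51 0) (.asg 27 0))) (.asg 27 0))) <|
    .sto 9 (.reg 50) (.reg 51)

theorem representativesProg_spec {a : ℕ} (hs : s.Bdd Λ) (h1 : s.reg 1 = n) (h2 : s.reg 2 = n * n)
    (h10 : s.reg 10 = a) (h0 : s.arr 0 = x) (hx : GraphData G c b x) (hD : DecData M D a x)
    (hM : IsPrimeGraph (modularQuotient (G.induce M))) (hΛ : n * n < Λ)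
    (hQ : ∀ s', s'.Bdd Λ → Frame representativesProg s s' →
      (∀ u : Fin n, s'.arr 9 u = ind (u ∈ representatives G M c)) → Q s') :
    Runs Λ K ω representativesProg s Q := by
  have hnΛ : n ≤ Λ := (Nat.le_mul_self n).trans hΛ.le
  have hpos : 0 < Λ := by omega
  refine Runs.loop (I := fun k s' => ∀ u : Fin n, u.1 < k → s'.arr 9 u = ind (u ∈ representatives G M c))
    hs h1 hnΛ rfl (fun k s' a h => h) (by simp) ?_ (fun s' hb hf h => hQ s' hb hf fun u => h u u.2)
  intro k hk s' hb hf hr hI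
  have e1 : s'.reg 1 = n := by rw [hf.reg 1 rfl, h1]
  have e2 : s'.reg 2 = n * n := by rw [hf.reg 2 rfl, h2]
  have e10 : s'.reg 10 = a := by rw [hf.reg 10 rfl, h10]
  have e0 : s'.arr 0 = x := by rw [hf.arr 0 rfl, h0]
  set u : Fin n := ⟨k, hk⟩ with hu
  refine Runs.seq (P := fun s₁ => s₁.reg 51 = ind (u ∈ M)) (Runs.asg hb (hb.arr _ _)
    (by simp [e10, hr, e0, hD.mem_apply hk, hu])) fun s₁ hb₁ hf₁ h₁ => ?_
  refine Runs.seq (P := fun s₂ => s₂.reg 51 = ind (u ∈ representatives G M c)) ?_ ?_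
  -- A vertex stays a candidate until a better vertex of its part is seen. The search is called only
  -- when both vertices lie in `M` and the second is preferable.
  · refine Runs.loop (I := fun j s₂ => s₂.reg 51 = ind (u ∈ M ∧ ∀ v : Fin n, v.1 < j → v ∈ M → u ≠ v →
      (c v < c u ∨ c v = c u ∧ v < u) → ¬ SamePart G M u v)) hb₁ (by rw [hf₁.reg 1 rfl, e1]) hnΛ rfl
      (fun k s' a h => by simpa using h) (by simpa using h₁) ?_ (fun s₂ _ _ h => ?_)
    · intro j hj s₂ hb₂ hf₂ hr₂ hI₂
      have f1 : s₂.reg 1 = n := by rw [hf₂.reg 1 rfl, hf₁.reg 1 rfl, e1]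
      have f2 : s₂.reg 2 = n * n := by rw [hf₂.reg 2 rfl, hf₁.reg 2 rfl, e2]
      have f10 : s₂.reg 10 = a := by rw [hf₂.reg 10 rfl, hf₁.reg 10 rfl, e10]
      have f50 : s₂.reg 50 = k := by rw [hf₂.reg 50 rfl, hf₁.reg 50 rfl, hr]
      have f0 : s₂.arr 0 = x := by rw [hf₂.arr 0 rfl, hf₁.arr 0 rfl, e0]
      set v : Fin n := ⟨j, hj⟩ with hv
      have hstep : (u ∈ M ∧ ∀ v : Fin n, v.1 < j + 1 → v ∈ M → u ≠ v →
          (c v < c u ∨ c v = c u ∧ v < u) → ¬ SamePart G M u v) ↔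
          (u ∈ M ∧ ∀ v : Fin n, v.1 < j → v ∈ M → u ≠ v →
          (c v < c u ∨ c v = c u ∧ v < u) → ¬ SamePart G M u v) ∧
          (u ∈ M → v ∈ M → u ≠ v → (c v < c u ∨ c v = c u ∧ v < u) → ¬ SamePart G M u v) := by
        constructor
        · rintro ⟨h1, h2⟩
          exact ⟨⟨h1, fun v hv => h2 v (by omega)⟩, fun _ => h2 v (by simp [hv])⟩
        · rintro ⟨⟨h1, h2⟩, h3⟩
          refine ⟨h1, fun y hy => ?_⟩
          rcases Nat.lt_succ_iff_lt_or_eq.1 hy with h' | h'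
          · exact h2 y h'
          · obtain rfl : y = v := Fin.ext h'
            exact h3 h1
      have hval : ((Expr.load 0 (.reg 10 + .reg 50) * .load 0 (.reg 10 + .reg 52) *
          (1 - .eq (.reg 50) (.reg 52)) * .lt 0
          (.lt (.load 0 (1 + .reg 2 + .reg 52)) (.load 0 (1 + .reg 2 + .reg 50)) +
            .eq (.load 0 (1 + .reg 2 + .reg 52)) (.load 0 (1 + .reg 2 + .reg 50)) *
              .lt (.reg 52) (.reg 50)))).eval s₂ =
          ind (((u ∈ M ∧ v ∈ M) ∧ u ≠ v) ∧ (c v < c u ∨ c v = c u ∧ v < u)) := by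
        simp only [Expr.eval_lt_ind, Expr.eval_add, Expr.eval_eq_ind, Expr.eval_mul, Expr.eval_reg,
          Expr.eval_load, Expr.eval_one, Expr.eval_sub, Expr.eval_zero, f2, f10, f50, f0, hr₂,
          hD.mem_apply hk, hD.mem_apply hj, hx.cost_apply hk, hx.cost_apply hj,
          one_sub_ind, ind_mul, Nat.add_pos_iff_pos_or_pos, ind_pos]
        simp only [hu, hv, ne_eq, Fin.mk.injEq, Fin.mk_lt_mk]
      refine Runs.ite hb₂ (fun hc => ?_) (fun hc => ?_)
      · rw [hval, ind_ne_zero] at hc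
        obtain ⟨⟨⟨c1, c2⟩, c3⟩, c4⟩ := hc
        refine Runs.seq (samePartProg_spec hb₂ f1 f2 f10 f0 hx hD hM hΛ (u := u) (v := v) f50 hr₂ c1 c2
          fun s₃ _ _ h => show s₃.reg 54 ≠ 0 ↔ _ from h) fun s₃ hb₃ hf₃ h₃ => ?_
        have f51 := hf₃.reg 51 rfl
        refine Runs.ite hb₃ (fun hc => Runs.asg hb₃ (by simp) ?_) (fun hc => Runs.asg hb₃ (by simp) ?_)
        · have hsame := h₃.1 hc
          rw [ind_congr hstep]
          simp only [Expr.eval_zero, State.setReg_reg, if_true]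
          exact (ind_eq_zero.2 fun h => h.2 c1 c2 c3 c4 hsame).symm
        · have hsame : ¬ SamePart G M u v := fun h => h₃.2 h hc
          rw [ind_congr hstep]
          simp only [Expr.eval_zero, State.setReg_reg]
          norm_num only [if_false]
          rw [f51, hI₂]
          exact ind_congr ⟨fun h => ⟨h, fun _ _ _ _ => hsame⟩, fun h => h.1⟩
      · rw [hval, ind_eq_zero] at hc
        refine Runs.asg hb₂ (by simp) ?_
        rw [ind_congr hstep]
        simp only [Expr.eval_zero, State.setReg_reg]
        norm_num only [if_false]
        rw [hI₂]
        exact ind_congr ⟨fun h => ⟨h, fun g1 g2 g3 g4 => absurd ⟨⟨⟨g1, g2⟩, g3⟩, g4⟩ hc⟩, fun h => h.1⟩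
    · rw [h]
      refine ind_congr ?_
      rw [mem_representatives_iff hM]
      exact ⟨fun h => ⟨h.1, fun v => h.2 v v.2⟩, fun h => ⟨h.1, fun v _ => h.2 v⟩⟩
  · intro s₂ hb₂ hf₂ h₂
    refine Runs.sto hb₂ (hb₂.reg 51) fun v hv => ?_
    have e9 : s₂.arr 9 = s'.arr 9 := by rw [hf₂.arr 9 rfl, hf₁.arr 9 rfl]
    have e50 : s₂.reg 50 = k := by rw [hf₂.reg 50 rfl, hf₁.reg 50 rfl, hr]
    simp only [State.setArr_arr, if_true, Function.update_apply, Expr.eval_reg, e50, h₂, e9]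
    split
    · next h =>
      have : v = u := Fin.ext h
      rw [this]
    · exact hI v (by omega)

end Parts

/-! ### The program for one tree decomposition -/

section Node

variable {Λ K : ℕ} {ω : ℕ → Bool} {s : State} {Q : State → Prop} {n : ℕ} {G : SimpleGraph (Fin n)}
  {c w : Fin n → ℕ} {l : ℕ} {b : ℤ} {x : ℕ → ℕ} {M : Set (Fin n)}
  {D : TreeDecomposition (modularQuotient (G.induce M))} {a : ℕ}

theorem TreeDecomposition.size_pos {V : Type*} {H : SimpleGraph V} (D : TreeDecomposition H) :
    0 < D.size := by
  obtain ⟨t⟩ := D.isTree.connected.nonempty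
  exact t.pos

/-- Search the tree of the tree decomposition. -/
def treeSearchProg : LP :=
  .seq (.asg 20 (.reg 12)) <| .seq (.asg 21 (.reg 13)) <| .seq (.asg 22 0) <|
  .seq (.loop false 53 13 (.sto 2 (.reg 53) (.load 0 (.reg 10 + .reg 1 + 1 + .reg 53)))) searchProg

theorem treeSearchProg_spec (hs : s.Bdd Λ) (h1 : s.reg 1 = n) (h10 : s.reg 10 = a)
    (h12 : s.reg 12 = D.size) (h13 : s.reg 13 = D.size * D.size) (h0 : s.arr 0 = x)
    (hD : DecData M D a x) (hΛ : D.size * D.size < Λ)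
    (hQ : ∀ s', s'.Bdd Λ → Frame treeSearchProg s s' → (∃ E, IsMatrixOf D.tree E ∧
      SearchInv D.size E 0 (s'.arr 1) (s'.arr 3) (s'.arr 4) (s'.arr 5) (s'.reg 23) ∧
      SearchClosed D.size E (s'.arr 1)) → Q s') :
    Runs Λ K ω treeSearchProg s Q := by
  suffices h : Runs Λ K ω treeSearchProg s (fun s' => ∃ E, IsMatrixOf D.tree E ∧
      SearchInv D.size E 0 (s'.arr 1) (s'.arr 3) (s'.arr 4) (s'.arr 5) (s'.reg 23) ∧
      SearchClosed D.size E (s'.arr 1)) from h.mono fun s' hb hf h => hQ s' hb hf h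
  refine Runs.asg_seq hs (hs.reg 12) fun hb => ?_
  refine Runs.asg_seq hb (hb.reg 13) fun hb => ?_
  refine Runs.asg_seq hb (by simp) fun hb => ?_
  generalize hs₁ : State.setReg _ 22 _ = s₁ at hb ⊢
  replace hs₁ := hs₁.symm
  have e1 : s₁.reg 1 = n := by simp [hs₁, h1]
  have e10 : s₁.reg 10 = a := by simp [hs₁, h10]
  have e13 : s₁.reg 13 = D.size * D.size := by simp [hs₁, h13]
  have e20 : s₁.reg 20 = D.size := by simp [hs₁, h12]
  have e21 : s₁.reg 21 = D.size * D.size := by simp [hs₁, h13]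
  have e22 : s₁.reg 22 = 0 := by simp [hs₁]
  have e0 : s₁.arr 0 = x := by simp [hs₁, h0]
  clear hs₁
  refine Runs.seq (P := fun s₂ => ∀ e < D.size * D.size, s₂.arr 2 e = x (a + n + 1 + e))
    (Runs.fill (f := fun e => x (a + n + 1 + e)) hb e13 hΛ.le rfl (fun e he t hreg ht _ => ⟨?_, ?_⟩)
      (fun _ _ _ h => h)) fun s₂ hb₂ hf₂ h₂ => ?_
  · simp only [Expr.eval_add, Expr.eval_reg, Expr.eval_load, Expr.eval_one, hreg,
      State.setReg_reg, ht 0 (by norm_num), e0]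
    norm_num only [if_true, if_false]
    rw [e10, e1]
  · rw [← e0]
    exact hb.arr 0 _
  · refine searchProg_spec hb₂ (by rw [hf₂.reg 20 rfl, e20]) (by rw [hf₂.reg 21 rfl, e21])
      (by rw [hf₂.reg 22 rfl, e22]) D.size_pos hΛ fun s₃ _ _ h h' => ⟨s₂.arr 2, ?_, h, h'⟩
    intro p hp q hq
    rw [h₂ _ (mul_add_lt hp hq), hD.tree ⟨p, hp⟩ ⟨q, hq⟩, ind_ne_zero]

/-- Compute the table of the bags. -/
def bagTableProg : LP :=
  .seq (.asg 53 (.reg 15 * .reg 1)) <| .loop false 54 53 <| .sto 10 (.reg 54)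
    (.lt 0 (.reg 54 / .reg 1) * .load 0 (.reg 10 + .reg 1 + 1 + .reg 13 +
      (.load 3 (.reg 54 / .reg 1) * .reg 1 + .reg 54 % .reg 1)) * .load 9 (.reg 54 % .reg 1))

theorem bagTableProg_spec (hs : s.Bdd Λ) (h1 : s.reg 1 = n) (h10 : s.reg 10 = a)
    (h13 : s.reg 13 = D.size * D.size) (h15 : s.reg 15 = D.size + 1)
    (h0 : s.arr 0 = x) (hD : DecData M D a x)
    (h9 : ∀ u : Fin n, s.arr 9 u = ind (u ∈ representatives G M c)) {ord : ℕ → ℕ}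
    (h3 : s.arr 3 = ord) (hord : ∀ i, 1 ≤ i → i ≤ D.size → ord i < D.size)
    (hΛ : (D.size + 1) * n < Λ)
    (hQ : ∀ s', s'.Bdd Λ → Frame bagTableProg s s' →
      (∀ i ≤ D.size, ∀ v : Fin n, s'.arr 10 (i * n + v) = ind (v ∈ orderedBag c D ord i)) → Q s') :
    Runs Λ K ω bagTableProg s Q := by
  have hlt : Λ < 2 ^ Λ := Nat.lt_two_pow_self
  suffices h : Runs Λ K ω bagTableProg s (fun s' => ∀ i ≤ D.size, ∀ v : Fin n,
      s'.arr 10 (i * n + v) = ind (v ∈ orderedBag c D ord i)) from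
    h.mono fun s' hb hf h => hQ s' hb hf h
  refine Runs.asg_seq hs (by simp [h15, h1]; omega) fun hb => ?_
  refine Runs.fill (N := (D.size + 1) * n)
    (f := fun e => ind (∃ h : e % n < n, ⟨e % n, h⟩ ∈ orderedBag c D ord (e / n)))
    hb (by simp [h15, h1]) hΛ.le rfl (fun e he t hreg ht _ => ⟨?_, ind_lt (by omega)⟩) ?_
  · have hn : 0 < n := Nat.pos_of_ne_zero fun h => by simp [h] at he
    have hv : e % n < n := Nat.mod_lt _ hn
    have hi : e / n ≤ D.size := Nat.lt_succ_iff.1 (Nat.div_lt_of_lt_mul (by rwa [mul_comm]))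
    have f1 : t.reg 1 = n := by rw [hreg]; simpa using h1
    have f10 : t.reg 10 = a := by rw [hreg]; simpa using h10
    have f13 : t.reg 13 = D.size * D.size := by rw [hreg]; simpa using h13
    have f54 : t.reg 54 = e := by rw [hreg]; simp
    have f0 : t.arr 0 = x := by rw [ht 0 (by norm_num)]; simpa using h0
    have f3 : t.arr 3 = ord := by rw [ht 3 (by norm_num)]; simpa using h3
    have f9 : t.arr 9 (e % n) = ind (⟨e % n, hv⟩ ∈ representatives G M c) := by
      rw [ht 9 (by norm_num)]; exact h9 ⟨e % n, hv⟩
    simp only [Expr.eval_add, Expr.eval_mul, Expr.eval_reg, Expr.eval_load, Expr.eval_one,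
      Expr.eval_zero, Expr.eval_div, Expr.eval_mod, Expr.eval_lt_ind, f1, f10, f13, f54, f0, f3, f9]
    -- Row 0 of the table is the empty bag that serves as parent of the root; the order of discovery
    -- starts at position 1.
    rcases Nat.eq_zero_or_pos (e / n) with h | h
    · rw [h]
      simp only [lt_irrefl]
      rw [ind_eq_zero.2 id, zero_mul, zero_mul, eq_comm, ind_eq_zero]
      rintro ⟨_, h⟩
      simp [orderedBag] at h
    · have ho := hord _ h hi
      have := hD.bag ⟨_, ho⟩ ⟨_, hv⟩
      simp only at this
      rw [this, ind_true h, one_mul, ind_mul]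
      refine ind_congr ?_
      simp only [orderedBag, if_neg h.ne', mem_representativeBag ho, hv, exists_true_left]
      exact and_comm
  · intro s' _ _ h i hi v
    rw [h _ (mul_add_lt (Nat.lt_succ_of_le hi) v.2)]
    refine ind_congr ?_
    simp only [mul_add_div_of_lt v.2, mul_add_mod_of_lt' v.2, v.2, exists_true_left]

/-- Look for a coefficient of the generating function that shows that there is a solution. -/
def extractProg : LP :=
  .seq (.asg 55 (.load 12 1 % .reg 8)) <| .seq (.asg 56 0) <| .loop false 57 9 <|
    .seq (.ite (.eq (.reg 55 % 4) 2 * (1 - .lt (.load 0 (1 + .reg 2 + .reg 1))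
      (.reg 57 / .reg 5 + .load 0 (1 + .reg 2 + .reg 1 + 1)))) (.asg 56 1) (.asg 27 0)) <|
    .asg 55 (.reg 55 / .reg 7)

theorem extractProg_spec {E : Fin n → ℕ} (hs : s.Bdd Λ) (hT : Tables E l s) (h0 : s.arr 0 = x)
    (hx : GraphData G c b x) {Z : ℕ} (hZ : s.arr 12 1 % (16 ^ n) ^ (∑ v, E v + 1) = Z)
    (hΛ : ∑ v, E v + 1 < Λ)
    (hQ : ∀ s', s'.Bdd Λ → Frame extractProg s s' → (s'.reg 56 ≠ 0 ↔ ∃ i < ∑ v, E v + 1,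
      Z / (16 ^ n) ^ i % 4 = 2 ∧ ((i / weightBase n l : ℕ) : ℤ) ≤ b) → Q s') :
    Runs Λ K ω extractProg s Q := by
  have hone : 1 < 2 ^ Λ := Nat.one_lt_two_pow (by omega)
  suffices h : Runs Λ K ω extractProg s (fun s' => s'.reg 56 ≠ 0 ↔ ∃ i < ∑ v, E v + 1,
      Z / (16 ^ n) ^ i % 4 = 2 ∧ ((i / weightBase n l : ℕ) : ℤ) ≤ b) from
    h.mono fun s' hb hf h => hQ s' hb hf h
  have hval : (Expr.load 12 1 % .reg 8 : Expr).eval s = Z := by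
    simp [hT.r8, hZ]
  refine Runs.asg_seq hs (by rw [hval, ← hZ]; exact (Nat.mod_le _ _).trans_lt (hs.arr _ _)) fun hb => ?_
  refine Runs.asg_seq hb (by simp) fun hb => ?_
  -- Successive division by `z` shifts the digit of `z ^ k` to the last place, where it is inspected
  -- modulo 4.
  refine Runs.loop (I := fun k s' => s'.reg 55 = Z / (16 ^ n) ^ k ∧ (s'.reg 56 ≠ 0 ↔ ∃ i < k,
    Z / (16 ^ n) ^ i % 4 = 2 ∧ ((i / weightBase n l : ℕ) : ℤ) ≤ b)) hb (by simpa using hT.r9) hΛ.le rfl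
    (fun k s' a h => by simpa using h) (by rw [hval]; simp) ?_ (fun s' _ _ h => h.2)
  intro k hk s' hb hf hr hI
  have e1 : s'.reg 1 = n := by rw [hf.reg 1 rfl]; simpa using hT.r1
  have e2 : s'.reg 2 = n * n := by rw [hf.reg 2 rfl]; simpa using hT.r2
  have e5 : s'.reg 5 = weightBase n l := by rw [hf.reg 5 rfl]; simpa using hT.r5
  have e7 : s'.reg 7 = 16 ^ n := by rw [hf.reg 7 rfl]; simpa using hT.r7
  have e0 : s'.arr 0 = x := by rw [hf.arr 0 rfl]; simpa using h0
  have hval₂ : (Expr.eq (.reg 55 % 4) 2 * (1 - .lt (.load 0 (1 + .reg 2 + .reg 1))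
      (.reg 57 / .reg 5 + .load 0 (1 + .reg 2 + .reg 1 + 1)))).eval s' =
      ind (Z / (16 ^ n) ^ k % 4 = 2 ∧ ((k / weightBase n l : ℕ) : ℤ) ≤ b) := by
    simp only [Expr.eval_add, Expr.eval_mul, Expr.eval_sub, Expr.eval_reg, Expr.eval_load,
      Expr.eval_one, Expr.eval_two, Expr.eval_four, Expr.eval_div, Expr.eval_mod, Expr.eval_lt_ind,
      Expr.eval_eq_ind, e1, e2, e5, e0, hr, hI.1, hx.budget, hx.neg_budget, one_sub_ind, ind_mul]
    refine ind_congr (and_congr_right fun _ => ?_)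
    omega
  have hstep : (∃ i < k + 1, Z / (16 ^ n) ^ i % 4 = 2 ∧ ((i / weightBase n l : ℕ) : ℤ) ≤ b) ↔
      s'.reg 56 ≠ 0 ∨ (Z / (16 ^ n) ^ k % 4 = 2 ∧ ((k / weightBase n l : ℕ) : ℤ) ≤ b) := by
    rw [hI.2]
    constructor
    · rintro ⟨i, hi, h⟩
      rcases Nat.lt_succ_iff_lt_or_eq.1 hi with h' | rfl
      exacts [Or.inl ⟨i, h', h⟩, Or.inr h]
    · rintro (⟨i, hi, h⟩ | h)
      exacts [⟨i, by omega, h⟩, ⟨k, by omega, h⟩]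
  refine Runs.seq (P := fun s₁ => s₁.reg 55 = Z / (16 ^ n) ^ k ∧ (s₁.reg 56 ≠ 0 ↔ ∃ i < k + 1,
      Z / (16 ^ n) ^ i % 4 = 2 ∧ ((i / weightBase n l : ℕ) : ℤ) ≤ b))
    (Runs.ite hb (fun hc => Runs.asg hb (by simpa using hone) ⟨by simpa using hI.1, ?_⟩)
      (fun hc => Runs.asg hb (by simp) ⟨by simpa using hI.1, ?_⟩)) fun s₁ hb₁ hf₁ h₁ => ?_
  · rw [hval₂, ind_ne_zero] at hc
    rw [hstep]
    exact iff_of_true (by simp) (Or.inr hc)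
  · rw [hval₂, ind_eq_zero] at hc
    rw [hstep, or_iff_left hc]
    simp
  · have hv : (Expr.reg 55 / .reg 7 : Expr).eval s₁ = Z / (16 ^ n) ^ (k + 1) := by
      simp only [Expr.eval_div, Expr.eval_reg, h₁.1, hf₁.reg 7 rfl, e7]
      rw [Nat.div_div_eq_div_mul, pow_succ]
    refine Runs.asg hb₁ (by
      rw [Expr.eval_div]; exact (Nat.div_le_self _ _).trans_lt (hb₁.reg 55)) ⟨by simpa using hv, ?_⟩
    simpa using h₁.2

/-- The program for one tree decomposition. -/
def decProg : LP :=
  .seq (.asg 12 (.load 0 (.reg 10 + .reg 1))) <| .seq (.asg 13 (.reg 12 * .reg 12)) <|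
  .seq (.asg 15 (.reg 12 + 1)) <| .seq joinedProg <| .seq representativesProg <|
  .seq treeSearchProg <| .seq bagTableProg <| .seq treeProg <| .seq extractProg <|
  .seq (.ite (.reg 56 * .eq (.reg 14) 0) (.asg 0 1) (.asg 27 0)) <|
  .asg 10 (.reg 10 + .reg 1 + 1 + .reg 13 + .reg 12 * .reg 1)

/-- The answer register is only ever set to 1, so answers accumulate as a disjunction. Register `10`
is moved past the description just read, to the next one. -/
theorem decProg_spec {k : ℕ} (hs : s.Bdd Λ) (hT : Tables (combinedWeight c w l) l s)
    (h10 : s.reg 10 = a) (h0 : s.arr 0 = x) (hx : GraphData G c b x) (hD : DecData M D a x)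
    (hM : IsPrimeGraph (modularQuotient (G.induce M))) (hk : D.WidthAtMost k) (hK : 4 ^ (k + 1) ≤ K)
    (hn0 : 0 < n) (hn : 2 * n < Λ) (hnn : n * n < Λ) (hss : D.size * D.size < Λ)
    (hsn : (D.size + 1) * n < Λ) (hE : ∑ v, combinedWeight c w l v + 1 < Λ)
    (ha : a + n + 1 + D.size * D.size + D.size * n < 2 ^ Λ)
    (hQ : ∀ s', s'.Bdd Λ → Frame decProg s s' →
      (s'.reg 0 ≠ 0 ↔ s.reg 0 ≠ 0 ∨ NodeAccepts G c b w l M) →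
      s'.reg 10 = a + n + 1 + D.size * D.size + D.size * n → Q s') :
    Runs Λ K ω decProg s Q := by
  set E := combinedWeight c w l with hEdef
  set T := ∑ v, E v with hTdef
  have hlt : Λ < 2 ^ Λ := Nat.lt_two_pow_self
  have hs1 : D.size + 1 < Λ := lt_of_le_of_lt (Nat.le_mul_of_pos_right _ hn0) hsn
  have hone : 1 < 2 ^ Λ := by omega
  suffices h : Runs Λ K ω decProg s (fun s' => (s'.reg 0 ≠ 0 ↔ s.reg 0 ≠ 0 ∨ NodeAccepts G c b w l M) ∧
      s'.reg 10 = a + n + 1 + D.size * D.size + D.size * n) from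
    h.mono fun s' hb hf h => hQ s' hb hf h.1 h.2
  have hsize : (Expr.load 0 (.reg 10 + .reg 1) : Expr).eval s = D.size := by
    simp [h10, h0, hT.r1, hD.size]
  refine Runs.seq (P := fun s₁ => s₁.reg 12 = D.size) (Runs.asg hs (hs.arr _ _) (by rw [hsize]; simp))
    fun s₁ hb₁ hf₁ h₁ => ?_
  refine Runs.seq (P := fun s₂ => s₂.reg 13 = D.size * D.size) (Runs.asg hb₁ (by simp [h₁]; omega)
    (by simp [h₁])) fun s₂ hb₂ hf₂ h₂ => ?_
  have e12₂ : s₂.reg 12 = D.size := by rw [hf₂.reg 12 rfl, h₁]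
  refine Runs.seq (P := fun s₃ => s₃.reg 15 = D.size + 1) (Runs.asg hb₂ (by simp [e12₂]; omega)
    (by simp [e12₂])) fun s₃ hb₃ hf₃ h₃ => ?_
  have hT₃ := ((hT.of_frame hf₁ rfl).of_frame hf₂ rfl).of_frame hf₃ rfl
  have e0₃ : s₃.reg 0 = s.reg 0 := by rw [hf₃.reg 0 rfl, hf₂.reg 0 rfl, hf₁.reg 0 rfl]
  have e10₃ : s₃.reg 10 = a := by rw [hf₃.reg 10 rfl, hf₂.reg 10 rfl, hf₁.reg 10 rfl, h10]
  have e12₃ : s₃.reg 12 = D.size := by rw [hf₃.reg 12 rfl, e12₂]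
  have e13₃ : s₃.reg 13 = D.size * D.size := by rw [hf₃.reg 13 rfl, h₂]
  have a0₃ : s₃.arr 0 = x := by rw [hf₃.arr 0 rfl, hf₂.arr 0 rfl, hf₁.arr 0 rfl, h0]
  refine Runs.seq (joinedProg_spec hb₃ hT₃.r1 hT₃.r2 e10₃ a0₃ hx hD hnn fun s₄ _ _ h =>
    show s₄.reg 14 ≠ 0 ↔ _ from h) fun s₄ hb₄ hf₄ h₄ => ?_
  have hT₄ := hT₃.of_frame hf₄ rfl
  refine Runs.seq (representativesProg_spec hb₄ hT₄.r1 hT₄.r2 (by rw [hf₄.reg 10 rfl, e10₃])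
    (by rw [hf₄.arr 0 rfl, a0₃]) hx hD hM hnn fun s₅ _ _ h =>
      show ∀ u : Fin n, s₅.arr 9 u = _ from h) fun s₅ hb₅ hf₅ h₅ => ?_
  have hT₅ := hT₄.of_frame hf₅ rfl
  have e10₅ : s₅.reg 10 = a := by rw [hf₅.reg 10 rfl, hf₄.reg 10 rfl, e10₃]
  have e12₅ : s₅.reg 12 = D.size := by rw [hf₅.reg 12 rfl, hf₄.reg 12 rfl, e12₃]
  have e13₅ : s₅.reg 13 = D.size * D.size := by rw [hf₅.reg 13 rfl, hf₄.reg 13 rfl, e13₃]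
  have e15₅ : s₅.reg 15 = D.size + 1 := by rw [hf₅.reg 15 rfl, hf₄.reg 15 rfl, h₃]
  have a0₅ : s₅.arr 0 = x := by rw [hf₅.arr 0 rfl, hf₄.arr 0 rfl, a0₃]
  refine Runs.seq (treeSearchProg_spec hb₅ hT₅.r1 e10₅ e12₅ e13₅ a0₅ hD hss fun s₆ _ _ h =>
    show ∃ E, IsMatrixOf D.tree E ∧
      SearchInv D.size E 0 (s₆.arr 1) (s₆.arr 3) (s₆.arr 4) (s₆.arr 5) (s₆.reg 23) ∧
      SearchClosed D.size E (s₆.arr 1) from h) fun s₆ hb₆ hf₆ h₆ => ?_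
  obtain ⟨A, hA, hinv, hclosed⟩ := h₆
  have hT₆ := hT₅.of_frame hf₆ rfl
  have e10₆ : s₆.reg 10 = a := by rw [hf₆.reg 10 rfl, e10₅]
  have e15₆ : s₆.reg 15 = D.size + 1 := by rw [hf₆.reg 15 rfl, e15₅]
  have e13₆ : s₆.reg 13 = D.size * D.size := by rw [hf₆.reg 13 rfl, e13₅]
  have a0₆ : s₆.arr 0 = x := by rw [hf₆.arr 0 rfl, a0₅]
  have hcnt := hinv.cnt_eq D.isTree.connected D.size_pos hA hclosed
  set ord := s₆.arr 3 with hord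
  refine Runs.seq (bagTableProg_spec (c := c) hb₆ hT₆.r1 e10₆ e13₆ e15₆ a0₆ hD
    (by rw [hf₆.arr 9 rfl]; exact h₅) hord.symm
    (fun i h1 h2 => (hinv.of_ord i h1 (by rwa [hcnt])).1) hsn fun s₇ _ _ h =>
      show ∀ i ≤ D.size, ∀ v : Fin n, s₇.arr 10 (i * n + v) = ind (v ∈ orderedBag c D ord i) from h)
    fun s₇ hb₇ hf₇ h₇ => ?_
  have hT₇ := hT₆.of_frame hf₇ rfl
  -- The modulus of the dynamic program; it exceeds the partition function by
  -- `partitionFunction_lt`.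
  have hz : 1 < (16 ^ n) ^ (T + 1) := Nat.one_lt_pow (by omega) (Nat.one_lt_pow hn0.ne' (by norm_num))
  have hmem : TreeMem G (16 ^ n) E (orderedBag c D ord) (s₆.arr 5) D.size ((16 ^ n) ^ (T + 1)) s₇ := by
    refine ⟨hT₇.r1, hT₇.r2, hT₇.r8, by rw [hf₇.reg 12 rfl, hf₆.reg 12 rfl, e12₅],
      by rw [hf₇.reg 15 rfl, e15₆], fun u hu v hv => ?_, fun v hv => hT₇.weight ⟨v, hv⟩,
      fun i hi v hv => ?_, by rw [hf₇.arr 5 rfl]⟩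
    · rw [hf₇.arr 0 rfl, a0₆, hx.adj_apply hu hv, ind_eq_one, ind_eq_zero]
      simpa using em _
    · rw [ite_eq_ind]
      exact h₇ i hi ⟨v, hv⟩
  have hbag : BagTree D.size (orderedBag c D ord) (s₆.arr 5) := hinv.bagTree D.size_pos hA hclosed
  refine Runs.seq (treeProg_spec hb₇ hmem hbag hn (by omega) hnn.le hs1.le hz
    (fun i _ => (Nat.pow_le_pow_right (by norm_num) (card_orderedBag_le hk i)).trans hK)
    (hinv.biUnion_orderedBag D.size_pos hA hclosed)
    (fun u hu v hv huv => hinv.exists_orderedBag D.size_pos hA hclosed hu hv huv)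
    (partitionFunction_lt (twelve_pow_lt hn0 _) E)
    fun s₈ _ _ h => show s₈.arr 12 1 % _ = _ from h) fun s₈ hb₈ hf₈ h₈ => ?_
  have hT₈ := hT₇.of_frame hf₈ rfl
  have a0₈ : s₈.arr 0 = x := by rw [hf₈.arr 0 rfl, hf₇.arr 0 rfl, a0₆]
  refine Runs.seq (extractProg_spec hb₈ hT₈ a0₈ hx h₈ hE fun s₉ _ _ h =>
    show s₉.reg 56 ≠ 0 ↔ _ from h) fun s₉ hb₉ hf₉ h₉ => ?_
  have e14 : s₉.reg 14 ≠ 0 ↔ ¬ ∀ u ∈ M, ∀ v ∉ M, G.Adj u v := by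
    rw [hf₉.reg 14 rfl, hf₈.reg 14 rfl, hf₇.reg 14 rfl, hf₆.reg 14 rfl, hf₅.reg 14 rfl, h₄]
  have e0 : s₉.reg 0 = s.reg 0 := by
    rw [hf₉.reg 0 rfl, hf₈.reg 0 rfl, hf₇.reg 0 rfl, hf₆.reg 0 rfl, hf₅.reg 0 rfl, hf₄.reg 0 rfl, e0₃]
  have e1 : s₉.reg 1 = n := (hT₈.of_frame hf₉ rfl).r1
  have e10 : s₉.reg 10 = a := by rw [hf₉.reg 10 rfl, hf₈.reg 10 rfl, hf₇.reg 10 rfl, e10₆]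
  have e12 : s₉.reg 12 = D.size := by
    rw [hf₉.reg 12 rfl, hf₈.reg 12 rfl, hf₇.reg 12 rfl, hf₆.reg 12 rfl, e12₅]
  have e13 : s₉.reg 13 = D.size * D.size := by
    rw [hf₉.reg 13 rfl, hf₈.reg 13 rfl, hf₇.reg 13 rfl, e13₆]
  have hval : (Expr.reg 56 * .eq (.reg 14) 0 : Expr).eval s₉ ≠ 0 ↔ NodeAccepts G c b w l M := by
    rw [Expr.eval_mul, Expr.eval_eq_ind, mul_ne_zero_iff, ind_ne_zero, Expr.eval_reg, h₉, NodeAccepts,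
      and_comm]
    refine and_congr_left fun _ => ?_
    rw [Expr.eval_reg, Expr.eval_zero, ← not_iff_not]
    exact e14
  refine Runs.seq (P := fun s' => s'.reg 0 ≠ 0 ↔ s.reg 0 ≠ 0 ∨ NodeAccepts G c b w l M)
    (Runs.ite hb₉ (fun hc => Runs.asg hb₉ (by simpa using hone) ?_)
      (fun hc => Runs.asg hb₉ (by simp) ?_)) fun s' hb hf h => ?_
  · simp [hval.1 hc]
  · have : ¬ NodeAccepts G c b w l M := fun h => hval.2 h hc
    simp [this, e0]
  · have hv : (Expr.reg 10 + .reg 1 + 1 + .reg 13 + .reg 12 * .reg 1 : Expr).eval s' =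
        a + n + 1 + D.size * D.size + D.size * n := by
      simp [hf.reg 10 rfl, hf.reg 1 rfl, hf.reg 13 rfl, hf.reg 12 rfl, e10, e1, e13, e12]
    refine Runs.asg hb (by rwa [hv]) ⟨by simpa using h, by rw [hv]; simp⟩

end Node

/-! ### The encoding of the input -/

section Encoding

theorem length_bits {m : ℕ} (p : Fin m → Prop) : (bits p).length = m := by simp [bits]

theorem getD_bits {m : ℕ} (p : Fin m → Prop) (i : Fin m) : (bits p).getD i 0 = ind (p i) := by
  simp [bits, ind]

theorem length_flatMap_finRange {m k : ℕ} {f : Fin m → List ℕ} (hf : ∀ i, (f i).length = k) :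
    ((List.finRange m).flatMap f).length = m * k := by
  simp [List.length_flatMap, hf]

theorem getD_flatMap_finRange {m k : ℕ} {f : Fin m → List ℕ} (hf : ∀ i, (f i).length = k) (t : Fin m)
    {j : ℕ} (hj : j < k) : ((List.finRange m).flatMap f).getD (t * k + j) 0 = (f t).getD j 0 := by
  induction m with
  | zero => exact t.elim0
  | succ m ih =>
    rw [List.finRange_succ, List.flatMap_cons, List.flatMap_map]
    refine Fin.cases ?_ (fun t => ?_) t
    · rw [List.getD_append _ _ _ _ (by simpa [hf] using hj)]
      simp
    · have hle : (f 0).length ≤ (t.succ : ℕ) * k + j := by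
        rw [hf, Fin.val_succ, Nat.succ_mul]; omega
      rw [List.getD_append_right _ _ _ _ hle, hf]
      have : (t.succ : ℕ) * k + j - k = t * k + j := by
        rw [Fin.val_succ, Nat.succ_mul]; omega
      rw [this]
      exact ih (f := fun i => f i.succ) (fun i => hf _) t

theorem length_encodeGraph {m : ℕ} (G : SimpleGraph (Fin m)) : (encodeGraph G).length = m * m :=
  length_flatMap_finRange fun _ => length_bits _

theorem getD_encodeGraph {m : ℕ} (G : SimpleGraph (Fin m)) (u v : Fin m) :
    (encodeGraph G).getD (u * m + v) 0 = ind (G.Adj u v) := by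
  rw [encodeGraph, getD_flatMap_finRange (fun _ => length_bits _) u v.2, getD_bits]

section Dec

variable {n : ℕ} {G : SimpleGraph (Fin n)} (M : Set (Fin n))
  (D : TreeDecomposition (modularQuotient (G.induce M)))

theorem length_encodeDec :
    (encodeDec M D).length = n + 1 + D.size * D.size + D.size * n := by
  simp only [encodeDec, List.length_append, length_bits, length_encodeGraph, List.length_singleton]
  rw [length_flatMap_finRange fun _ => length_bits _]

/-- The four pieces of an encoded decomposition have lengths `n`, `1`, `D.size * D.size` and `D.size
* n`; these are the offsets that the program adds to the address. -/
theorem decData_of_getD {a : ℕ} {x : ℕ → ℕ}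
    (h : ∀ i < (encodeDec M D).length, x (a + i) = (encodeDec M D).getD i 0) : DecData M D a x := by
  rw [length_encodeDec] at h
  have hl1 : (bits fun v => v ∈ M).length = n := length_bits _
  have hl2 : ((bits fun v => v ∈ M) ++ [D.size]).length = n + 1 := by simp [hl1]
  have hl3 : ((bits fun v => v ∈ M) ++ [D.size] ++ encodeGraph D.tree).length =
      n + 1 + D.size * D.size := by simp [hl1, length_encodeGraph]; omega
  refine ⟨fun v => ?_, ?_, fun t t' => ?_, fun t v => ?_⟩
  · have hv := v.2
    rw [h _ (by omega), encodeDec, List.getD_append _ _ _ _ (by omega),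
      List.getD_append _ _ _ _ (by omega), List.getD_append _ _ _ _ (by omega), getD_bits]
  · rw [h _ (by omega), encodeDec, List.getD_append _ _ _ _ (by omega),
      List.getD_append _ _ _ _ (by omega), List.getD_append_right _ _ _ _ (by omega), hl1]
    simp
  · have ht := mul_add_lt t.2 t'.2
    rw [add_assoc, add_assoc, h _ (by omega), encodeDec, List.getD_append _ _ _ _ (by omega),
      List.getD_append_right _ _ _ _ (by omega), hl2, ← getD_encodeGraph]
    congr 1
    omega
  · have ht := mul_add_lt t.2 v.2
    rw [add_assoc, add_assoc, add_assoc, h _ (by omega), encodeDec,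
      List.getD_append_right _ _ _ _ (by omega), hl3,
      ← getD_bits (fun v => ∃ h : v ∈ M, ∃ P ∈ D.bag t, (⟨v, h⟩ : M) ∈ P.1) v,
      ← getD_flatMap_finRange (f := fun t => bits fun v => ∃ h : v ∈ M, ∃ P ∈ D.bag t,
        (⟨v, h⟩ : M) ∈ P.1) (fun _ => length_bits _) t v.2]
    congr 1
    omega

end Dec

theorem getD_flatMap_take {α : Type*} (L : List α) (f : α → List ℕ) {j : ℕ} (hj : j < L.length) {i : ℕ}
    (hi : i < (f L[j]).length) :
    (L.flatMap f).getD (((L.take j).flatMap f).length + i) 0 = (f L[j]).getD i 0 := by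
  conv_lhs => rw [← List.take_append_drop j L, List.drop_eq_getElem_cons hj]
  rw [List.flatMap_append, List.flatMap_cons, List.getD_append_right _ _ _ _ (by simp),
    List.getD_append _ _ _ _ (by simpa using hi)]
  congr 1
  simp

theorem length_flatMap_take_succ {α : Type*} (L : List α) (f : α → List ℕ) {j : ℕ}
    (hj : j < L.length) : ((L.take (j + 1)).flatMap f).length =
      ((L.take j).flatMap f).length + (f L[j]).length := by
  rw [List.take_add_one, List.getElem?_eq_getElem hj, List.flatMap_append, List.length_append]
  simp only [Option.toList_some, List.flatMap_singleton]

namespace Input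

variable (I : Input)

/-- The input word as a sequence. -/
noncomputable def word (i : ℕ) : ℕ := I.encode.getD i 0

/-- The part of the input word that precedes the tree decompositions. -/
noncomputable def encodeHead : List ℕ :=
  [I.n] ++ encodeGraph I.graph ++ List.ofFn I.cost ++ [I.budget.toNat, (-I.budget).toNat] ++
    [I.decs.length]

/-- The part of the input word that describes the tree decompositions. -/
noncomputable def encodeDecs : List ℕ := I.decs.flatMap fun D => encodeDec D.1.1 D.2

theorem encode_eq : I.encode = I.encodeHead ++ I.encodeDecs := rfl

theorem length_encodeHead : I.encodeHead.length = 1 + I.n * I.n + I.n + 3 := by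
  simp [encodeHead, length_encodeGraph]; omega

theorem length_encode : I.encode.length = 1 + I.n * I.n + I.n + 3 + I.encodeDecs.length := by
  rw [encode_eq, List.length_append, length_encodeHead]

theorem word_head {i : ℕ} (hi : i < 1 + I.n * I.n + I.n + 3) : I.word i = I.encodeHead.getD i 0 := by
  rw [word, encode_eq, List.getD_append _ _ _ _ (by rwa [length_encodeHead])]

theorem graphData : GraphData I.graph I.cost I.budget I.word := by
  have l1 : ([I.n] ++ encodeGraph I.graph).length = 1 + I.n * I.n := by
    simp [length_encodeGraph]; omega
  have l2 : ([I.n] ++ encodeGraph I.graph ++ List.ofFn I.cost).length = 1 + I.n * I.n + I.n := by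
    rw [List.length_append, l1, List.length_ofFn]
  have l3 : ([I.n] ++ encodeGraph I.graph ++ List.ofFn I.cost ++
      [I.budget.toNat, (-I.budget).toNat]).length = 1 + I.n * I.n + I.n + 2 := by
    rw [List.length_append, l2]; rfl
  refine ⟨?_, fun u v => ?_, fun v => ?_, ?_, ?_⟩
  · rw [word_head _ (by omega)]
    rfl
  · have := mul_add_lt u.2 v.2
    rw [word_head _ (by omega), encodeHead, List.getD_append _ _ _ _ (by omega),
      List.getD_append _ _ _ _ (by omega), List.getD_append _ _ _ _ (by omega),
      List.getD_append_right _ _ _ _ (by simp), ← getD_encodeGraph]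
    congr 1
    simp
  · have := v.2
    rw [word_head _ (by omega), encodeHead, List.getD_append _ _ _ _ (by omega),
      List.getD_append _ _ _ _ (by omega), List.getD_append_right _ _ _ _ (by omega), l1]
    simp
  · rw [word_head _ (by omega), encodeHead, List.getD_append _ _ _ _ (by omega),
      List.getD_append_right _ _ _ _ (by omega), l2]
    simp
  · rw [word_head _ (by omega), encodeHead, List.getD_append _ _ _ _ (by omega),
      List.getD_append_right _ _ _ _ (by omega), l2]
    simp

theorem word_length : I.word (1 + I.n * I.n + I.n + 2) = I.decs.length := by
  have l3 : ([I.n] ++ encodeGraph I.graph ++ List.ofFn I.cost ++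
      [I.budget.toNat, (-I.budget).toNat]).length = 1 + I.n * I.n + I.n + 2 := by
    simp [length_encodeGraph]; omega
  rw [word_head _ (by omega), encodeHead, List.getD_append_right _ _ _ _ (by omega), l3]
  simp

/-- The address of the description of a tree decomposition. -/
noncomputable def address (j : ℕ) : ℕ :=
  1 + I.n * I.n + I.n + 3 + ((I.decs.take j).flatMap fun D => encodeDec D.1.1 D.2).length

theorem address_zero : I.address 0 = 1 + I.n * I.n + I.n + 3 := by simp [address]

theorem address_succ {j : ℕ} (hj : j < I.decs.length) : I.address (j + 1) = I.address j + I.n + 1 +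
    I.decs[j].2.size * I.decs[j].2.size + I.decs[j].2.size * I.n := by
  rw [address, address, length_flatMap_take_succ _ _ hj, length_encodeDec]
  ring

theorem address_le (j : ℕ) : I.address j ≤ I.encode.length := by
  rw [length_encode, address, encodeDecs]
  refine Nat.add_le_add_left ?_ _
  conv_rhs => rw [← List.take_append_drop j I.decs]
  rw [List.flatMap_append, List.length_append]
  exact Nat.le_add_right _ _

/-- Each description has at least one entry, so the length of the list is bounded by the input
length; this makes the outer loop polynomial. -/
theorem le_address (j : ℕ) (hj : j ≤ I.decs.length) : j ≤ I.address j := by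
  induction j with
  | zero => exact Nat.zero_le _
  | succ j ih =>
    have := ih (by omega)
    rw [address_succ _ hj]
    omega

theorem decData {j : ℕ} (hj : j < I.decs.length) :
    DecData I.decs[j].1.1 I.decs[j].2 (I.address j) I.word := by
  refine decData_of_getD _ _ fun i hi => ?_
  rw [word, encode_eq, address, List.getD_append_right _ _ _ _ (by rw [length_encodeHead]; omega),
    length_encodeHead, encodeDecs,
    ← getD_flatMap_take I.decs (fun D => encodeDec D.1.1 D.2) hj hi]
  congr 1
  omega

theorem word_lt (i : ℕ) : I.word i < 2 ^ bitLength I.encode := by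
  rw [← Nat.size_le, word]
  rcases lt_or_ge i I.encode.length with h | h
  · rw [List.getD_eq_getElem _ _ h, bitLength]
    have := List.single_le_sum (l := I.encode.map fun a => a.size + 1) (by simp)
      (I.encode[i].size + 1) (List.mem_map.2 ⟨_, List.getElem_mem h, rfl⟩)
    omega
  · rw [List.getD_eq_default _ _ h]
    simp

theorem length_le_bitLength (x : List ℕ) : x.length ≤ bitLength x := by
  induction x with
  | nil => simp
  | cons a x ih => simp only [bitLength, List.map_cons, List.sum_cons, List.length_cons] at ih ⊢; omega

end Input

end Encoding

/-! ### The whole program -/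

/-- The Monte-Carlo algorithm. -/
def mainProg : LP :=
  .seq (.asg 1 (.load 0 0)) <| .seq (.asg 2 (.reg 1 * .reg 1)) <| .seq bitCountProg <|
  .seq coinProg <| .seq weightTableProg <| .seq pairProg <|
  .seq (.asg 10 (1 + .reg 2 + .reg 1 + 3)) <| .seq (.asg 11 (.load 0 (1 + .reg 2 + .reg 1 + 2))) <|
  .loop false 45 11 decProg

/-- The number of bits needed for the entries of the memory, for inputs of length `N` with vertices
of total cost at most `C`. -/
def memoryBound (N C : ℕ) : ℕ :=
  4 * N * (C * (4 * (N * N) + 1) + 4 * (N * N) + 1) + 4 * (N * N) + 4 * N + 1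

/-- The result does not mention the bounds `Λ`, `K` and `k`; these serve only to guarantee
termination in time. -/
theorem mainProg_spec (I : Input) {Λ K k : ℕ} {ω : ℕ → Bool}
    (hk : ∀ D ∈ I.decs, D.2.WidthAtMost k) (hK : 4 ^ (k + 1) ≤ K)
    (hΛ : memoryBound (bitLength I.encode) (∑ v, I.cost v) ≤ Λ) :
    Runs Λ K ω mainProg (State.start I.encode)
      (fun s' => s'.reg 0 ≠ 0 ↔ I.Answer (coinWeight ω (bitCount I.n)) (bitCount I.n)) := by
  set N := bitLength I.encode with hN
  set l := bitCount I.n with hl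
  set w : Fin I.n → ℕ := coinWeight ω l with hw
  have hpos : 0 < I.n := I.pos
  have hlen : I.encode.length ≤ N := Input.length_le_bitLength _
  have hlen' := I.length_encode
  have hnN : 1 + I.n * I.n + I.n + 3 ≤ N := by omega
  have hnn : I.n ≤ I.n * I.n := Nat.le_mul_self I.n
  have hNN : I.n * I.n ≤ N * N := Nat.mul_le_mul (by omega) (by omega)
  have hpow := pow_bitCount_le hpos
  have hn2l : I.n * 2 ^ l ≤ 4 * (I.n * I.n) := by nlinarith
  have hbase : weightBase I.n l ≤ 4 * (N * N) + 1 := by unfold weightBase; omega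
  -- The base for combined weights is `n * 2 ^ l + 1`, and `2 ^ l ≤ 4 * n`; total weights stay below
  -- it. This explains the shape of `memoryBound`.
  have hE : ∑ v, combinedWeight I.cost w l v ≤ (∑ v, I.cost v) * (4 * (N * N) + 1) + 4 * (N * N) := by
    rw [sum_combinedWeight]
    have h1 := sum_weight_lt (w := w) (l := l) (fun v => bitsValue_lt _ _ _) Finset.univ
    have h2 : (∑ v, I.cost v) * weightBase I.n l ≤ (∑ v, I.cost v) * (4 * (N * N) + 1) := Nat.mul_le_mul_left _ hbase
    omega
  have hE' : 4 * I.n * (∑ v, combinedWeight I.cost w l v + 1) < Λ := by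
    refine lt_of_lt_of_le ?_ hΛ
    have : 4 * I.n * (∑ v, combinedWeight I.cost w l v + 1) ≤
        4 * N * ((∑ v, I.cost v) * (4 * (N * N) + 1) + 4 * (N * N) + 1) := Nat.mul_le_mul (by omega) (by omega)
    unfold memoryBound
    omega
  have hE1 : ∑ v, combinedWeight I.cost w l v + 1 < Λ :=
    lt_of_le_of_lt (Nat.le_mul_of_pos_left _ (by omega)) hE'
  have hΛN : 4 * (N * N) + 4 * N + 1 ≤ Λ := by
    refine le_trans ?_ hΛ
    unfold memoryBound
    omega
  have hlt : Λ < 2 ^ Λ := Nat.lt_two_pow_self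
  have hl_le : l ≤ I.n := bitCount_le I.n
  have h0 : (State.start I.encode).arr 0 = I.word := by
    funext i
    simp [State.start, Input.word]
  have hx := I.graphData
  have hs : (State.start I.encode).Bdd Λ := by
    refine ⟨fun r => by simp [State.start], fun a i => ?_⟩
    simp only [State.start]
    split
    · exact (I.word_lt i).trans_le (Nat.pow_le_pow_right (by norm_num) (by omega))
    · positivity
  have h1 : (Expr.load 0 0).eval (State.start I.encode) = I.n := by
    rw [Expr.eval_load, h0]; exact hx.card
  refine Runs.asg_seq hs (hs.arr _ _) fun hb => ?_
  rw [h1] at hb ⊢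
  refine Runs.asg_seq hb (by simp; omega) fun hb => ?_
  generalize hs₁ : State.setReg _ 2 _ = s₁ at hb ⊢
  replace hs₁ := hs₁.symm
  have e1 : s₁.reg 1 = I.n := by simp [hs₁]
  have e2 : s₁.reg 2 = I.n * I.n := by simp [hs₁]
  have e0 : s₁.arr 0 = I.word := by rw [hs₁]; exact h0
  have er0 : s₁.reg 0 = 0 := by rw [hs₁]; simp [State.start]
  have et : s₁.tossed = 0 := by rw [hs₁]; rfl
  clear hs₁
  refine Runs.seq (bitCountProg_spec hb e1 hpos (by omega) fun s' _ _ h h' =>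
    show s'.reg 3 = l ∧ s'.reg 4 = 2 ^ l from ⟨h, h'⟩) fun s₂ hb₂ hf₂ h₂ => ?_
  refine Runs.seq (coinProg_spec hb₂ (by rw [hf₂.reg 1 rfl, e1]) h₂.1 (by rw [hf₂.tossed rfl, et])
    (by omega) (by omega) fun s' _ _ h => show ∀ v : Fin I.n, s'.arr 6 v = w v from h)
    fun s₃ hb₃ hf₃ h₃ => ?_
  have e1₃ : s₃.reg 1 = I.n := by rw [hf₃.reg 1 rfl, hf₂.reg 1 rfl, e1]
  have e2₃ : s₃.reg 2 = I.n * I.n := by rw [hf₃.reg 2 rfl, hf₂.reg 2 rfl, e2]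
  have e0₃ : s₃.arr 0 = I.word := by rw [hf₃.arr 0 rfl, hf₂.arr 0 rfl, e0]
  refine Runs.seq (weightTableProg_spec hb₃ e1₃ e2₃ (by rw [hf₃.reg 4 rfl, h₂.2])
    (fun v => by rw [e0₃]; exact hx.cost v) h₃ hpos (by omega) hE' fun s' _ _ h =>
      show Tables (combinedWeight I.cost w l) l s' from h) fun s₄ hb₄ hf₄ h₄ => ?_
  have e0₄ : s₄.arr 0 = I.word := by rw [hf₄.arr 0 rfl, e0₃]
  have er0₄ : s₄.reg 0 = 0 := by rw [hf₄.reg 0 rfl, hf₃.reg 0 rfl, hf₂.reg 0 rfl, er0]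
  refine Runs.seq (pairProg_spec hb₄ h₄.r1 h₄.r2 e0₄ hx er0₄ (by omega) fun s' _ _ h =>
    show s'.reg 0 ≠ 0 ↔ _ from h) fun s₅ hb₅ hf₅ h₅ => ?_
  have hT₅ := h₄.of_frame hf₅ rfl
  have e0₅ : s₅.arr 0 = I.word := by rw [hf₅.arr 0 rfl, e0₄]
  have ev : (1 + Expr.reg 2 + .reg 1 + 3 : Expr).eval s₅ = I.address 0 := by
    simp [hT₅.r1, hT₅.r2, I.address_zero]
  refine Runs.asg_seq hb₅ (by rw [ev, I.address_zero]; omega) fun hb => ?_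
  rw [ev] at hb ⊢
  have ev' : (Expr.load 0 (1 + .reg 2 + .reg 1 + 2)).eval (s₅.setReg 10 (I.address 0)) =
      I.decs.length := by
    rw [← I.word_length, ← e0₅]
    simp [hT₅.r1, hT₅.r2]
  have hdecs : I.decs.length ≤ N :=
    ((I.le_address _ le_rfl).trans (I.address_le _)).trans hlen
  refine Runs.asg_seq hb (hb.arr _ _) fun hb => ?_
  rw [ev'] at hb ⊢
  -- After `j` rounds the answer covers the pairs and the first `j` decompositions.
  refine Runs.loop (N := I.decs.length) (I := fun j s' => s'.reg 10 = I.address j ∧ (s'.reg 0 ≠ 0 ↔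
    (∃ u v, PairAccepts I.graph I.cost I.budget u v) ∨ ∃ D ∈ I.decs.take j,
      NodeAccepts I.graph I.cost I.budget w l D.1.1)) hb (by simp) (show _ ≤ Λ by omega) rfl
    (fun j s' a h => by simpa using h) ⟨by simp, by simpa using h₅⟩ ?_
    (fun s' _ _ h => by rw [h.2, List.take_length]; rfl)
  intro j hj s' hb' hf hr hI
  have hT : Tables (combinedWeight I.cost w l) l s' := by
    have : Tables (combinedWeight I.cost w l) l
        ((s₅.setReg 10 (I.address 0)).setReg 11 I.decs.length) :=
      ⟨by simp [hT₅.r1], by simp [hT₅.r2], by simp [hT₅.r5], by simp [hT₅.r7], by simp [hT₅.r8],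
        by simp [hT₅.r9], fun v => by simp [hT₅.weight]⟩
    exact this.of_frame hf rfl
  have ha : I.address (j + 1) ≤ N := (I.address_le _).trans hlen
  have hs := I.address_succ hj
  have hsize : (I.decs[j].2.size + 1) * I.n = I.decs[j].2.size * I.n + I.n := by ring
  refine decProg_spec (k := k) hb' hT hI.1 (by rw [hf.arr 0 rfl]; exact e0₅) hx (I.decData hj)
    I.decs[j].1.2.2 (hk _ (List.getElem_mem hj)) hK hpos (by omega) (by omega) (by omega) (by omega)
    hE1 (by omega) fun s₆ _ _ h h' => ⟨by rw [h', hs], ?_⟩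
  rw [h, hI.2, List.take_add_one, List.getElem?_eq_getElem hj]
  simp only [List.mem_append, Option.toList_some, List.mem_singleton, or_and_right, exists_or,
    exists_eq_left, or_assoc]

/-! ### The main theorem -/

theorem eval_mono (p : Polynomial ℕ) {a b : ℕ} (h : a ≤ b) : p.eval a ≤ p.eval b := by
  rw [Polynomial.eval_eq_sum, Polynomial.eval_eq_sum]
  exact Finset.sum_le_sum fun i _ => Nat.mul_le_mul_left _ (Nat.pow_le_pow_left h i)

theorem memoryBound_mono (N : ℕ) {C C' : ℕ} (h : C ≤ C') : memoryBound N C ≤ memoryBound N C' := by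
  unfold memoryBound
  gcongr

/-- Representatives embed the parts into the vertices, so no bag has more than `n` elements.
Correctness can thus be stated without any assumption on the width. -/
theorem Input.widthAtMost (I : Input) : ∀ D ∈ I.decs, D.2.WidthAtMost I.n := by
  intro D _ t
  have := card_finset_fin_le
    ((D.2.bag t).map (representativeEmbedding I.graph D.1.1 I.cost).toEmbedding)
  rw [Finset.card_map] at this
  omega

theorem Input.n_le_bitLength (I : Input) : I.n ≤ bitLength I.encode := by
  have := I.length_encode
  have := Input.length_le_bitLength I.encode
  omega

/-- The program halts on every outcome of the coins, and determinism (`Exec.unique`) identifies any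
accepting run with the one described by its specification. -/
theorem accepts_mainProg_iff (I : Input) (ω : ℕ → Bool) :
    Accepts mainProg.compile ω I.encode ↔
      I.Answer (coinWeight ω (bitCount I.n)) (bitCount I.n) := by
  obtain ⟨t, s, h, -, -, -, hs⟩ := mainProg_spec I (ω := ω) I.widthAtMost le_rfl le_rfl
  rw [← hs]
  refine ⟨fun ⟨t', s', h', hs'⟩ => ?_, fun hs => ⟨t, s, h, hs⟩⟩
  rwa [(h.unique h').2]

/-- The bit length bounds both `n` and, through `p`, the total cost; substituting these into the
memory bound makes `Λ` a polynomial in the bit length. -/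
theorem haltsWithin_mainProg (p : Polynomial ℕ) : ∃ q : Polynomial ℕ, ∀ (I : Input) (k : ℕ),
    (∀ v, I.cost v ≤ p.eval I.n) → (∀ D ∈ I.decs, D.2.WidthAtMost k) → ∀ ω : ℕ → Bool,
      HaltsWithin mainProg.compile ω I.encode (4 ^ k * q.eval (bitLength I.encode)) := by
  obtain ⟨q, hq⟩ := LP.exists_timeBound_le mainProg
  let b : Polynomial ℕ := 4 * .X * (.X * p * (4 * (.X * .X) + 1) + 4 * (.X * .X) + 1) +
    4 * (.X * .X) + 4 * .X + 1
  refine ⟨4 * q.comp b, fun I k hc hk ω => ?_⟩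
  set N := bitLength I.encode
  have hb : b.eval N = memoryBound N (N * p.eval N) := by simp [b, memoryBound]
  have hsum : ∑ v, I.cost v ≤ N * p.eval N :=
    calc ∑ v, I.cost v ≤ ∑ _v : Fin I.n, p.eval I.n := Finset.sum_le_sum fun v _ => hc v
      _ = I.n * p.eval I.n := by simp
      _ ≤ N * p.eval N := Nat.mul_le_mul I.n_le_bitLength (eval_mono p I.n_le_bitLength)
  obtain ⟨t, s, h, ht, -⟩ := mainProg_spec I (ω := ω) hk le_rfl (memoryBound_mono N hsum)
  refine ⟨t, s, h, ht.trans ((hq _ _ (Nat.one_le_pow _ _ (by norm_num))).trans (le_of_eq ?_))⟩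
  -- Big loops are not nested, so `K = 4 ^ (k + 1)` enters once; the extra factor 4 goes into the
  -- polynomial.
  rw [show mainProg.bigDepth = 1 from rfl, Polynomial.eval_mul, Polynomial.eval_comp, hb, pow_one,
    pow_succ, mul_assoc]
  simp

end CDSModTW

theorem mainTheorem6 :
    -- the Monte-Carlo algorithm
    (∃ A : Program,
      -- no false positives
      (∀ (I : Input) (ω : ℕ → Bool),
        Accepts A ω I.encode → HasCDS I.graph I.cost I.budget) ∧
      -- false negatives with probability at most one half
      (∀ I : Input, HasCDS I.graph I.cost I.budget →
        coinMeasure {ω | ¬ Accepts A ω I.encode} ≤ 1 / 2) ∧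
      -- running time, for polynomially bounded costs
      (∀ p : Polynomial ℕ, ∃ q : Polynomial ℕ, ∀ (I : Input) (k : ℕ),
        (∀ v, I.cost v ≤ p.eval I.n) → (∀ D ∈ I.decs, D.2.WidthAtMost k) →
        ∀ ω : ℕ → Bool,
          HaltsWithin A ω I.encode (4 ^ k * q.eval (bitLength I.encode)))) ∧
    -- the recursion at series nodes
    (∀ (V : Type) [Fintype V] (G : SimpleGraph V) (c : V → ℕ), IsSeries G →
      (∀ b : ℤ, HasCDS G c b ↔
        (∃ M ∈ canonicalPartition G, ∃ N ∈ canonicalPartition G, M ≠ N ∧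
          ∃ x ∈ M, ∃ y ∈ N, ((c x + c y : ℕ) : ℤ) ≤ b) ∨
        ∃ M ∈ canonicalPartition G, HasCDS (G.induce M) (fun v => c v) b) ∧
      (∀ w : V → ℕ, Isolates w (optimumCDS G c) →
        ∀ X, IsMinWeight w (optimumCDS G c) X →
        ∀ M ∈ canonicalPartition G, (X : Set V) ⊆ M →
          Isolates (fun v : M => w v) (optimumCDS (G.induce M) (fun v => c v)))) ∧
    -- the reduction to the quotient graph at prime nodes
    (∀ (V : Type) [Fintype V] [DecidableEq V] (G : SimpleGraph V) (c w : V → ℕ)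
      (r : canonicalPartition G → V),
      IsPrimeGraph (modularQuotient G) → (∀ v, 0 < c v) →
      (∀ M, r M ∈ M.1 ∧ ∀ u ∈ M.1, toLex (c (r M), w (r M)) ≤ toLex (c u, w u)) →
      (∀ X ∈ optimumCDS G c, IsCDS (modularQuotient G) (projection G X) ∧
        ∑ M ∈ projection G X, c (r M) = ∑ v ∈ X, c v) ∧
      (∀ X ∈ optimumCDS (modularQuotient G) (fun M => c (r M)), IsCDS G (X.image r) ∧
        ∑ v ∈ X.image r, c v = ∑ M ∈ X, c (r M)) ∧
      (Isolates w (optimumCDS G c) →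
        Isolates (fun M => w (r M))
          (optimumCDS (modularQuotient G) (fun M => c (r M))))) := by
  refine ⟨⟨mainProg.compile, fun I ω h => ?_, fun I h => ?_, haltsWithin_mainProg⟩,
    fun V _ G c hG => ⟨fun b => hG.hasCDS_iff c b, fun w hw X hX M hM hXM =>
      hG.isolates hw hX hM hXM⟩,
    fun V _ _ G c w r hG hc hr => ⟨fun X hX => ⟨hX.1.projection hG, (sum_projection hG hc hr hX).1⟩,
      fun X hX => ?_, isolates_quotient hG hc hr⟩⟩
  · exact Input.Answer.hasCDS (fun v => bitsValue_lt _ _ _) ((accepts_mainProg_iff I ω).1 h)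
  · simp only [accepts_mainProg_iff]
    exact Input.coinMeasure_not_answer_le h (two_mul_le_pow_bitCount I.n)
  · have hr' : ∀ M, r M ∈ M.1 := fun M => (hr M).1
    -- Parts are disjoint, so choosing one vertex in each is injective and no cost is lost in the
    -- image.
    have himage : X.image r = X.map (quotientEmbedding r hr').toEmbedding := by
      rw [Finset.map_eq_image]
      rfl
    rw [himage]
    exact ⟨hX.1.map_quotient hG r hr', sum_map_quotientEmbedding hr' X c⟩
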